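/- Let $\Sigma$ be a finite alphabet and let $T\in\{BS,B,S\}$. An infinite sequence of natural numbers is *bounded* if it has an upper bound, and *strongly unbounded* if it tends to infinity. **Expressions.** A *word sequence* $\vec u=\langle u_0,u_1,\dots\rangle$ is a finite or infinite sequence of finite words over $\Sigma$; $|\vec u|$ denotes its length. For languages $K,L$ of word sequences let - $K\cdot L=\{\langle u_0v_0,u_1v_1,\dots\rangle : \vec u\in K,\ \vec v\in L,\ |\vec u|=|\vec v|\}$; - $K+L$ (the mix) be the set of all $\vec w$ for which there are $\vec u\in K$, $\vec v\in L$ with $|\vec w|=\max(|\vec u|,|\vec v|)$ such that for every $i<|\vec w|$, either $i<|\vec u|$ and $w_i=u_i$, or $i<|\vec v|$ and $w_i=v_i$; - $L^*$ be the set of all $\langle u_0\cdots u_{g(0)-1},\,u_{g(0)}\cdots u_{g(1)-1},\dots\rangle$, of length $|g|$, with $\vec u\in L$ and $g$ a finite or infinite non-decreasing sequence of natural numbers all of whose terms are at most $|\vec u|$; $L^B$ (respectively $L^S$) is defined in the same way, with the additional requirement that the sequence of differences $g(i+1)-g(i)$ is finite or bounded (respectively, finite or strongly unbounded). $BS$-regular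 expressions are given by $e::=\emptyset\mid\varepsilon\mid\bar\varepsilon\mid a\mid e\cdot e\mid e+e\mid e^*\mid e^B\mid e^S$ with $a\in\Sigma$. Here $[\![\emptyset]\!]=\{\langle\rangle\}$; $[\![\varepsilon]\!]$ is the set of all, and $[\![\bar\varepsilon]\!]$ that of all finite, word sequences all of whose words are empty; $[\![a]\!]$ is the set of all word sequences all of whose words equal $a$; the other constructors are interpreted by the operations above. A $B$-regular (respectively $S$-regular) expression is one in which the exponent $S$ (respectively $B$) does not occur. For a language $L$ of word sequences, $L^\omega$ is the set of $\omega$-words $u_0u_1u_2\cdots$ with $\vec u\in L$ infinite and $u_i$ nonempty for infinitely many $i$. A language of $\omega$-words is *$\omega T$-regular* if it is of the form $\bigcup_{i=1}^n M_i\cdot[\![f_i]\!]^\omega$, where $n\ge 0$, each $M_i$ is the language of finite words of a standard regular expression, and each $f_i$ is a $T$-regular expression. **Automata.** An *$\omega BS$-automaton* consists of a finite set $Q$ of states, an initial state $q_I\in Q$, disjoint finite sets $\Gamma_B,\Gamma_S$ of counters with union $\Gamma$, and, for each $a\in\Sigma$, a transition relation $\delta_a\subseteq Q\times\{\mathrm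 i,\mathrm r,\epsilon\}^\Gamma\times Q$ (each counter is incremented, reset, or left unchanged). It is an *$\omega B$-automaton* if $\Gamma_S=\emptyset$, and an *$\omega S$-automaton* if $\Gamma_B=\emptyset$. A run over $a_1a_2\cdots$ is a sequence of transitions $t_1t_2\cdots$ with $t_i\in\delta_{a_i}$ such that the target of $t_i$ is the source of $t_{i+1}$. It is accepting if the source of $t_1$ is $q_I$ and every counter $\alpha$ is reset infinitely often and the sequence of the numbers of increments of $\alpha$ before its first reset, between its first and second resets, and so on, is bounded if $\alpha\in\Gamma_B$, and strongly unbounded if $\alpha\in\Gamma_S$. The automaton recognizes the set of $\omega$-words that have an accepting run. It is *hierarchical* if $\Gamma=\{1,\dots,n\}$ for some $n\ge0$ and every transition that increments or resets a counter $i>1$ resets the counters $1,\dots,i-1$. **Theorem.** For every language $L\subseteq\Sigma^\omega$ the following are equivalent: 1. $L$ is $\omega T$-regular; 2. $L$ is recognized by a hierarchical $\omega T$-automaton; 3. $L$ is recognized by an $\omega T$-automaton. -/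

import Mathlib

/-! Languages of word sequences, `ωBS`-regular expressions, `ωBS`-automata. -/

namespace OmegaBS

open Filter

/-! ### Asymptotic behaviour of sequences of natural numbers -/

/-- An infinite sequence of natural numbers is bounded. -/
def Bounded (f : ℕ → ℕ) : Prop := ∃ N, ∀ i, f i ≤ N

/-- An infinite sequence of natural numbers is strongly unbounded: it tends to infinity. -/
def StronglyUnbounded (f : ℕ → ℕ) : Prop := Tendsto f atTop atTop

/-- A finite or infinite sequence of natural numbers is non-decreasing. -/
def NonDecreasing (g : Stream'.Seq ℕ) : Prop :=
  ∀ i j a b, i ≤ j → g.get? i = some a → g.get? j = some b → a ≤ b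

/-- The sequence of differences `g (i + 1) - g i`, for `i + 1 < |g|`
(only used for non-decreasing `g`). -/
def diff (g : Stream'.Seq ℕ) : Stream'.Seq ℕ :=
  Stream'.Seq.zipWith (fun a b => b - a) g g.tail

/-- The sequence is finite, or it is infinite and satisfies `P`. -/
def FiniteOr (P : (ℕ → ℕ) → Prop) (g : Stream'.Seq ℕ) : Prop :=
  g.Terminates ∨ ∃ f : ℕ → ℕ, (∀ i, g.get? i = some (f i)) ∧ P f

/-- Bounded difference. -/
def BoundedDiff (g : Stream'.Seq ℕ) : Prop := FiniteOr Bounded (diff g)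

/-- Strongly unbounded difference. -/
def StronglyUnboundedDiff (g : Stream'.Seq ℕ) : Prop := FiniteOr StronglyUnbounded (diff g)

/-! ### Word sequences and operations on languages of word sequences -/

/-- A word sequence: a finite or infinite sequence of finite words. -/
abbrev WordSeq (α : Type*) := Stream'.Seq (List α)

variable {α : Type*}

/-- Coordinatewise concatenation of word sequences of the same length. -/
def concat (K L : Set (WordSeq α)) : Set (WordSeq α) :=
  {w | ∃ u ∈ K, ∃ v ∈ L, u.length' = v.length' ∧
    w = Stream'.Seq.zipWith (fun x y => x ++ y) u v}

/-- The mix of two languages of word sequences: every coordinate of the result is the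
corresponding coordinate of one of the two given sequences (where it exists). -/
def mix (K L : Set (WordSeq α)) : Set (WordSeq α) :=
  {w | ∃ u ∈ K, ∃ v ∈ L, w.length' = max u.length' v.length' ∧
    ∀ i x, w.get? i = some x → u.get? i = some x ∨ v.get? i = some x}

/-- The word `u_a u_{a+1} … u_{b-1}`, for `a ≤ b ≤ |u|`. -/
def block (u : WordSeq α) (a b : ℕ) : List α := (Stream'.Seq.take (b - a) (u.drop a)).flatten

/-- The word sequence `⟨u_0 … u_{g(0)-1}, u_{g(0)} … u_{g(1)-1}, …⟩`, of the same length
as `g`. -/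
def blocks (u : WordSeq α) (g : Stream'.Seq ℕ) : WordSeq α :=
  Stream'.Seq.zipWith (block u) (Stream'.Seq.cons 0 g) g

/-- Grouping the words of sequences of `L` into blocks, along non-decreasing sequences
`g ≤ |u|` that satisfy `P`. -/
def group (P : Stream'.Seq ℕ → Prop) (L : Set (WordSeq α)) : Set (WordSeq α) :=
  {w | ∃ u ∈ L, ∃ g : Stream'.Seq ℕ, (∀ i a, g.get? i = some a → (a : ℕ∞) ≤ u.length') ∧
    NonDecreasing g ∧ P g ∧ w = blocks u g}

/-! ### Expressions -/

/-- The three variants `BS`, `B`, `S`. -/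
inductive Variant
  | BS
  | B
  | S

/-- Is the exponent (or the counter type) `B` allowed in the given variant? -/
def Variant.AllowsB (T : Variant) : Prop := T = .BS ∨ T = .B

/-- Is the exponent (or the counter type) `S` allowed in the given variant? -/
def Variant.AllowsS (T : Variant) : Prop := T = .BS ∨ T = .S

/-- `BS`-regular expressions; `finEps` is the constant for finite sequences of empty words. -/
inductive BSExpr (α : Type*)
  | empty : BSExpr α
  | eps : BSExpr α
  | finEps : BSExpr α
  | letter (a : α) : BSExpr α
  | concat (e f : BSExpr α) : BSExpr α
  | mix (e f : BSExpr α) : BSExpr α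
  | star (e : BSExpr α) : BSExpr α
  | bexp (e : BSExpr α) : BSExpr α
  | sexp (e : BSExpr α) : BSExpr α

/-- The language of word sequences described by a `BS`-regular expression. -/
def BSExpr.lang : BSExpr α → Set (WordSeq α)
  | .empty => {Stream'.Seq.nil}
  | .eps => {u | ∀ i x, u.get? i = some x → x = []}
  | .finEps => {u | u.Terminates ∧ ∀ i x, u.get? i = some x → x = []}
  | .letter a => {u | ∀ i x, u.get? i = some x → x = [a]}
  | .concat e f => OmegaBS.concat e.lang f.lang
  | .mix e f => OmegaBS.mix e.lang f.lang
  | .star e => group (fun _ => True) e.lang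
  | .bexp e => group BoundedDiff e.lang
  | .sexp e => group StronglyUnboundedDiff e.lang

/-- `T`-regular expressions: the exponents used are those allowed by `T`. -/
def BSExpr.IsVariant (T : Variant) : BSExpr α → Prop
  | .empty => True
  | .eps => True
  | .finEps => True
  | .letter _ => True
  | .concat e f => e.IsVariant T ∧ f.IsVariant T
  | .mix e f => e.IsVariant T ∧ f.IsVariant T
  | .star e => e.IsVariant T
  | .bexp e => T.AllowsB ∧ e.IsVariant T
  | .sexp e => T.AllowsS ∧ e.IsVariant T

/-- The `ω`-word `x` is the concatenation `u_0 u_1 …` of the word sequence `u`, which has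
nonempty words on infinitely many coordinates. -/
def IsOmegaPower (u : WordSeq α) (x : Stream' α) : Prop :=
  (∃ᶠ i in atTop, ∃ v, u.get? i = some v ∧ v ≠ []) ∧
    ∀ n, (Stream'.Seq.take n u).flatten = x.take (Stream'.Seq.take n u).flatten.length

/-- The `ω`-power of a language of word sequences. -/
def omegaPower (L : Set (WordSeq α)) : Set (Stream' α) := {x | ∃ u ∈ L, IsOmegaPower u x}

/-- An `ωBS`-regular expression: a finite sum of terms `e · f ^ ω`, where `e` is a regular
expression and `f` is a `BS`-regular expression. -/
abbrev OmegaExpr (α : Type*) := List (RegularExpression α × BSExpr α)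

/-- The language of `ω`-words described by an `ωBS`-regular expression. -/
def OmegaExpr.lang (E : OmegaExpr α) : Set (Stream' α) :=
  {x | ∃ p ∈ E, ∃ v ∈ p.1.matches', ∃ y ∈ omegaPower p.2.lang, x = v ++ₛ y}

/-- A language of `ω`-words is `ωT`-regular. -/
def IsOmegaRegular (T : Variant) (L : Set (Stream' α)) : Prop :=
  ∃ E : OmegaExpr α, (∀ p ∈ E, p.2.IsVariant T) ∧ OmegaExpr.lang E = L

/-! ### Automata -/

/-- The two types of counters. -/
inductive CounterType
  | B
  | S

/-- What a transition does to a counter: increment, reset, or nothing. -/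
inductive Action
  | inc
  | reset
  | none

/-- A transition with states `Q` and counters `Γ`: source, counter actions, target. -/
structure Transition (Q Γ : Type) where
  source : Q
  action : Γ → Action
  target : Q

/-- `ωBS`-automata with input alphabet `α` and set of counters `Γ`; each counter is either a
`B`-counter or an `S`-counter. -/
structure Automaton (α : Type*) (Γ : Type) where
  State : Type
  finite_state : Finite State
  init : State
  type : Γ → CounterType
  δ : α → Set (Transition State Γ)

section
variable {Γ Q : Type}

/-- The set of positions at which the counter `c` is reset. -/
def resetPositions (ρ : ℕ → Transition Q Γ) (c : Γ) : Set ℕ := {k | (ρ k).action c = .reset}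

/-- The position following the `(i-1)`-st reset of `c`, or `0` if `i = 0`. -/
noncomputable def segmentStart (ρ : ℕ → Transition Q Γ) (c : Γ) : ℕ → ℕ
  | 0 => 0
  | i + 1 => Nat.nth (· ∈ resetPositions ρ c) i + 1

/-- The sequence of the numbers of increments of `c` between consecutive resets of `c`
(only used if `c` is reset infinitely often); its first term counts the increments before
the first reset. -/
noncomputable def counterValues (ρ : ℕ → Transition Q Γ) (c : Γ) (i : ℕ) : ℕ :=
  {k | segmentStart ρ c i ≤ k ∧ k < Nat.nth (· ∈ resetPositions ρ c) i ∧
    (ρ k).action c = .inc}.ncard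

/-- The asymptotic condition attached to a type of counters. -/
def CounterType.Condition : CounterType → (ℕ → ℕ) → Prop
  | .B => Bounded
  | .S => StronglyUnbounded

/-- `ρ` is a run of `A` over the `ω`-word `x`. -/
def Automaton.IsRun (A : Automaton α Γ) (x : Stream' α) (ρ : ℕ → Transition A.State Γ) : Prop :=
  (∀ i, ρ i ∈ A.δ (x.get i)) ∧ ∀ i, (ρ i).target = (ρ (i + 1)).source

/-- The run `ρ` is accepting. -/
def Automaton.IsAccepting (A : Automaton α Γ) (ρ : ℕ → Transition A.State Γ) : Prop :=
  (ρ 0).source = A.init ∧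
    ∀ c, (resetPositions ρ c).Infinite ∧ (A.type c).Condition (counterValues ρ c)

/-- The language recognized by an automaton. -/
def Automaton.lang (A : Automaton α Γ) : Set (Stream' α) :=
  {x | ∃ ρ, A.IsRun x ρ ∧ A.IsAccepting ρ}

/-- `A` is an `ωT`-automaton: all counters are of a type allowed by `T`. -/
def Automaton.IsVariant (T : Variant) (A : Automaton α Γ) : Prop :=
  ∀ c, (A.type c = .B → T.AllowsB) ∧ (A.type c = .S → T.AllowsS)

/-- An automaton with the linearly ordered counters `0, …, n - 1` is hierarchical: whenever a
counter is incremented or reset, all smaller counters are reset. -/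
def Automaton.IsHierarchical {n : ℕ} (A : Automaton α (Fin n)) : Prop :=
  ∀ a, ∀ t ∈ A.δ a, ∀ i, t.action i = .inc ∨ t.action i = .reset →
    ∀ j, j < i → t.action j = .reset

end

/-- A language of `ω`-words is recognized by an `ωT`-automaton. -/
def IsRecognized (T : Variant) (L : Set (Stream' α)) : Prop :=
  ∃ (Γ : Type) (_ : Finite Γ) (A : Automaton α Γ), A.IsVariant T ∧ A.lang = L

/-- A language of `ω`-words is recognized by a hierarchical `ωT`-automaton. -/
def IsHierarchicallyRecognized (T : Variant) (L : Set (Stream' α)) : Prop :=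
  ∃ (n : ℕ) (A : Automaton α (Fin n)), A.IsHierarchical ∧ A.IsVariant T ∧ A.lang = L

end OmegaBS

/-! Asymptotic conditions are replaced by conditions on finite words. Each expression `e` yields
ordinary languages `e.val b s`: the words obtained with all exponents `B` at most `b` and all
exponents `S` at least `s`. A word sequence belongs to `e.lang` iff, for one bound `N`, all its
words lie in `e.val N 0` and, for every `s`, all but finitely many lie in `e.val N s`
(`BSExpr.lang_eq`). An `ω`-regular language is therefore a finite union of sets `omegaTerm M R`:
words cut into a prefix in `M` and nonempty blocks obeying such a condition (`lang_eq_omegaTerm`).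
Only the behaviour of `R` up to corrections of bound and threshold matters, which is the relation
`Represents`; a complete correction may cost finitely many blocks, and these are moved into the
prefix.

From automata to expressions. An accepting run is cut at infinitely many positions with the same
state and the same Boolean certificates, one for each counter, such that every counter is reset
between cuts (`mem_omegaTerm_of_mem_lang`, `lang_of_mem_omegaTerm`). The certificate of an
`S`-counter promises that its value at the cut is already large. The words read between cuts are
shown to form a definable language by induction on the profile of the run, i.e. on which counters
are untouched, only incremented, or reset (`Definable.runLang_profile`). A run of profile `T` is a
sequence of minimal runs of profile `T` followed by a run of smaller profile. If a `B`-counter is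
incremented and never reset, the number of these blocks is bounded; an `S`-counter that must become
large without a reset does so within one block or the tail, or because there are many blocks.
Kleene's construction on the finite graph of states and certificates, with the matching constraint
on path lengths, gives the expression.

From expressions to hierarchical automata. Exponents are nested loops, each counted by a counter
above those of its body. The obstacle is a sum below an exponent: an idle `B`-counter is harmless,
but an idle `S`-counter has value zero. Counters are therefore arranged in groups of `M` counters of
type `B` followed by one of type `S`, and an expression is written as a sum of pieces, the piece of
grade `k` using all of the first `k` groups (`BSExpr.exists_graded`). Identities for the iteration
of a sum keep this form. At the level of `ω`-words the grades merge, because consecutive blocks may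
be grouped into longer and longer ones, so that a further `S`-counter can count them
(`Graded.exists_merge`). One automaton with a counter that is reset exactly at the ends of blocks
then recognizes the term (`BlockAut.omegaLang_loop`). -/

namespace OmegaBS

/-! ### Cost languages, their comparison, and the cost language of an expression. -/

open Filter

variable {α : Type*}

/-! ### Languages with a bound and a threshold -/

/-- A language of words depending on a bound `b` (for `B`-values) and on a threshold `s`
(for `S`-values). -/
abbrev CostLang (α : Type*) := ℕ → ℕ → Language α

/-- Weakening the constraints enlarges the language. -/
def CostMono (R : CostLang α) : Prop :=
  ∀ ⦃b b' s s' : ℕ⦄, b ≤ b' → s' ≤ s → ∀ w ∈ R b s, w ∈ R b' s'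

/-- A constraint on the number of factors of an iteration. -/
abbrev CountCond := ℕ → ℕ → ℕ → Prop

/-- Weakening the constraints preserves a condition on the number of factors. -/
def CountMono (P : CountCond) : Prop :=
  ∀ ⦃b b' s s' k : ℕ⦄, b ≤ b' → s' ≤ s → P b s k → P b' s' k

/-- Concatenations of words of `R`, where the number of factors satisfies `P`. -/
def iter (P : CountCond) (R : CostLang α) : CostLang α := fun b s =>
  {w | ∃ l : List (List α), l.flatten = w ∧ (∀ u ∈ l, u ∈ R b s) ∧ P b s l.length}

/-- No constraint on the number of factors. -/
def anyCount : CountCond := fun _ _ _ => True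

/-- At most `b` factors. -/
def atMost : CountCond := fun b _ k => k ≤ b

/-- At least `s` factors. -/
def atLeast : CountCond := fun _ s k => s ≤ k

/-- At least one factor. -/
def posCount : CountCond := fun _ _ k => 1 ≤ k

/-- At least one and at most `b + 1` factors. -/
def posAtMost : CountCond := fun b _ k => 1 ≤ k ∧ k ≤ b + 1

/-- At least `s + 1` factors. -/
def posAtLeast : CountCond := fun _ s k => s + 1 ≤ k

theorem countMono_anyCount : CountMono anyCount := fun _ _ _ _ _ _ _ h => h

theorem countMono_atMost : CountMono atMost := fun _ _ _ _ _ hb _ h => le_trans h hb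

theorem countMono_atLeast : CountMono atLeast := fun _ _ _ _ _ _ hs h => le_trans hs h

theorem countMono_posCount : CountMono posCount := fun _ _ _ _ _ _ _ h => h

theorem countMono_posAtMost : CountMono posAtMost := fun _ _ _ _ _ hb _ h =>
  ⟨h.1, h.2.trans (by omega)⟩

theorem countMono_posAtLeast : CountMono posAtLeast := fun _ _ _ _ _ _ hs h =>
  le_trans (by omega) h

theorem mem_iter {P : CountCond} {R : CostLang α} {b s : ℕ} {w : List α} :
    w ∈ iter P R b s ↔ ∃ l : List (List α), l.flatten = w ∧ (∀ u ∈ l, u ∈ R b s) ∧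
      P b s l.length := Iff.rfl

theorem mem_add_apply {R R' : CostLang α} {b s : ℕ} {w : List α} :
    w ∈ (R + R') b s ↔ w ∈ R b s ∨ w ∈ R' b s := Iff.rfl

theorem mem_one_apply {b s : ℕ} {w : List α} : w ∈ (1 : CostLang α) b s ↔ w = [] := Iff.rfl

theorem CostMono.zero : CostMono (0 : CostLang α) := fun _ _ _ _ _ _ _ h => h

theorem CostMono.one : CostMono (1 : CostLang α) := fun _ _ _ _ _ _ _ h => h

theorem CostMono.add {R R' : CostLang α} (h : CostMono R) (h' : CostMono R') :
    CostMono (R + R') := fun _ _ _ _ hb hs w hw =>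
  hw.imp (h hb hs w) (h' hb hs w)

theorem CostMono.mul {R R' : CostLang α} (h : CostMono R) (h' : CostMono R') :
    CostMono (R * R') := by
  rintro _ _ _ _ hb hs w ⟨u, hu, v, hv, rfl⟩
  exact ⟨u, h hb hs u hu, v, h' hb hs v hv, rfl⟩

theorem CostMono.iter {P : CountCond} {R : CostLang α} (hP : CountMono P) (h : CostMono R) :
    CostMono (iter P R) := by
  rintro _ _ _ _ hb hs w ⟨l, rfl, hl, hn⟩
  exact ⟨l, rfl, fun u hu => h hb hs u (hl u hu), hP hb hs hn⟩

/-- `X` can be used instead of `R` in languages of word sequences: words of `X` are words of `R`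
with the same threshold and a corrected bound, and words of `R` are words of `X` with a
corrected bound and a corrected threshold. -/
structure Represents (X R : CostLang α) : Prop where
  mono_left : CostMono X
  mono_right : CostMono R
  sound : ∀ b, ∃ b', ∀ s, ∀ w ∈ X b s, w ∈ R b' s
  complete : ∀ b, ∃ b', ∀ s', ∃ s, ∀ w ∈ R b s, w ∈ X b' s'

theorem Represents.refl {R : CostLang α} (h : CostMono R) : Represents R R :=
  ⟨h, h, fun b => ⟨b, fun _ _ => id⟩, fun b => ⟨b, fun s => ⟨s, fun _ => id⟩⟩⟩

theorem Represents.trans {X Y Z : CostLang α} (h : Represents X Y) (h' : Represents Y Z) :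
    Represents X Z := by
  refine ⟨h.mono_left, h'.mono_right, fun b => ?_, fun b => ?_⟩
  · obtain ⟨b1, h1⟩ := h.sound b
    obtain ⟨b2, h2⟩ := h'.sound b1
    exact ⟨b2, fun s w hw => h2 s w (h1 s w hw)⟩
  · obtain ⟨b1, h1⟩ := h'.complete b
    obtain ⟨b2, h2⟩ := h.complete b1
    refine ⟨b2, fun s' => ?_⟩
    obtain ⟨s1, h3⟩ := h2 s'
    obtain ⟨s2, h4⟩ := h1 s1
    exact ⟨s2, fun w hw => h3 w (h4 w hw)⟩

theorem Represents.add {X R X' R' : CostLang α} (h : Represents X R) (h' : Represents X' R') :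
    Represents (X + X') (R + R') := by
  refine ⟨h.mono_left.add h'.mono_left, h.mono_right.add h'.mono_right, fun b => ?_, fun b => ?_⟩
  · obtain ⟨b1, h1⟩ := h.sound b
    obtain ⟨b2, h2⟩ := h'.sound b
    exact ⟨max b1 b2, fun s w hw => hw.imp
      (fun hw => h.mono_right (le_max_left _ _) le_rfl w (h1 s w hw))
      (fun hw => h'.mono_right (le_max_right _ _) le_rfl w (h2 s w hw))⟩
  · obtain ⟨b1, h1⟩ := h.complete b
    obtain ⟨b2, h2⟩ := h'.complete b
    refine ⟨max b1 b2, fun s' => ?_⟩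
    obtain ⟨s1, h3⟩ := h1 s'
    obtain ⟨s2, h4⟩ := h2 s'
    refine ⟨max s1 s2, fun w hw => hw.imp (fun hw => ?_) (fun hw => ?_)⟩
    · exact h.mono_left (le_max_left _ _) le_rfl w
        (h3 w (h.mono_right le_rfl (le_max_left _ _) w hw))
    · exact h'.mono_left (le_max_right _ _) le_rfl w
        (h4 w (h'.mono_right le_rfl (le_max_right _ _) w hw))

theorem Represents.mul {X R X' R' : CostLang α} (h : Represents X R) (h' : Represents X' R') :
    Represents (X * X') (R * R') := by
  refine ⟨h.mono_left.mul h'.mono_left, h.mono_right.mul h'.mono_right, fun b => ?_, fun b => ?_⟩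
  · obtain ⟨b1, h1⟩ := h.sound b
    obtain ⟨b2, h2⟩ := h'.sound b
    refine ⟨max b1 b2, ?_⟩
    rintro s w ⟨u, hu, v, hv, rfl⟩
    exact ⟨u, h.mono_right (le_max_left _ _) le_rfl u (h1 s u hu), v,
      h'.mono_right (le_max_right _ _) le_rfl v (h2 s v hv), rfl⟩
  · obtain ⟨b1, h1⟩ := h.complete b
    obtain ⟨b2, h2⟩ := h'.complete b
    refine ⟨max b1 b2, fun s' => ?_⟩
    obtain ⟨s1, h3⟩ := h1 s'
    obtain ⟨s2, h4⟩ := h2 s'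
    refine ⟨max s1 s2, ?_⟩
    rintro w ⟨u, hu, v, hv, rfl⟩
    exact ⟨u, h.mono_left (le_max_left _ _) le_rfl u
        (h3 u (h.mono_right le_rfl (le_max_left _ _) u hu)), v,
      h'.mono_left (le_max_right _ _) le_rfl v
        (h4 v (h'.mono_right le_rfl (le_max_right _ _) v hv)), rfl⟩

theorem Represents.iter {X R : CostLang α} {P : CountCond} (hP : CountMono P)
    (h : Represents X R) : Represents (iter P X) (iter P R) := by
  refine ⟨h.mono_left.iter hP, h.mono_right.iter hP, fun b => ?_, fun b => ?_⟩
  · obtain ⟨b1, h1⟩ := h.sound b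
    refine ⟨max b b1, ?_⟩
    rintro s w ⟨l, rfl, hl, hn⟩
    exact ⟨l, rfl, fun u hu => h.mono_right (le_max_right _ _) le_rfl u (h1 s u (hl u hu)),
      hP (le_max_left _ _) le_rfl hn⟩
  · obtain ⟨b1, h1⟩ := h.complete b
    refine ⟨max b b1, fun s' => ?_⟩
    obtain ⟨s1, h3⟩ := h1 s'
    refine ⟨max s' s1, ?_⟩
    rintro w ⟨l, rfl, hl, hn⟩
    exact ⟨l, rfl, fun u hu => h.mono_left (le_max_right _ _) le_rfl u
      (h3 u (h.mono_right le_rfl (le_max_right _ _) u (hl u hu))),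
      hP (le_max_left _ _) (le_max_left _ _) hn⟩

/-! ### The costs of the words described by an expression -/

/-- The words described by an expression such that all exponents `B` are at most `b` and all
exponents `S` are at least `s`. -/
def BSExpr.val : BSExpr α → CostLang α
  | .empty => 0
  | .eps => 1
  -- An infinite sequence must eventually meet every threshold; a language that is empty for `s > 0`
  -- therefore admits only finite sequences.
  | .finEps => fun _ s => {w | w = [] ∧ s = 0}
  | .letter a => fun _ _ => {w | w = [a]}
  | .concat e f => e.val * f.val
  | .mix e f => e.val + f.val
  | .star e => iter anyCount e.val
  | .bexp e => iter atMost e.val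
  | .sexp e => iter atLeast e.val

theorem BSExpr.costMono_val (e : BSExpr α) : CostMono e.val := by
  induction e with
  | empty => exact CostMono.zero
  | eps => exact CostMono.one
  | finEps =>
    rintro b b' s s' _ hs w ⟨hw, rfl⟩
    exact ⟨hw, by omega⟩
  | letter a => exact fun _ _ _ _ _ _ _ h => h
  | concat e f he hf => exact he.mul hf
  | mix e f he hf => exact he.add hf
  | star e he => exact he.iter countMono_anyCount
  | bexp e he => exact he.iter countMono_atMost
  | sexp e he => exact he.iter countMono_atLeast

/-- The regular expression obtained by forgetting the constraints on exponents. -/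
def BSExpr.toRegular : BSExpr α → RegularExpression α
  | .empty => 0
  | .eps => 1
  | .finEps => 1
  | .letter a => .char a
  | .concat e f => e.toRegular * f.toRegular
  | .mix e f => e.toRegular + f.toRegular
  | .star e => e.toRegular.star
  | .bexp e => e.toRegular.star
  | .sexp e => e.toRegular.star

theorem CostMono.exists_forall_mem {R : CostLang α} (h : CostMono R) (l : List (List α))
    (hl : ∀ u ∈ l, ∃ b, u ∈ R b 0) : ∃ b, ∀ u ∈ l, u ∈ R b 0 := by
  induction l with
  | nil => exact ⟨0, by simp⟩
  | cons u l ih =>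
    obtain ⟨b, hb⟩ := hl u (by simp)
    obtain ⟨b', hb'⟩ := ih fun v hv => hl v (by simp [hv])
    refine ⟨max b b', ?_⟩
    rintro v (_ | ⟨_, hv⟩)
    · exact h (le_max_left _ _) le_rfl _ hb
    · exact h (le_max_right _ _) le_rfl _ (hb' v hv)

theorem CostMono.exists_mem_iter_iff {R : CostLang α} (h : CostMono R) {P : CountCond}
    (hm : CountMono P) (hP : ∀ k, ∃ b, P b 0 k) {w : List α} :
    (∃ b, w ∈ OmegaBS.iter P R b 0) ↔
      ∃ l : List (List α), w = l.flatten ∧ ∀ u ∈ l, ∃ b, u ∈ R b 0 := by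
  constructor
  · rintro ⟨b, l, rfl, hl, -⟩
    exact ⟨l, rfl, fun u hu => ⟨b, hl u hu⟩⟩
  · rintro ⟨l, rfl, hl⟩
    obtain ⟨b, hb⟩ := h.exists_forall_mem l hl
    obtain ⟨b', hb'⟩ := hP l.length
    exact ⟨max b b', l, rfl, fun u hu => h (le_max_left _ _) le_rfl u (hb u hu),
      hm (le_max_right _ _) le_rfl hb'⟩

/-- At threshold `0` the exponent `S` is no constraint, and a single word always has some finite
bound, so both kinds of exponents become stars. -/
theorem BSExpr.mem_matches'_toRegular (e : BSExpr α) {w : List α} :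
    w ∈ e.toRegular.matches' ↔ ∃ b, w ∈ e.val b 0 := by
  induction e generalizing w with
  | empty => simp [toRegular, val]
  | eps => simp [toRegular, val]
  | finEps =>
    simp only [toRegular, val, RegularExpression.matches'_epsilon, Language.mem_one]
    exact ⟨fun h => ⟨0, h, trivial⟩, fun ⟨_, h, _⟩ => h⟩
  | letter a =>
    simp only [toRegular, val, RegularExpression.matches'_char]
    exact ⟨fun h => ⟨0, h⟩, fun ⟨_, h⟩ => h⟩
  | concat e f he hf =>
    simp only [toRegular, val, RegularExpression.matches'_mul, Language.mem_mul, he, hf]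
    constructor
    · rintro ⟨u, ⟨b, hu⟩, v, ⟨b', hv⟩, rfl⟩
      exact ⟨max b b', u, e.costMono_val (le_max_left _ _) le_rfl u hu, v,
        f.costMono_val (le_max_right _ _) le_rfl v hv, rfl⟩
    · rintro ⟨b, u, hu, v, hv, rfl⟩
      exact ⟨u, ⟨b, hu⟩, v, ⟨b, hv⟩, rfl⟩
  | mix e f he hf =>
    simp only [toRegular, val, RegularExpression.matches'_add, Language.mem_add, he, hf,
      mem_add_apply, exists_or]
  | star e he =>
    simp only [toRegular, val, RegularExpression.matches'_star, Language.mem_kstar, he]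
    exact (e.costMono_val.exists_mem_iter_iff countMono_anyCount fun k => ⟨0, trivial⟩).symm
  | bexp e he =>
    simp only [toRegular, val, RegularExpression.matches'_star, Language.mem_kstar, he]
    exact (e.costMono_val.exists_mem_iter_iff countMono_atMost fun k => ⟨k, le_rfl⟩).symm
  | sexp e he =>
    simp only [toRegular, val, RegularExpression.matches'_star, Language.mem_kstar, he]
    exact (e.costMono_val.exists_mem_iter_iff countMono_atLeast fun k => ⟨0, Nat.zero_le _⟩).symm

/-- A regular expression as a `BS`-regular expression. -/
def ofRegular : RegularExpression α → BSExpr α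
  | .zero => .empty
  | .epsilon => .eps
  | .char a => .letter a
  | .plus e f => .mix (ofRegular e) (ofRegular f)
  | .comp e f => .concat (ofRegular e) (ofRegular f)
  | .star e => .star (ofRegular e)

theorem val_ofRegular (r : RegularExpression α) (b s : ℕ) :
    (ofRegular r).val b s = r.matches' := by
  induction r with
  | zero => rfl
  | epsilon => rfl
  | char a => rfl
  | plus e f he hf =>
    change (ofRegular e).val b s + (ofRegular f).val b s = e.matches' + f.matches'
    rw [he, hf]
  | comp e f he hf =>
    change (ofRegular e).val b s * (ofRegular f).val b s = e.matches' * f.matches'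
    rw [he, hf]
  | star e he =>
    change iter anyCount (ofRegular e).val b s = KStar.kstar e.matches'
    ext w
    simp only [mem_iter, he, Language.mem_kstar]
    exact ⟨fun ⟨l, h, h', _⟩ => ⟨l, h.symm, h'⟩, fun ⟨l, h, h'⟩ => ⟨l, h.symm, h', trivial⟩⟩

end OmegaBS

/-! ### Languages of word sequences in terms of costs. -/

namespace OmegaBS

open Filter

variable {α : Type*}

/-! ### Sequences -/

section Sequences

variable {β γ : Type*}

theorem length'_le_of_forall {s : Stream'.Seq β} {t : Stream'.Seq γ}
    (h : ∀ i x, s.get? i = some x → ∃ y, t.get? i = some y) : s.length' ≤ t.length' := by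
  refine le_of_forall_lt fun c hc => ?_
  lift c to ℕ using (ne_top_of_lt hc)
  obtain ⟨x, hx⟩ := Stream'.Seq.lt_length'_iff.1 hc
  exact Stream'.Seq.lt_length'_iff.2 (h c x hx)

theorem get?_isSome_of_lt_length' {s : Stream'.Seq β} {i : ℕ} (h : (i : ℕ∞) < s.length') :
    ∃ x, s.get? i = some x := Stream'.Seq.lt_length'_iff.1 h

theorem lt_length'_of_get? {s : Stream'.Seq β} {i : ℕ} {x : β} (h : s.get? i = some x) :
    (i : ℕ∞) < s.length' := Stream'.Seq.lt_length'_iff.2 ⟨x, h⟩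

theorem get?_of_le {s : Stream'.Seq β} {i j : ℕ} {x : β} (hij : i ≤ j) (h : s.get? j = some x) :
    ∃ y, s.get? i = some y := by
  rcases hy : s.get? i with _ | y
  · rw [s.le_stable hij hy] at h
    cases h
  · exact ⟨y, rfl⟩

/-- The sequence `A`, cut at the length of `w`. -/
def cutLike (w : Stream'.Seq β) (A : ℕ → γ) : Stream'.Seq γ :=
  ⟨fun i => (w.get? i).map fun _ => A i, fun {n} h => by
    have h' : w.get? n = none := by simpa using h
    have : w.get? (n + 1) = none := w.le_stable (Nat.le_succ n) h'
    change (w.get? (n + 1)).map _ = none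
    simp [this]⟩

theorem get?_cutLike (w : Stream'.Seq β) (A : ℕ → γ) (i : ℕ) :
    (cutLike w A).get? i = (w.get? i).map fun _ => A i := rfl

theorem length'_cutLike (w : Stream'.Seq β) (A : ℕ → γ) : (cutLike w A).length' = w.length' := by
  apply le_antisymm <;> apply length'_le_of_forall <;> intro i x hx
  · rw [get?_cutLike] at hx
    obtain ⟨y, hy, -⟩ := Option.map_eq_some_iff.1 hx
    exact ⟨y, hy⟩
  · exact ⟨A i, by rw [get?_cutLike, hx]; rfl⟩

/-- The concatenation of the first `m` lists of a sequence. -/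
def pre (L : ℕ → List β) (m : ℕ) : List β := ((List.range m).map L).flatten

theorem pre_zero (L : ℕ → List β) : pre L 0 = [] := rfl

theorem pre_succ (L : ℕ → List β) (m : ℕ) : pre L (m + 1) = pre L m ++ L m := by
  simp [pre, List.range_succ]

theorem length_pre_mono (L : ℕ → List β) : Monotone fun m => (pre L m).length :=
  monotone_nat_of_le_succ fun m => by simp [pre_succ]

theorem getElem?_pre_of_le (L : ℕ → List β) {m m' k : ℕ} (h : m ≤ m')
    (hk : k < (pre L m).length) : (pre L m')[k]? = (pre L m)[k]? := by
  induction m', h using Nat.le_induction with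
  | base => rfl
  | succ n hn ih =>
    rw [pre_succ, List.getElem?_append_left (hk.trans_le (length_pre_mono L hn)), ih]

open Classical in
/-- The concatenation of a sequence of lists. -/
noncomputable def glue (L : ℕ → List β) : Stream'.Seq β :=
  ⟨fun k => if h : ∃ m, k < (pre L m).length then (pre L (Nat.find h))[k]? else none, by
    intro k hk
    beta_reduce at hk ⊢
    by_cases h : ∃ m, k < (pre L m).length
    · rw [dif_pos h] at hk
      exact absurd (Nat.find_spec h) (by simpa using hk)
    · rw [dif_neg]
      rintro ⟨m, hm⟩
      exact h ⟨m, by omega⟩⟩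

theorem get?_glue (L : ℕ → List β) {k m : ℕ} (h : k < (pre L m).length) :
    (glue L).get? k = (pre L m)[k]? := by
  classical
  have h' : ∃ m, k < (pre L m).length := ⟨m, h⟩
  have e : (glue L).get? k = (pre L (Nat.find h'))[k]? := dif_pos h'
  rw [e]
  exact (getElem?_pre_of_le L (Nat.find_min' h' h) (Nat.find_spec h')).symm

theorem exists_of_get?_glue (L : ℕ → List β) {k : ℕ} {x : β} (h : (glue L).get? k = some x) :
    ∃ m, (pre L m).length ≤ k ∧ k < (pre L (m + 1)).length ∧ x ∈ L m := by
  classical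
  by_cases h' : ∃ m, k < (pre L m).length
  · have hm := Nat.find_spec h'
    obtain ⟨n, hn⟩ : ∃ n, Nat.find h' = n + 1 := by
      refine Nat.exists_eq_succ_of_ne_zero fun h0 => ?_
      rw [h0] at hm
      simp [pre_zero] at hm
    have hlt : (pre L n).length ≤ k := by
      by_contra! hlt
      exact Nat.find_min h' (by omega) hlt
    refine ⟨n, hlt, by rwa [← hn], ?_⟩
    rw [get?_glue L hm, hn, pre_succ, List.getElem?_append_right hlt] at h
    exact List.mem_of_getElem? h
  · have e : (glue L).get? k = none := dif_neg h'
    rw [e] at h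
    cases h

theorem take_drop_glue (L : ℕ → List β) (m : ℕ) :
    ((glue L).drop (pre L m).length).take ((pre L (m + 1)).length - (pre L m).length) = L m := by
  apply List.ext_getElem?
  intro n
  have hl : (pre L (m + 1)).length - (pre L m).length = (L m).length := by simp [pre_succ]
  rw [Stream'.Seq.getElem?_take, hl]
  split_ifs with h
  · rw [Stream'.Seq.drop_get?, get?_glue L (m := m + 1) (by simp [pre_succ, h]), pre_succ,
      List.getElem?_append_right (by omega)]
    congr 1
    omega
  · simp only [not_lt] at h
    simp [h]

end Sequences

/-! ### The languages of word sequences given by costs -/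

/-- The word sequences with bounded `B`-values and strongly unbounded `S`-values. -/
def seqLang (R : CostLang α) : Set (WordSeq α) :=
  {u | ∃ N, (∀ i x, u.get? i = some x → x ∈ R N 0) ∧
    ∀ s, ∃ i₀, ∀ i ≥ i₀, ∀ x, u.get? i = some x → x ∈ R N s}

/-- Take the largest `s ≤ i` with `p i s`: the cap `i` makes it exist and `p i 0` makes the search
succeed. With one threshold `f i` per coordinate, factorizations can be chosen coordinate by
coordinate. -/
theorem exists_threshold {p : ℕ → ℕ → Prop} (h0 : ∀ i, p i 0)
    (h : ∀ s, ∃ i₀, ∀ i ≥ i₀, p i s) : ∃ f : ℕ → ℕ, StronglyUnbounded f ∧ ∀ i, p i (f i) := by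
  classical
  refine ⟨fun i => Nat.findGreatest (p i) i, ?_, fun i => ?_⟩
  · refine tendsto_atTop.2 fun s => ?_
    obtain ⟨i₀, hi₀⟩ := h s
    filter_upwards [eventually_ge_atTop (max i₀ s)] with i hi
    exact Nat.le_findGreatest ((le_max_right _ _).trans hi) (hi₀ i ((le_max_left _ _).trans hi))
  · exact Nat.findGreatest_spec (P := p i) (Nat.zero_le i) (h0 i)

theorem StronglyUnbounded.exists_ge {f : ℕ → ℕ} (h : StronglyUnbounded f) (s : ℕ) :
    ∃ i₀, ∀ i ≥ i₀, s ≤ f i := eventually_atTop.1 (tendsto_atTop.1 h s)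

theorem exists_of_mem_seqLang {R : CostLang α} {u : WordSeq α} (h : u ∈ seqLang R) :
    ∃ N, ∃ f : ℕ → ℕ, StronglyUnbounded f ∧ ∀ i x, u.get? i = some x → x ∈ R N (f i) := by
  obtain ⟨N, h0, h1⟩ := h
  obtain ⟨f, hf, hf'⟩ := exists_threshold (p := fun i s => ∀ x, u.get? i = some x → x ∈ R N s)
    h0 h1
  exact ⟨N, f, hf, hf'⟩

theorem mem_seqLang_of_threshold {R : CostLang α} (hR : CostMono R) {u : WordSeq α} {N : ℕ}
    {f : ℕ → ℕ} (hf : StronglyUnbounded f)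
    (h : ∀ i x, u.get? i = some x → x ∈ R N (f i)) : u ∈ seqLang R := by
  refine ⟨N, fun i x hx => hR le_rfl (Nat.zero_le _) x (h i x hx), fun s => ?_⟩
  obtain ⟨i₀, hi₀⟩ := hf.exists_ge s
  exact ⟨i₀, fun i hi x hx => hR le_rfl (hi₀ i hi) x (h i x hx)⟩

theorem concat_seqLang {R R' : CostLang α} (hR : CostMono R) (hR' : CostMono R') :
    concat (seqLang R) (seqLang R') = seqLang (R * R') := by
  ext w
  constructor
  · rintro ⟨u, ⟨N, h0, h1⟩, v, ⟨N', h0', h1'⟩, -, rfl⟩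
    have key : ∀ i x, (Stream'.Seq.zipWith (fun x y => x ++ y) u v).get? i = some x →
        ∃ y z, u.get? i = some y ∧ v.get? i = some z ∧ y ++ z = x := by
      intro i x hx
      rw [Stream'.Seq.get?_zipWith] at hx
      obtain ⟨y, z, hy, hz, h⟩ := Option.map₂_eq_some_iff.1 hx
      exact ⟨y, z, hy, hz, h⟩
    refine ⟨max N N', fun i x hx => ?_, fun s => ?_⟩
    · obtain ⟨y, z, hy, hz, rfl⟩ := key i x hx
      exact ⟨y, hR (le_max_left _ _) le_rfl y (h0 i y hy), z,
        hR' (le_max_right _ _) le_rfl z (h0' i z hz), rfl⟩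
    · obtain ⟨i₀, hi₀⟩ := h1 s
      obtain ⟨i₁, hi₁⟩ := h1' s
      refine ⟨max i₀ i₁, fun i hi x hx => ?_⟩
      obtain ⟨y, z, hy, hz, rfl⟩ := key i x hx
      exact ⟨y, hR (le_max_left _ _) le_rfl y (hi₀ i ((le_max_left _ _).trans hi) y hy), z,
        hR' (le_max_right _ _) le_rfl z (hi₁ i ((le_max_right _ _).trans hi) z hz), rfl⟩
  · intro h
    obtain ⟨N, f, hf, h⟩ := exists_of_mem_seqLang h
    have : ∀ i, ∃ y z, ∀ x, w.get? i = some x → y ∈ R N (f i) ∧ z ∈ R' N (f i) ∧ y ++ z = x := by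
      intro i
      rcases hx : w.get? i with _ | x
      · exact ⟨[], [], by simp⟩
      · obtain ⟨y, hy, z, hz, e⟩ := h i x hx
        exact ⟨y, z, fun x' hx' => by cases hx'; exact ⟨hy, hz, e⟩⟩
    choose A B hAB using this
    refine ⟨cutLike w A, mem_seqLang_of_threshold (N := N) hR hf fun i x hx => ?_, cutLike w B,
      mem_seqLang_of_threshold (N := N) hR' hf fun i x hx => ?_, ?_, ?_⟩
    · rw [get?_cutLike] at hx
      obtain ⟨y, hy, rfl⟩ := Option.map_eq_some_iff.1 hx
      exact (hAB i y hy).1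
    · rw [get?_cutLike] at hx
      obtain ⟨y, hy, rfl⟩ := Option.map_eq_some_iff.1 hx
      exact (hAB i y hy).2.1
    · rw [length'_cutLike, length'_cutLike]
    · apply Stream'.Seq.ext
      intro i
      rw [Stream'.Seq.get?_zipWith, get?_cutLike, get?_cutLike]
      rcases hx : w.get? i with _ | x
      · rfl
      · simp [(hAB i x hx).2.2]

open Classical in
/-- The sequence whose `i`-th term is the first `w j` with `j ≥ i` and `D j`. -/
noncomputable def fillNext {β : Type*} (w : Stream'.Seq β) (D : ℕ → Prop)
    (hD : ∀ j, D j → ∃ x, w.get? j = some x) : Stream'.Seq β :=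
  ⟨fun i => if h : ∃ j, i ≤ j ∧ D j then w.get? (Nat.find h) else none, by
    intro n hn
    beta_reduce at hn ⊢
    by_cases h : ∃ j, n ≤ j ∧ D j
    · rw [dif_pos h] at hn
      obtain ⟨x, hx⟩ := hD _ (Nat.find_spec h).2
      rw [hx] at hn
      cases hn
    · rw [dif_neg]
      rintro ⟨m, hm, hm'⟩
      exact h ⟨m, by omega, hm'⟩⟩

theorem get?_fillNext {β : Type*} {w : Stream'.Seq β} {D : ℕ → Prop}
    (hD : ∀ j, D j → ∃ x, w.get? j = some x) {i : ℕ} {x : β}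
    (h : (fillNext w D hD).get? i = some x) : ∃ j, i ≤ j ∧ D j ∧ w.get? j = some x := by
  classical
  by_cases h' : ∃ j, i ≤ j ∧ D j
  · have e : (fillNext w D hD).get? i = w.get? (Nat.find h') := dif_pos h'
    exact ⟨_, (Nat.find_spec h').1, (Nat.find_spec h').2, e ▸ h⟩
  · have e : (fillNext w D hD).get? i = none := dif_neg h'
    rw [e] at h
    cases h

theorem get?_fillNext_of {β : Type*} {w : Stream'.Seq β} {D : ℕ → Prop}
    (hD : ∀ j, D j → ∃ x, w.get? j = some x) {i : ℕ} (h : D i) :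
    (fillNext w D hD).get? i = w.get? i := by
  classical
  have h' : ∃ j, i ≤ j ∧ D j := ⟨i, le_rfl, h⟩
  have e : (fillNext w D hD).get? i = w.get? (Nat.find h') := dif_pos h'
  rw [e, (Nat.find_eq_iff h').2 ⟨⟨le_rfl, h⟩, fun n hn hn' => by omega⟩]

/-- Each coordinate of a sequence for `R + R'` comes from one of the two languages, but the
components of a mix may have no gaps. A gap is filled with the next word that comes from the same
language: later words meet thresholds that also tend to infinity. The component stops after its last
own word, so neither is longer than `w`, and every coordinate of `w` occurs in one of them. -/
theorem mix_seqLang {R R' : CostLang α} (hR : CostMono R) (hR' : CostMono R') :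
    mix (seqLang R) (seqLang R') = seqLang (R + R') := by
  ext w
  constructor
  · rintro ⟨u, ⟨N, h0, h1⟩, v, ⟨N', h0', h1'⟩, -, h⟩
    refine ⟨max N N', fun i x hx => ?_, fun s => ?_⟩
    · exact (h i x hx).imp (fun h => hR (le_max_left _ _) le_rfl x (h0 i x h))
        (fun h => hR' (le_max_right _ _) le_rfl x (h0' i x h))
    · obtain ⟨i₀, hi₀⟩ := h1 s
      obtain ⟨i₁, hi₁⟩ := h1' s
      exact ⟨max i₀ i₁, fun i hi x hx => (h i x hx).imp
        (fun h => hR (le_max_left _ _) le_rfl x (hi₀ i ((le_max_left _ _).trans hi) x h))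
        (fun h => hR' (le_max_right _ _) le_rfl x (hi₁ i ((le_max_right _ _).trans hi) x h))⟩
  · intro h
    obtain ⟨N, f, hf, h⟩ := exists_of_mem_seqLang h
    have fill : ∀ (Q : CostLang α), CostMono Q →
        ∃ u ∈ seqLang Q, u.length' ≤ w.length' ∧
          ∀ i x, w.get? i = some x → x ∈ Q N (f i) → u.get? i = some x := by
      intro Q hQ
      have hD : ∀ j, (∃ x, w.get? j = some x ∧ x ∈ Q N (f j)) → ∃ x, w.get? j = some x :=
        fun j ⟨x, hx, _⟩ => ⟨x, hx⟩
      refine ⟨fillNext w _ hD, ⟨N, ?_, ?_⟩, ?_, ?_⟩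
      · intro i x hx
        obtain ⟨j, -, ⟨y, hy, hy'⟩, hj⟩ := get?_fillNext hD hx
        rw [hy] at hj
        cases hj
        exact hQ le_rfl (Nat.zero_le _) x hy'
      · intro s
        obtain ⟨i₀, hi₀⟩ := hf.exists_ge s
        refine ⟨i₀, fun i hi x hx => ?_⟩
        obtain ⟨j, hij, ⟨y, hy, hy'⟩, hj⟩ := get?_fillNext hD hx
        rw [hy] at hj
        cases hj
        exact hQ le_rfl (hi₀ j (hi.trans hij)) x hy'
      · refine length'_le_of_forall fun i x hx => ?_
        obtain ⟨j, hij, -, hj⟩ := get?_fillNext hD hx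
        exact get?_of_le hij hj
      · intro i x hx hx'
        rw [get?_fillNext_of hD ⟨x, hx, hx'⟩, hx]
    obtain ⟨u, hu, hul, hu'⟩ := fill R hR
    obtain ⟨v, hv, hvl, hv'⟩ := fill R' hR'
    have key : ∀ i x, w.get? i = some x → u.get? i = some x ∨ v.get? i = some x :=
      fun i x hx => (h i x hx).imp (hu' i x hx) (hv' i x hx)
    refine ⟨u, hu, v, hv, le_antisymm ?_ (max_le hul hvl), key⟩
    refine le_of_forall_lt fun c hc => ?_
    lift c to ℕ using (ne_top_of_lt hc)
    obtain ⟨x, hx⟩ := get?_isSome_of_lt_length' hc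
    exact lt_max_iff.2 ((key c x hx).imp lt_length'_of_get? lt_length'_of_get?)

/-- The lengths of the blocks cut out by `g` satisfy `P`, with a fixed bound and with a
threshold that tends to infinity. -/
def GapCond (P : CountCond) (g : Stream'.Seq ℕ) : Prop :=
  ∃ N, (∀ i a c, (Stream'.Seq.cons 0 g).get? i = some a → g.get? i = some c → P N 0 (c - a)) ∧
    ∀ s, ∃ i₀, ∀ i ≥ i₀, ∀ a c, (Stream'.Seq.cons 0 g).get? i = some a → g.get? i = some c →
      P N s (c - a)

theorem get?_blocks {u : WordSeq α} {g : Stream'.Seq ℕ} {i : ℕ} {x : List α}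
    (h : (blocks u g).get? i = some x) : ∃ a c, (Stream'.Seq.cons 0 g).get? i = some a ∧
      g.get? i = some c ∧ block u a c = x := by
  rw [blocks, Stream'.Seq.get?_zipWith] at h
  obtain ⟨a, c, ha, hc, h⟩ := Option.map₂_eq_some_iff.1 h
  exact ⟨a, c, ha, hc, h⟩

theorem mem_take_drop {β : Type*} {u : Stream'.Seq β} {a n : ℕ} {y : β}
    (h : y ∈ (u.drop a).take n) : ∃ j, a ≤ j ∧ j < a + n ∧ u.get? j = some y := by
  obtain ⟨k, hk⟩ := List.getElem?_of_mem h
  rw [Stream'.Seq.getElem?_take] at hk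
  split_ifs at hk with hkn
  rw [Stream'.Seq.drop_get?] at hk
  exact ⟨a + k, by omega, by omega, hk⟩

theorem length_take_drop {β : Type*} {u : Stream'.Seq β} {a c : ℕ} (hac : a ≤ c)
    (hc : (c : ℕ∞) ≤ u.length') : ((u.drop a).take (c - a)).length = c - a := by
  refine le_antisymm Stream'.Seq.length_take_le ?_
  by_contra! hlt
  set n := ((u.drop a).take (c - a)).length with hn
  have h1 : ((u.drop a).take (c - a))[n]? = none := by rw [List.getElem?_eq_none_iff]
  rw [Stream'.Seq.getElem?_take, if_pos hlt, Stream'.Seq.drop_get?] at h1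
  have h2 : ((a + n : ℕ) : ℕ∞) < u.length' := lt_of_lt_of_le (by exact_mod_cast (by omega)) hc
  obtain ⟨x, hx⟩ := get?_isSome_of_lt_length' h2
  rw [h1] at hx
  cases hx

theorem NonDecreasing.le_of_get?_cons {g : Stream'.Seq ℕ} (hg : NonDecreasing g) {i a c : ℕ}
    (ha : (Stream'.Seq.cons 0 g).get? i = some a) (hc : g.get? i = some c) : a ≤ c := by
  cases i with
  | zero =>
    rw [Stream'.Seq.get?_cons_zero] at ha
    cases ha
    exact Nat.zero_le c
  | succ i =>
    rw [Stream'.Seq.get?_cons_succ] at ha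
    exact hg i (i + 1) a c (by omega) ha hc

/-- A nonempty block that starts before `n` increases `g`, which can happen only finitely often.
Hence late nonempty blocks consist of late words, even when `g` is bounded. -/
theorem NonDecreasing.eventually {g : Stream'.Seq ℕ} (hg : NonDecreasing g) (n : ℕ) :
    ∃ i₀, ∀ i ≥ i₀, ∀ a c, (Stream'.Seq.cons 0 g).get? i = some a → g.get? i = some c →
      n ≤ a ∨ a = c := by
  by_contra! hcon
  have : ∀ m, ∃ i c, g.get? i = some c ∧ min m n ≤ c := by
    intro m
    induction m with
    | zero =>
      obtain ⟨i, -, a, c, -, hc, -⟩ := hcon 0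
      exact ⟨i, c, hc, by omega⟩
    | succ m ih =>
      obtain ⟨i, c, hc, hm⟩ := ih
      obtain ⟨j, hj, a, d, ha, hd, han, had⟩ := hcon (i + 1)
      obtain ⟨j, rfl⟩ : ∃ k, j = k + 1 := ⟨j - 1, by omega⟩
      rw [Stream'.Seq.get?_cons_succ] at ha
      have h1 := hg i j c a (by omega) hc ha
      have h2 := hg j (j + 1) a d (by omega) ha hd
      exact ⟨j + 1, d, hd, by omega⟩
  obtain ⟨i, c, hc, hn⟩ := this n
  obtain ⟨j, hj, a, d, ha, hd, han, -⟩ := hcon (i + 1)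
  obtain ⟨j, rfl⟩ : ∃ k, j = k + 1 := ⟨j - 1, by omega⟩
  rw [Stream'.Seq.get?_cons_succ] at ha
  have h1 := hg i j c a (by omega) hc ha
  omega

/-- Late blocks are empty or made of late words, so the thresholds of the words pass to the blocks.
Conversely, factorizations of all the words are glued into one sequence, and a word of a block `i ≥
i₀` comes after the first `i₀` blocks. -/
theorem group_gapCond {P : CountCond} {R : CostLang α} (hP : CountMono P) (hR : CostMono R) :
    group (GapCond P) (seqLang R) = seqLang (iter P R) := by
  ext w
  constructor
  · rintro ⟨u, ⟨N₁, h0, h1⟩, g, hle, hg, ⟨N₂, k0, k1⟩, rfl⟩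
    refine ⟨max N₁ N₂, fun i x hx => ?_, fun s => ?_⟩
    · obtain ⟨a, c, ha, hc, rfl⟩ := get?_blocks hx
      refine ⟨_, rfl, fun y hy => ?_, ?_⟩
      · obtain ⟨j, -, -, hj⟩ := mem_take_drop hy
        exact hR (le_max_left _ _) le_rfl y (h0 j y hj)
      · rw [length_take_drop (hg.le_of_get?_cons ha hc) (hle i c hc)]
        exact hP (le_max_right _ _) le_rfl (k0 i a c ha hc)
    · obtain ⟨j₀, hj₀⟩ := h1 s
      obtain ⟨i₀, hi₀⟩ := k1 s
      obtain ⟨i₁, hi₁⟩ := hg.eventually j₀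
      refine ⟨max i₀ i₁, fun i hi x hx => ?_⟩
      obtain ⟨a, c, ha, hc, rfl⟩ := get?_blocks hx
      refine ⟨_, rfl, fun y hy => ?_, ?_⟩
      · obtain ⟨j, hj1, hj2, hj⟩ := mem_take_drop hy
        have h2 := hi₁ i ((le_max_right _ _).trans hi) a c ha hc
        exact hR (le_max_left _ _) le_rfl y (hj₀ j (by omega) y hj)
      · rw [length_take_drop (hg.le_of_get?_cons ha hc) (hle i c hc)]
        exact hP (le_max_right _ _) le_rfl (hi₀ i ((le_max_left _ _).trans hi) a c ha hc)
  · intro h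
    obtain ⟨N, f, hf, h⟩ := exists_of_mem_seqLang h
    have : ∀ i, ∃ l : List (List α), (∀ x, w.get? i = some x → l.flatten = x ∧
        (∀ u ∈ l, u ∈ R N (f i)) ∧ P N (f i) l.length) ∧ (w.get? i = none → l = []) := by
      intro i
      rcases hx : w.get? i with _ | x
      · exact ⟨[], by simp⟩
      · obtain ⟨l, h1, h2, h3⟩ := h i x hx
        exact ⟨l, fun x' hx' => by cases hx'; exact ⟨h1, h2, h3⟩, by simp⟩
    choose L hL hL' using this
    have hmem : ∀ i, ∀ y ∈ L i, y ∈ R N (f i) := by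
      intro i y hy
      rcases hx : w.get? i with _ | x
      · rw [hL' i hx] at hy
        cases hy
      · exact (hL i x hx).2.1 y hy
    -- The cuts lie at the ends of the chosen factorizations, and they stop where `w` stops.
    set g : Stream'.Seq ℕ := cutLike w fun i => (pre L (i + 1)).length with hg
    have hgc : ∀ i c, g.get? i = some c → c = (pre L (i + 1)).length ∧ ∃ x, w.get? i = some x := by
      intro i c hc
      rw [hg, get?_cutLike] at hc
      obtain ⟨x, hx, rfl⟩ := Option.map_eq_some_iff.1 hc
      exact ⟨rfl, x, hx⟩
    have hga : ∀ i a, (Stream'.Seq.cons 0 g).get? i = some a → a = (pre L i).length := by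
      intro i a ha
      cases i with
      | zero =>
        rw [Stream'.Seq.get?_cons_zero] at ha
        cases ha
        rfl
      | succ i =>
        rw [Stream'.Seq.get?_cons_succ] at ha
        exact (hgc i a ha).1
    have hgap : ∀ i a c, (Stream'.Seq.cons 0 g).get? i = some a → g.get? i = some c →
        P N (f i) (c - a) := by
      intro i a c ha hc
      obtain ⟨rfl, x, hx⟩ := hgc i c hc
      obtain rfl := hga i a ha
      have := (hL i x hx).2.2
      simpa [pre_succ] using this
    refine ⟨glue L, ⟨N, fun k y hy => ?_, fun s => ?_⟩, g, fun i c hc => ?_, ?_, ⟨N, ?_, ?_⟩, ?_⟩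
    · obtain ⟨m, -, -, hm⟩ := exists_of_get?_glue L hy
      exact hR le_rfl (Nat.zero_le _) y (hmem m y hm)
    · obtain ⟨i₀, hi₀⟩ := hf.exists_ge s
      refine ⟨(pre L i₀).length, fun k hk y hy => ?_⟩
      obtain ⟨m, -, hm', hm⟩ := exists_of_get?_glue L hy
      refine hR le_rfl (hi₀ m ?_) y (hmem m y hm)
      by_contra! hlt
      exact absurd (length_pre_mono L (show m + 1 ≤ i₀ by omega)) (by simp only; omega)
    · obtain ⟨rfl, -⟩ := hgc i c hc
      refine le_of_forall_lt fun k hk => ?_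
      lift k to ℕ using (ne_top_of_lt hk)
      have hk' : k < (pre L (i + 1)).length := by exact_mod_cast hk
      have := get?_glue L hk'
      rw [List.getElem?_eq_getElem hk'] at this
      exact lt_length'_of_get? this
    · intro i j a b hij ha hb
      rw [(hgc i a ha).1, (hgc j b hb).1]
      exact length_pre_mono L (by omega)
    · exact fun i a c ha hc => hP le_rfl (Nat.zero_le _) (hgap i a c ha hc)
    · intro s
      obtain ⟨i₀, hi₀⟩ := hf.exists_ge s
      exact ⟨i₀, fun i hi a c ha hc => hP le_rfl (hi₀ i hi) (hgap i a c ha hc)⟩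
    · apply Stream'.Seq.ext
      intro i
      rw [blocks, Stream'.Seq.get?_zipWith]
      rcases hx : w.get? i with _ | x
      · have : g.get? i = none := by rw [hg, get?_cutLike, hx]; rfl
        rw [this]
        simp
      · have h2 : g.get? i = some (pre L (i + 1)).length := by rw [hg, get?_cutLike, hx]; rfl
        have h1 : (Stream'.Seq.cons 0 g).get? i = some (pre L i).length := by
          cases i with
          | zero => rfl
          | succ i =>
            rw [Stream'.Seq.get?_cons_succ]
            obtain ⟨y, hy⟩ := get?_of_le (Nat.le_succ i) hx
            rw [hg, get?_cutLike, hy]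
            rfl
        rw [h1, h2, Option.map₂_some_some, block, take_drop_glue, (hL i x hx).1]

theorem get?_diff (g : Stream'.Seq ℕ) (i : ℕ) :
    (diff g).get? i = Option.map₂ (fun a b => b - a) (g.get? i) (g.get? (i + 1)) := by
  rw [diff, Stream'.Seq.get?_zipWith, Stream'.Seq.get?_tail]

theorem diff_terminates {g : Stream'.Seq ℕ} : (diff g).Terminates ↔ g.Terminates := by
  constructor
  · rintro ⟨n, hn⟩
    refine ⟨n + 1, ?_⟩
    have hn' : (diff g).get? n = none := hn
    rw [get?_diff, Option.map₂_eq_none_iff] at hn'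
    exact hn'.elim (g.le_stable (Nat.le_succ n)) id
  · rintro ⟨n, hn⟩
    refine ⟨n, ?_⟩
    have hn' : g.get? n = none := hn
    change (diff g).get? n = none
    rw [get?_diff, hn']
    rfl

theorem get?_some_of_diff {g : Stream'.Seq ℕ} {f : ℕ → ℕ}
    (hf : ∀ i, (diff g).get? i = some (f i)) {i a c : ℕ}
    (ha : (Stream'.Seq.cons 0 g).get? (i + 1) = some a) (hc : g.get? (i + 1) = some c) :
    c - a = f i := by
  have := hf i
  rw [Stream'.Seq.get?_cons_succ] at ha
  rw [get?_diff, ha, hc] at this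
  simpa using this

theorem exists_diff_eq {g : Stream'.Seq ℕ} (h : ¬ g.Terminates) :
    ∃ f : ℕ → ℕ, (∀ i, (diff g).get? i = some (f i)) ∧ ∀ i, ∃ a c,
      (Stream'.Seq.cons 0 g).get? (i + 1) = some a ∧ g.get? (i + 1) = some c ∧ f i = c - a := by
  have h' := Stream'.Seq.not_terminates_iff.1 h
  choose G hG using fun i => Option.isSome_iff_exists.1 (h' i)
  refine ⟨fun i => G (i + 1) - G i, fun i => by rw [get?_diff, hG, hG]; rfl, fun i =>
    ⟨G i, G (i + 1), ?_, hG _, rfl⟩⟩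
  rw [Stream'.Seq.get?_cons_succ, hG]

/-- `GapCond` also constrains the first block, which `diff` ignores; a single block does not affect
boundedness. A finite `g` is bounded anyway. -/
theorem boundedDiff_iff (g : Stream'.Seq ℕ) : BoundedDiff g ↔ GapCond atMost g := by
  constructor
  · rintro (h | ⟨f, hf, N, hN⟩)
    · obtain ⟨n, hn⟩ := diff_terminates.1 h
      -- The sum of the finitely many terms serves as a common upper bound.
      have key : ∀ i c, g.get? i = some c → c ≤ ∑ i ∈ Finset.range n, (g.get? i).getD 0 := by
        intro i c hc
        have hi : i < n := by
          by_contra! hni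
          rw [g.le_stable hni hn] at hc
          cases hc
        have := Finset.single_le_sum (f := fun i => (g.get? i).getD 0)
          (fun _ _ => Nat.zero_le _) (Finset.mem_range.2 hi)
        simpa [hc] using this
      have key' : ∀ i a c, (Stream'.Seq.cons 0 g).get? i = some a → g.get? i = some c →
          c - a ≤ ∑ i ∈ Finset.range n, (g.get? i).getD 0 :=
        fun i a c _ hc => (Nat.sub_le _ _).trans (key i c hc)
      exact ⟨_, key', fun s => ⟨0, fun i _ => key' i⟩⟩
    · have key : ∀ i a c, (Stream'.Seq.cons 0 g).get? i = some a → g.get? i = some c →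
          c - a ≤ max N ((g.get? 0).getD 0) := by
        intro i a c ha hc
        cases i with
        | zero => simp [hc]
        | succ i =>
          rw [get?_some_of_diff hf ha hc]
          exact (hN i).trans (le_max_left _ _)
      exact ⟨_, key, fun s => ⟨0, fun i _ => key i⟩⟩
  · rintro ⟨N, h0, -⟩
    by_cases ht : g.Terminates
    · exact Or.inl (diff_terminates.2 ht)
    · obtain ⟨f, hf, hf'⟩ := exists_diff_eq ht
      refine Or.inr ⟨f, hf, N, fun i => ?_⟩
      obtain ⟨a, c, ha, hc, e⟩ := hf' i
      rw [e]
      exact h0 (i + 1) a c ha hc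

theorem stronglyUnboundedDiff_iff (g : Stream'.Seq ℕ) :
    StronglyUnboundedDiff g ↔ GapCond atLeast g := by
  constructor
  · rintro (h | ⟨f, hf, hf'⟩)
    · obtain ⟨n, hn⟩ := diff_terminates.1 h
      refine ⟨0, fun _ _ _ _ _ => Nat.zero_le _, fun s => ⟨n, fun i hi a c _ hc => ?_⟩⟩
      rw [g.le_stable hi hn] at hc
      cases hc
    · refine ⟨0, fun _ _ _ _ _ => Nat.zero_le _, fun s => ?_⟩
      obtain ⟨i₀, hi₀⟩ := StronglyUnbounded.exists_ge hf' s
      refine ⟨i₀ + 1, fun i hi a c ha hc => ?_⟩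
      obtain ⟨i, rfl⟩ : ∃ k, i = k + 1 := ⟨i - 1, by omega⟩
      rw [get?_some_of_diff hf ha hc]
      exact hi₀ i (by omega)
  · rintro ⟨N, -, h1⟩
    by_cases ht : g.Terminates
    · exact Or.inl (diff_terminates.2 ht)
    · obtain ⟨f, hf, hf'⟩ := exists_diff_eq ht
      refine Or.inr ⟨f, hf, tendsto_atTop.2 fun s => ?_⟩
      obtain ⟨i₀, hi₀⟩ := h1 s
      filter_upwards [eventually_ge_atTop i₀] with i hi
      obtain ⟨a, c, ha, hc, e⟩ := hf' i
      rw [e]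
      exact hi₀ (i + 1) (by omega) a c ha hc

/-- Every operation on languages of word sequences is the coordinatewise form of the operation on
cost languages with the same name, so an induction on the expression suffices. -/
theorem BSExpr.lang_eq (e : BSExpr α) : e.lang = seqLang e.val := by
  induction e with
  | empty =>
    ext u
    constructor
    · rintro rfl
      exact ⟨0, by simp, fun s => ⟨0, by simp⟩⟩
    · rintro ⟨N, h0, -⟩
      rcases hx : u.get? 0 with _ | x
      · exact Stream'.Seq.terminatedAt_zero_iff.1 hx
      · exact (h0 0 x hx).elim
  | eps =>
    ext u
    exact ⟨fun h => ⟨0, h, fun s => ⟨0, fun i _ => h i⟩⟩, fun ⟨N, h0, _⟩ => h0⟩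
  | finEps =>
    ext u
    constructor
    · rintro ⟨⟨n, hn⟩, h⟩
      refine ⟨0, fun i x hx => ⟨h i x hx, rfl⟩, fun s => ⟨n, fun i hi x hx => ?_⟩⟩
      rw [u.le_stable hi hn] at hx
      cases hx
    · rintro ⟨N, h0, h1⟩
      refine ⟨?_, fun i x hx => (h0 i x hx).1⟩
      obtain ⟨n, hn⟩ := h1 1
      refine ⟨n, ?_⟩
      rcases hx : u.get? n with _ | x
      · exact hx
      · exact absurd (hn n le_rfl x hx).2 one_ne_zero
  | letter a =>
    ext u
    exact ⟨fun h => ⟨0, h, fun s => ⟨0, fun i _ => h i⟩⟩, fun ⟨N, h0, _⟩ => h0⟩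
  | concat e f he hf =>
    rw [lang, he, hf, concat_seqLang e.costMono_val f.costMono_val, val]
  | mix e f he hf =>
    rw [lang, he, hf, mix_seqLang e.costMono_val f.costMono_val, val]
  | star e he =>
    rw [lang, he, val, ← group_gapCond countMono_anyCount e.costMono_val]
    congr 1
    ext g
    exact ⟨fun _ => ⟨0, fun _ _ _ _ _ => trivial, fun s => ⟨0, fun _ _ _ _ _ _ => trivial⟩⟩,
      fun _ => trivial⟩
  | bexp e he =>
    rw [lang, he, val, ← group_gapCond countMono_atMost e.costMono_val]
    congr 1
    ext g
    exact boundedDiff_iff g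
  | sexp e he =>
    rw [lang, he, val, ← group_gapCond countMono_atLeast e.costMono_val]
    congr 1
    ext g
    exact stronglyUnboundedDiff_iff g

end OmegaBS

/-! ### Infinite words cut into blocks, and the terms of `ω`-regular expressions. -/

namespace OmegaBS

open Filter

variable {α : Type*}

/-! ### Segments of infinite sequences -/

section Segments

variable {β γ : Type*}

/-- The list `f a, …, f (b - 1)`. -/
def seg (f : ℕ → β) (a b : ℕ) : List β := (List.range' a (b - a)).map f

theorem length_seg (f : ℕ → β) (a b : ℕ) : (seg f a b).length = b - a := by simp [seg]

theorem seg_self (f : ℕ → β) (a : ℕ) : seg f a a = [] := by simp [seg]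

theorem seg_append (f : ℕ → β) {a b c : ℕ} (hab : a ≤ b) (hbc : b ≤ c) :
    seg f a b ++ seg f b c = seg f a c := by
  rw [seg, seg, seg, ← List.map_append]
  congr 1
  obtain ⟨m, rfl⟩ := Nat.exists_eq_add_of_le hab
  obtain ⟨n, rfl⟩ := Nat.exists_eq_add_of_le hbc
  rw [show a + m - a = m by omega, show a + m + n - (a + m) = n by omega,
    show a + m + n - a = m + n by omega]
  simp

theorem seg_succ (f : ℕ → β) {a b : ℕ} (hab : a ≤ b) : seg f a (b + 1) = seg f a b ++ [f b] := by
  rw [← seg_append f hab (Nat.le_succ b)]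
  simp [seg]

theorem seg_cons (f : ℕ → β) {a b : ℕ} (hab : a < b) : seg f a b = f a :: seg f (a + 1) b := by
  rw [← seg_append f (Nat.le_succ a) hab]
  simp [seg]

theorem seg_map (g : β → γ) (f : ℕ → β) (a b : ℕ) : seg (fun i => g (f i)) a b = (seg f a b).map g := by
  simp [seg]

theorem seg_shift (f : ℕ → β) (c a b : ℕ) : seg f (c + a) (c + b) = seg (fun i => f (c + i)) a b := by
  rw [seg, seg, show c + b - (c + a) = b - a by omega, ← List.map_add_range', List.map_map]
  rfl

theorem mem_seg {f : ℕ → β} {a b : ℕ} {x : β} : x ∈ seg f a b ↔ ∃ i, a ≤ i ∧ i < b ∧ f i = x := by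
  simp only [seg, List.mem_map, List.mem_range'_1]
  constructor
  · rintro ⟨i, h, rfl⟩
    exact ⟨i, h.1, by omega, rfl⟩
  · rintro ⟨i, h, h', rfl⟩
    exact ⟨i, ⟨h, by omega⟩, rfl⟩

theorem eq_seg_of_append {f : ℕ → β} {a b : ℕ} {l l' : List β} (h : l ++ l' = seg f a b) :
    l = seg f a (a + l.length) ∧ l' = seg f (a + l.length) b := by
  have hlen : l.length + l'.length = b - a := by rw [← List.length_append, h, length_seg]
  rcases l.length.eq_zero_or_pos with h0 | h0
  · obtain rfl := List.length_eq_zero_iff.1 h0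
    exact ⟨by simp [seg_self], by simpa using h⟩
  · rw [← seg_append f (show a ≤ a + l.length by omega) (show a + l.length ≤ b by omega)] at h
    exact List.append_inj h (by rw [length_seg]; omega)

theorem take_eq_seg (x : Stream' β) (n : ℕ) : x.take n = seg x.get 0 n := by
  induction n with
  | zero => rfl
  | succ n ih => rw [Stream'.take_succ', ih, seg_succ _ (Nat.zero_le n)]

theorem flatten_seg_zero (L : ℕ → List β) (m : ℕ) : (seg L 0 m).flatten = pre L m := by
  rw [seg, pre, List.range_eq_range']
  rfl

theorem pre_eq_of_forall_nil {L : ℕ → List β} {a b : ℕ} (hab : a ≤ b)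
    (h : ∀ j, a ≤ j → j < b → L j = []) : pre L b = pre L a := by
  induction b, hab using Nat.le_induction with
  | base => rfl
  | succ b hab ih =>
    rw [pre_succ, ih fun j hj hj' => h j hj (by omega), h b hab (by omega), List.append_nil]

theorem exists_index_of_strictMono {t : ℕ → ℕ} (ht : StrictMono t) {j : ℕ} (hj : t 0 ≤ j) :
    ∃ i, t i ≤ j ∧ j < t (i + 1) := by
  classical
  have hex : ∃ n, j < t n := ⟨j + 1, (ht.id_le (j + 1)).trans_lt' (Nat.lt_succ_self j)⟩
  obtain ⟨n, hn⟩ : ∃ n, Nat.find hex = n + 1 := by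
    refine Nat.exists_eq_succ_of_ne_zero fun h0 => ?_
    have := Nat.find_spec hex
    rw [h0] at this
    omega
  refine ⟨n, ?_, hn ▸ Nat.find_spec hex⟩
  by_contra! hlt
  exact Nat.find_min hex (by omega) hlt

theorem strictMono_length_pre {L : ℕ → List β} (hL : ∀ i, L i ≠ []) :
    StrictMono fun i => (pre L i).length :=
  strictMono_nat_of_lt_succ fun i => by
    have := List.length_pos_of_ne_nil (hL i)
    simp only [pre_succ, List.length_append]
    omega

/-- A sequence of nonempty lists is obtained by cutting an infinite sequence. -/
theorem exists_seg_eq {L : ℕ → List β} (hL : ∀ i, L i ≠ []) :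
    ∃ f : ℕ → β, ∀ i, seg f (pre L i).length (pre L (i + 1)).length = L i := by
  have hsome : ∀ k, ∃ x, (glue L).get? k = some x := by
    intro k
    have hk : k < (pre L (k + 1)).length := (strictMono_length_pre hL).id_le (k + 1)
    exact ⟨_, (get?_glue L hk).trans (List.getElem?_eq_getElem hk)⟩
  choose f hf using hsome
  refine ⟨f, fun i => ?_⟩
  apply List.ext_getElem?
  intro n
  have hle : (pre L (i + 1)).length = (pre L i).length + (L i).length := by simp [pre_succ]
  by_cases hn : n < (L i).length
  · have h1 : (seg f (pre L i).length (pre L (i + 1)).length)[n]? = some (f ((pre L i).length + n)) := by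
      rw [seg, List.getElem?_map, List.getElem?_range' (by omega)]
      simp
    rw [h1, ← hf, get?_glue L (m := i + 1) (by omega), pre_succ,
      List.getElem?_append_right (by omega)]
    congr 1
    omega
  · rw [List.getElem?_eq_none (by rw [length_seg]; omega), List.getElem?_eq_none (by omega)]

theorem seg_zero_eq_pre {L : ℕ → List β} {f : ℕ → β}
    (hf : ∀ i, seg f (pre L i).length (pre L (i + 1)).length = L i) (i : ℕ) :
    seg f 0 (pre L i).length = pre L i := by
  induction i with
  | zero => simp [pre_zero, seg_self]
  | succ i ih =>
    rw [← seg_append f (Nat.zero_le _) (length_pre_mono L (Nat.le_succ i)), ih, hf, pre_succ]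

end Segments

/-! ### Terms of `ω`-regular expressions -/

/-- The `ω`-words that consist of a word of `M` and of a sequence of nonempty words of `R`
with bounded `B`-values and strongly unbounded `S`-values. -/
def omegaTerm (M : Language α) (R : CostLang α) : Set (Stream' α) :=
  {x | ∃ k : ℕ → ℕ, StrictMono k ∧ seg x.get 0 (k 0) ∈ M ∧ ∃ N,
    (∀ i, seg x.get (k i) (k (i + 1)) ∈ R N 0) ∧
    ∀ s, ∃ i₀, ∀ i ≥ i₀, seg x.get (k i) (k (i + 1)) ∈ R N s}

theorem take_eq_map_range {β : Type*} {u : Stream'.Seq β} {U : ℕ → β}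
    (h : ∀ i, u.get? i = some (U i)) (n : ℕ) : u.take n = (List.range n).map U := by
  apply List.ext_getElem?
  intro i
  rw [Stream'.Seq.getElem?_take]
  split_ifs with hi
  · simp [h, hi]
  · simp only [not_lt] at hi
    simp [hi]

/-- Dropping the empty words of a sequence changes neither its concatenation nor its asymptotic
conditions, and a sequence of nonempty words with a given concatenation amounts to a strictly
increasing sequence of cuts. -/
theorem lang_eq_omegaTerm (E : OmegaExpr α) :
    OmegaExpr.lang E = {x | ∃ p ∈ E, x ∈ omegaTerm p.1.matches' p.2.val} := by
  ext x
  constructor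
  · rintro ⟨p, hp, v, hv, y, ⟨u, hu, hfreq, hcat⟩, rfl⟩
    refine ⟨p, hp, ?_⟩
    rw [BSExpr.lang_eq] at hu
    obtain ⟨N, h0, h1⟩ := hu
    have hU : ∀ i, ∃ w, u.get? i = some w := by
      intro i
      obtain ⟨j, hj, w, hw, -⟩ := (frequently_atTop.1 hfreq) i
      exact get?_of_le hj hw
    choose U hU using hU
    have hinf : (Set.ofPred fun i => U i ≠ []).Infinite := by
      refine Nat.frequently_atTop_iff_infinite.1 (hfreq.mono ?_)
      rintro i ⟨w, hw, hne⟩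
      rw [hU] at hw
      cases hw
      exact hne
    have hpre : ∀ n, seg y.get 0 (pre U n).length = pre U n := by
      intro n
      have := hcat n
      rw [take_eq_map_range hU, take_eq_seg] at this
      exact this.symm
    -- `φ` enumerates the nonempty words. As `i ≤ φ i`, a threshold met from coordinate `i₀` on is
    -- still met from index `i₀` on in the subsequence.
    set φ := Nat.nth (fun i => U i ≠ []) with hφ
    have hφm : StrictMono φ := Nat.nth_strictMono hinf
    have hφs : ∀ j, U j ≠ [] → ∃ n, φ n = j := by
      intro j hj
      have : j ∈ Set.range φ := by
        rw [hφ, Nat.range_nth_of_infinite hinf]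
        exact hj
      exact this
    have hgap : ∀ i, pre U (φ (i + 1)) = pre U (φ i) ++ U (φ i) := by
      intro i
      rw [← pre_succ]
      refine pre_eq_of_forall_nil (hφm (Nat.lt_succ_self i)) fun j hj hj' => ?_
      by_contra hne
      obtain ⟨n, rfl⟩ := hφs j hne
      have h2 := hφm.lt_iff_lt.1 hj
      have h3 := hφm.lt_iff_lt.1 hj'
      omega
    have hzero : pre U (φ 0) = [] := by
      refine pre_eq_of_forall_nil (a := 0) (Nat.zero_le _) fun j hj hj' => ?_
      by_contra hne
      obtain ⟨n, rfl⟩ := hφs j hne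
      have h3 := hφm.lt_iff_lt.1 hj'
      omega
    have hlen : ∀ i, (pre U (φ (i + 1))).length = (pre U (φ i)).length + (U (φ i)).length := by
      intro i
      rw [hgap, List.length_append]
    have hy : ∀ a b, seg (v ++ₛ y).get (v.length + a) (v.length + b) = seg y.get a b := by
      intro a b
      rw [seg_shift]
      congr 1
      funext i
      simp
    have hblock : ∀ i, seg (v ++ₛ y).get (v.length + (pre U (φ i)).length)
        (v.length + (pre U (φ (i + 1))).length) = U (φ i) := by
      intro i
      rw [hy]
      have h2 := hpre (φ (i + 1))
      rw [hgap i] at h2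
      have h3 := (eq_seg_of_append h2.symm).2
      rw [Nat.zero_add] at h3
      rw [hgap i]
      exact h3.symm
    refine ⟨fun i => v.length + (pre U (φ i)).length, ?_, ?_, N, fun i => ?_, fun s => ?_⟩
    · refine strictMono_nat_of_lt_succ fun i => ?_
      have hne : U (φ i) ≠ [] := Nat.nth_mem_of_infinite hinf i
      have := List.length_pos_of_ne_nil hne
      have := hlen i
      omega
    · simp only [hzero, List.length_nil, Nat.add_zero]
      have hv' : (v ++ₛ y).take v.length = v := by
        simpa using (Stream'.append_take 0 v y).symm
      rwa [← take_eq_seg, hv']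
    · rw [hblock]
      exact h0 _ _ (hU _)
    · obtain ⟨i₀, hi₀⟩ := h1 s
      refine ⟨i₀, fun i hi => ?_⟩
      rw [hblock]
      exact hi₀ (φ i) (hi.trans (hφm.id_le i)) _ (hU _)
  · rintro ⟨p, hp, k, hk, hM, N, h0, h1⟩
    have hU : ∀ i, (Stream'.Seq.ofStream fun i => seg x.get (k i) (k (i + 1))).get? i =
        some (seg x.get (k i) (k (i + 1))) := fun i => rfl
    refine ⟨p, hp, seg x.get 0 (k 0), hM, x.drop (k 0),
      ⟨Stream'.Seq.ofStream fun i => seg x.get (k i) (k (i + 1)), ?_, ?_, ?_⟩, ?_⟩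
    · rw [BSExpr.lang_eq]
      refine ⟨N, fun i w hw => ?_, fun s => ?_⟩
      · rw [hU] at hw
        cases hw
        exact h0 i
      · obtain ⟨i₀, hi₀⟩ := h1 s
        refine ⟨i₀, fun i hi w hw => ?_⟩
        rw [hU] at hw
        cases hw
        exact hi₀ i hi
    · refine Eventually.frequently (Eventually.of_forall fun i => ⟨_, hU i, ?_⟩)
      have : k i < k (i + 1) := hk (Nat.lt_succ_self i)
      intro he
      have h2 := length_seg x.get (k i) (k (i + 1))
      rw [he, List.length_nil] at h2
      omega
    · intro n
      rw [take_eq_map_range hU]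
      have : ∀ n, ((List.range n).map fun i => seg x.get (k i) (k (i + 1))).flatten =
          seg x.get (k 0) (k n) := by
        intro n
        change pre _ n = _
        induction n with
        | zero => simp [pre_zero, seg_self]
        | succ n ih =>
          rw [pre_succ, ih, seg_append _ (hk.monotone (Nat.zero_le n)) (hk.monotone (Nat.le_succ n))]
      rw [this, length_seg, take_eq_seg]
      obtain ⟨m, hm⟩ := Nat.exists_eq_add_of_le (hk.monotone (Nat.zero_le n))
      have h3 := seg_shift x.get (k 0) 0 m
      rw [Nat.add_zero] at h3
      rw [hm, h3, Nat.add_sub_cancel_left]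
      congr 1
      funext i
      rw [Stream'.get_drop]
    · rw [← take_eq_seg]
      exact (Stream'.append_take_drop _ _).symm

theorem omegaTerm_mono {M M' : Language α} (h : ∀ w ∈ M, w ∈ M') (R : CostLang α) :
    omegaTerm M R ⊆ omegaTerm M' R := by
  rintro x ⟨k, hk, hM, h'⟩
  exact ⟨k, hk, h _ hM, h'⟩

theorem omegaTerm_subset_of_sound {M : Language α} {X R : CostLang α}
    (h : ∀ b, ∃ b', ∀ s, ∀ w ∈ X b s, w ∈ R b' s) : omegaTerm M X ⊆ omegaTerm M R := by
  rintro x ⟨k, hk, hM, N, h0, h1⟩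
  obtain ⟨N', hN'⟩ := h N
  refine ⟨k, hk, hM, N', fun i => hN' 0 _ (h0 i), fun s => ?_⟩
  obtain ⟨i₀, hi₀⟩ := h1 s
  exact ⟨i₀, fun i hi => hN' s _ (hi₀ i hi)⟩

/-- `M` is stable under concatenation, on the right, with the words of `R`. -/
def Absorbs (M : Language α) (R : CostLang α) : Prop :=
  ∀ w ∈ M, ∀ b, ∀ u ∈ R b 0, w ++ u ∈ M

theorem Absorbs.seg_mem {M : Language α} {R : CostLang α} (h : Absorbs M R) {x : ℕ → α}
    {k : ℕ → ℕ} (hk : Monotone k) (hM : seg x 0 (k 0) ∈ M) {N : ℕ}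
    (h0 : ∀ i, seg x (k i) (k (i + 1)) ∈ R N 0) (n : ℕ) : seg x 0 (k n) ∈ M := by
  induction n with
  | zero => exact hM
  | succ n ih =>
    rw [← seg_append x (Nat.zero_le _) (hk (Nat.le_succ n))]
    exact h _ ih N _ (h0 n)

/-- Completeness yields words of `X` only for words of `R` above some threshold, so finitely many
initial blocks may be lost. They are moved into the prefix, and `M` has to absorb them. -/
theorem omegaTerm_subset_of_complete {M : Language α} {X R : CostLang α} (hM : Absorbs M R)
    (h : ∀ b, ∃ b', ∀ s', ∃ s, ∀ w ∈ R b s, w ∈ X b' s') : omegaTerm M R ⊆ omegaTerm M X := by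
  rintro x ⟨k, hk, hM0, N, h0, h1⟩
  obtain ⟨N', hN'⟩ := h N
  have h2 : ∀ s', ∃ i₀, ∀ i ≥ i₀, seg x.get (k i) (k (i + 1)) ∈ X N' s' := by
    intro s'
    obtain ⟨s, hs⟩ := hN' s'
    obtain ⟨i₀, hi₀⟩ := h1 s
    exact ⟨i₀, fun i hi => hs _ (hi₀ i hi)⟩
  obtain ⟨j, hj⟩ := h2 0
  refine ⟨fun i => k (j + i), fun a b hab => hk (by omega), hM.seg_mem hk.monotone hM0 h0 _, N',
    fun i => hj (j + i) (by omega), fun s => ?_⟩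
  obtain ⟨i₀, hi₀⟩ := h2 s
  exact ⟨i₀, fun i hi => hi₀ (j + i) (by omega)⟩

/-- Sequences of concatenations are sequences. -/
theorem omegaTerm_iter_subset {M : Language α} {R : CostLang α} (hR : CostMono R)
    (P : CountCond) : omegaTerm M (iter P R) ⊆ omegaTerm M R := by
  rintro x ⟨k, hk, hM, N, h0, h1⟩
  obtain ⟨f, hf, h⟩ := exists_threshold (p := fun i s => seg x.get (k i) (k (i + 1)) ∈ iter P R N s)
    h0 h1
  have : ∀ i, ∃ l : List (List α), l.flatten = seg x.get (k i) (k (i + 1)) ∧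
      ∀ u ∈ l, u ∈ R N (f i) ∧ u ≠ [] := by
    intro i
    obtain ⟨l, hl, hl', -⟩ := h i
    -- Empty factors are discarded because the cuts must increase strictly.
    refine ⟨l.filter fun u => !u.isEmpty, ?_, fun u hu => ?_⟩
    · rw [← hl]
      exact List.flatten_filter_not_isEmpty
    · simp only [List.mem_filter] at hu
      exact ⟨hl' u hu.1, by simpa using hu.2⟩
  choose L hL hL' using this
  have hne : ∀ i, L i ≠ [] := by
    intro i he
    have h2 := hL i
    rw [he, List.flatten_nil] at h2
    have h3 := length_seg x.get (k i) (k (i + 1))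
    rw [← h2, List.length_nil] at h3
    have : k i < k (i + 1) := hk (Nat.lt_succ_self i)
    omega
  obtain ⟨U, hU⟩ := exists_seg_eq hne
  -- `U` lists all factors and those of the `i`-th word occupy the indices from `t i` to `t (i +
  -- 1)`; they inherit the threshold `f i`.
  set t := fun i => (pre L i).length with ht
  have htm : StrictMono t := strictMono_length_pre hne
  have ht0 : t 0 = 0 := rfl
  have hUL : ∀ j, ∃ i, t i ≤ j ∧ j < t (i + 1) ∧ U j ∈ L i := by
    intro j
    obtain ⟨i, hi, hi'⟩ := exists_index_of_strictMono htm (j := j) (by omega)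
    exact ⟨i, hi, hi', by rw [← hU i]; exact mem_seg.2 ⟨j, hi, hi', rfl⟩⟩
  have hUne : ∀ j, U j ≠ [] := fun j => by
    obtain ⟨i, -, -, hi⟩ := hUL j
    exact (hL' i _ hi).2
  have hA : ∀ i, pre U (t i) = seg x.get (k 0) (k i) := by
    intro i
    rw [← flatten_seg_zero, seg_zero_eq_pre hU]
    induction i with
    | zero => simp [pre_zero, seg_self]
    | succ i ih =>
      rw [pre_succ, List.flatten_append, ih, hL,
        seg_append _ (hk.monotone (Nat.zero_le i)) (hk.monotone (Nat.le_succ i))]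
  have hB : ∀ j, pre U j = seg x.get (k 0) (k 0 + (pre U j).length) := by
    intro j
    have hle : j ≤ t j := htm.id_le j
    have : pre U j ++ (seg U j (t j)).flatten = seg x.get (k 0) (k j) := by
      rw [← hA, ← flatten_seg_zero, ← flatten_seg_zero, ← List.flatten_append,
        seg_append _ (Nat.zero_le _) hle]
    exact (eq_seg_of_append this).1
  have hC : ∀ j, seg x.get (k 0 + (pre U j).length) (k 0 + (pre U (j + 1)).length) = U j := by
    intro j
    have h2 := hB (j + 1)
    rw [pre_succ] at h2
    rw [pre_succ]
    exact (eq_seg_of_append h2).2.symm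
  refine ⟨fun j => k 0 + (pre U j).length, fun a b hab => ?_, ?_, N, fun j => ?_, fun s => ?_⟩
  · have := strictMono_length_pre hUne hab
    simp only at this ⊢
    omega
  · simpa [pre_zero] using hM
  · rw [hC]
    obtain ⟨i, -, -, hi⟩ := hUL j
    exact hR le_rfl (Nat.zero_le _) _ (hL' i _ hi).1
  · obtain ⟨i₀, hi₀⟩ := hf.exists_ge s
    refine ⟨t i₀, fun j hj => ?_⟩
    rw [hC]
    obtain ⟨i, hi1, hi2, hi⟩ := hUL j
    have : i₀ < i + 1 := htm.lt_iff_lt.1 (lt_of_le_of_lt hj hi2)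
    exact hR le_rfl (hi₀ i (by omega)) _ (hL' i _ hi).1

end OmegaBS

/-! ### Values of a counter along finite and infinite sequences of actions. -/

namespace OmegaBS

open Filter

/-! ### The value of a counter along a sequence of actions -/

/-- The effect of an action on the value of a counter. -/
def Action.apply : Action → ℕ → ℕ
  | .inc, n => n + 1
  | .reset, _ => 0
  | .none, n => n

/-- The value of a counter after a list of actions, starting from `n`. -/
def countFrom (n : ℕ) (l : List Action) : ℕ := l.foldl (fun n a => a.apply n) n

/-- The value of the counter, starting from `n`, is at most `b` after each increment. -/
def okB (b : ℕ) : ℕ → List Action → Prop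
  | _, [] => True
  | n, .inc :: l => n + 1 ≤ b ∧ okB b (n + 1) l
  | _, .reset :: l => okB b 0 l
  | n, .none :: l => okB b n l

/-- The value of the counter, starting from `n`, is at least `s` before each reset, and at the
end if `e` is true. -/
def okS (s : ℕ) (e : Bool) : ℕ → List Action → Prop
  | n, [] => e = true → s ≤ n
  | n, .inc :: l => okS s e (n + 1) l
  | n, .reset :: l => s ≤ n ∧ okS s e 0 l
  | n, .none :: l => okS s e n l

theorem countFrom_nil (n : ℕ) : countFrom n [] = n := rfl

theorem countFrom_cons (n : ℕ) (a : Action) (l : List Action) :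
    countFrom n (a :: l) = countFrom (a.apply n) l := rfl

theorem countFrom_append (n : ℕ) (l l' : List Action) :
    countFrom n (l ++ l') = countFrom (countFrom n l) l' := List.foldl_append ..

theorem okB_append {b n : ℕ} {l l' : List Action} :
    okB b n (l ++ l') ↔ okB b n l ∧ okB b (countFrom n l) l' := by
  induction l generalizing n with
  | nil => simp [okB, countFrom_nil]
  | cons a l ih => cases a <;> simp [okB, ih, countFrom_cons, Action.apply, and_assoc]

theorem okS_append {s n : ℕ} {e : Bool} {l l' : List Action} :
    okS s e n (l ++ l') ↔ okS s false n l ∧ okS s e (countFrom n l) l' := by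
  induction l generalizing n with
  | nil => simp [okS, countFrom_nil]
  | cons a l ih => cases a <;> simp [okS, ih, countFrom_cons, Action.apply, and_assoc]

theorem okS_true_iff {s n : ℕ} {l : List Action} :
    okS s true n l ↔ okS s false n l ∧ s ≤ countFrom n l := by
  induction l generalizing n with
  | nil => simp [okS, countFrom_nil]
  | cons a l ih => cases a <;> simp [okS, ih, countFrom_cons, Action.apply, and_assoc]

theorem okS.to_false {s n : ℕ} {e : Bool} {l : List Action} (h : okS s e n l) :
    okS s false n l := by
  cases e
  · exact h
  · exact (okS_true_iff.1 h).1

theorem okS.mono {s s' n n' : ℕ} {e : Bool} {l : List Action} (h : okS s e n l) (hs : s' ≤ s)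
    (hn : n ≤ n') : okS s' e n' l := by
  induction l generalizing n n' with
  | nil => exact fun he => hs.trans ((h he).trans hn)
  | cons a l ih =>
    cases a with
    | inc => exact ih (n := n + 1) h (by omega)
    | reset => exact ⟨hs.trans (h.1.trans hn), ih h.2 le_rfl⟩
    | none => exact ih (n := n) h hn

theorem okS_zero {n : ℕ} {e : Bool} {l : List Action} : okS 0 e n l := by
  induction l generalizing n with
  | nil => exact fun _ => Nat.zero_le _
  | cons a l ih =>
    cases a with
    | inc => exact ih
    | reset => exact ⟨Nat.zero_le _, ih⟩
    | none => exact ih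

theorem okB.mono {b b' n n' : ℕ} {l : List Action} (h : okB b n l) (hb : b ≤ b')
    (hn : n' ≤ n) : okB b' n' l := by
  induction l generalizing n n' with
  | nil => trivial
  | cons a l ih =>
    cases a with
    | inc => exact ⟨by have := h.1; omega, ih h.2 (by omega)⟩
    | reset => exact ih (n := 0) h le_rfl
    | none => exact ih (n := n) h hn

theorem okB.add {b n m : ℕ} {l : List Action} (h : okB b n l) : okB (b + m) (n + m) l := by
  induction l generalizing n with
  | nil => trivial
  | cons a l ih =>
    cases a with
    | inc => exact ⟨by have := h.1; omega, by have := ih h.2; rwa [Nat.add_right_comm] at this⟩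
    | reset => exact (ih (n := 0) h).mono le_rfl (by omega)
    | none => exact ih (n := n) h

theorem okB.countFrom_le {b n : ℕ} {l : List Action} (h : okB b n l) (hn : n ≤ b) :
    countFrom n l ≤ b := by
  induction l generalizing n with
  | nil => exact hn
  | cons a l ih =>
    cases a with
    | inc => exact ih h.2 h.1
    | reset => exact ih (n := 0) h (Nat.zero_le _)
    | none => exact ih (n := n) h hn

theorem countFrom_mono {n n' : ℕ} {l : List Action} (hn : n ≤ n') :
    countFrom n l ≤ countFrom n' l := by
  induction l generalizing n n' with
  | nil => exact hn
  | cons a l ih =>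
    cases a with
    | inc => exact ih (Nat.succ_le_succ hn)
    | reset => exact ih le_rfl
    | none => exact ih hn

theorem countFrom_eq_of_mem {n n' : ℕ} {l : List Action} (h : Action.reset ∈ l) :
    countFrom n l = countFrom n' l := by
  induction l generalizing n n' with
  | nil => cases h
  | cons a l ih =>
    cases a with
    | inc => exact ih (by simpa using h)
    | reset => rfl
    | none => exact ih (by simpa using h)

theorem countFrom_of_not_mem {n : ℕ} {l : List Action} (h : Action.reset ∉ l) :
    countFrom n l = n + countFrom 0 l := by
  induction l generalizing n with
  | nil => rfl
  | cons a l ih =>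
    have h' : Action.reset ∉ l := fun h' => h (List.mem_cons_of_mem _ h')
    cases a with
    | inc =>
      rw [countFrom_cons, countFrom_cons]
      simp only [Action.apply]
      rw [ih h', ih h' (n := 0 + 1)]
      omega
    | reset => exact absurd (by simp) h
    | none => exact ih h'

theorem countFrom_le_add_length (n : ℕ) (l : List Action) : countFrom n l ≤ n + l.length := by
  induction l generalizing n with
  | nil => exact le_rfl
  | cons a l ih =>
    have := ih (a.apply n)
    rw [countFrom_cons, List.length_cons]
    cases a <;> simp only [Action.apply] at this ⊢ <;> omega

/-! ### The value of a counter along an infinite sequence of actions -/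

/-- The value of a counter before the `k`-th action. -/
def cnt (a : ℕ → Action) (k : ℕ) : ℕ := countFrom 0 (seg a 0 k)

theorem cnt_eq_countFrom (a : ℕ → Action) {p q : ℕ} (h : p ≤ q) :
    cnt a q = countFrom (cnt a p) (seg a p q) := by
  rw [cnt, cnt, ← countFrom_append, seg_append a (Nat.zero_le p) h]

theorem cnt_succ (a : ℕ → Action) (k : ℕ) : cnt a (k + 1) = (a k).apply (cnt a k) := by
  rw [cnt, seg_succ a (Nat.zero_le k), countFrom_append]
  rfl

theorem okS_seg_iff (a : ℕ → Action) {s p q : ℕ} (h : p ≤ q) :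
    okS s false (cnt a p) (seg a p q) ↔ ∀ r, p ≤ r → r < q → a r = .reset → s ≤ cnt a r := by
  induction q, h using Nat.le_induction with
  | base =>
    rw [seg_self]
    exact ⟨fun _ r hr hr' => by omega, fun _ => by simp [okS]⟩
  | succ q hpq ih =>
    rw [seg_succ a hpq, okS_append, ih, ← cnt_eq_countFrom a hpq]
    have key : okS s false (cnt a q) [a q] ↔ (a q = .reset → s ≤ cnt a q) := by
      rcases hq : a q <;> simp [okS]
    rw [key]
    constructor
    · rintro ⟨h1, h2⟩ r hr hr'
      rcases Nat.lt_succ_iff_lt_or_eq.1 hr' with h3 | rfl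
      · exact h1 r hr h3
      · exact h2
    · intro h1
      exact ⟨fun r hr hr' => h1 r hr (by omega), h1 q hpq (Nat.lt_succ_self q)⟩

theorem okB_seg (a : ℕ → Action) {b p q : ℕ} (h : p ≤ q)
    (hb : ∀ k, k ≤ q → cnt a k ≤ b) : okB b (cnt a p) (seg a p q) := by
  induction q, h using Nat.le_induction with
  | base => rw [seg_self]; trivial
  | succ q hpq ih =>
    rw [seg_succ a hpq, okB_append, ← cnt_eq_countFrom a hpq]
    refine ⟨ih fun k hk => hb k (by omega), ?_⟩
    have h1 := hb (q + 1) le_rfl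
    rw [cnt_succ] at h1
    rcases hq : a q
    · rw [hq] at h1
      exact ⟨h1, trivial⟩
    all_goals trivial

theorem cnt_le_of_okB (a : ℕ → Action) {b p q : ℕ} (h : p ≤ q) (hp : cnt a p ≤ b)
    (hb : okB b (cnt a p) (seg a p q)) : cnt a q ≤ b := by
  rw [cnt_eq_countFrom a h]
  exact hb.countFrom_le hp

theorem okB.of_seg_le {a : ℕ → Action} {b n p q r : ℕ} (hpq : p ≤ q) (hqr : q ≤ r)
    (h : okB b n (seg a p r)) : okB b n (seg a p q) := by
  rw [← seg_append a hpq hqr, okB_append] at h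
  exact h.1

theorem cnt_le_of_forall_ne_reset (a : ℕ → Action) {p q : ℕ} (h : p ≤ q)
    (h' : ∀ r, p ≤ r → r < q → a r ≠ .reset) : cnt a p ≤ cnt a q := by
  induction q, h using Nat.le_induction with
  | base => exact le_rfl
  | succ q hpq ih =>
    refine (ih fun r hr hr' => h' r hr (by omega)).trans ?_
    rw [cnt_succ]
    have := h' q hpq (Nat.lt_succ_self q)
    cases hq : a q <;> simp_all [Action.apply]

section
variable {Γ Q : Type} {ρ : ℕ → Transition Q Γ} {c : Γ}

theorem nth_mem_resetPositions (h : (resetPositions ρ c).Infinite) (i : ℕ) :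
    (ρ (Nat.nth (· ∈ resetPositions ρ c) i)).action c = .reset :=
  Nat.nth_mem_of_infinite (p := (· ∈ resetPositions ρ c)) h i

theorem exists_nth_eq (h : (resetPositions ρ c).Infinite) {r : ℕ}
    (hr : (ρ r).action c = .reset) : ∃ n, Nat.nth (· ∈ resetPositions ρ c) n = r := by
  have : r ∈ Set.range (Nat.nth (· ∈ resetPositions ρ c)) := by
    rw [Nat.range_nth_of_infinite (p := (· ∈ resetPositions ρ c)) h]
    exact hr
  exact this

theorem action_ne_reset_of_segment (h : (resetPositions ρ c).Infinite) {i r : ℕ}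
    (h1 : segmentStart ρ c i ≤ r) (h2 : r < Nat.nth (· ∈ resetPositions ρ c) i) :
    (ρ r).action c ≠ .reset := by
  intro hr
  obtain ⟨n, rfl⟩ := exists_nth_eq h hr
  have hm := Nat.nth_strictMono (p := (· ∈ resetPositions ρ c)) h
  have h3 := hm.lt_iff_lt.1 h2
  cases i with
  | zero => omega
  | succ i =>
    rw [segmentStart] at h1
    have h4 := hm.lt_iff_lt.1 (Nat.lt_of_succ_le h1)
    omega

theorem cnt_segmentStart (h : (resetPositions ρ c).Infinite) (i : ℕ) :
    cnt (fun k => (ρ k).action c) (segmentStart ρ c i) = 0 := by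
  cases i with
  | zero => rfl
  | succ i =>
    rw [segmentStart, cnt_succ, nth_mem_resetPositions h]
    rfl

/-- No reset occurs inside a segment and the counter enters it with value zero, so counting
increments and running the counter agree. -/
theorem counterValues_eq (h : (resetPositions ρ c).Infinite) (i : ℕ) :
    counterValues ρ c i =
      cnt (fun k => (ρ k).action c) (Nat.nth (· ∈ resetPositions ρ c) i) := by
  have hle : segmentStart ρ c i ≤ Nat.nth (· ∈ resetPositions ρ c) i := by
    cases i with
    | zero => exact Nat.zero_le _
    | succ i =>
      exact Nat.nth_strictMono (p := (· ∈ resetPositions ρ c)) h (Nat.lt_succ_self i)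
  have key : ∀ m, segmentStart ρ c i ≤ m → m ≤ Nat.nth (· ∈ resetPositions ρ c) i →
      {k | segmentStart ρ c i ≤ k ∧ k < m ∧ (ρ k).action c = .inc}.ncard =
        cnt (fun k => (ρ k).action c) m := by
    intro m hm
    induction m, hm using Nat.le_induction with
    | base =>
      intro _
      rw [cnt_segmentStart h]
      convert Set.ncard_empty ℕ
      ext k
      simp only [Set.mem_ofPred_eq, Set.mem_empty_iff_false, iff_false]
      omega
    | succ m hm ih =>
      intro hm'
      rw [cnt_succ, ← ih (by omega)]
      have hne := action_ne_reset_of_segment h hm (Nat.lt_of_succ_le hm')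
      cases hact : (ρ m).action c with
      | reset => exact absurd hact hne
      | none =>
        simp only [Action.apply]
        congr 1
        ext k
        simp only [Set.mem_ofPred_eq]
        constructor
        · rintro ⟨h1, h2, h3⟩
          refine ⟨h1, lt_of_le_of_ne (by omega) ?_, h3⟩
          rintro rfl
          rw [hact] at h3
          cases h3
        · rintro ⟨h1, h2, h3⟩
          exact ⟨h1, by omega, h3⟩
      | inc =>
        simp only [Action.apply]
        rw [← Set.ncard_insert_of_notMem (a := m) (by simp)
          ((Set.finite_lt_nat m).subset fun k hk => hk.2.1)]
        congr 1
        ext k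
        simp only [Set.mem_ofPred_eq, Set.mem_insert_iff]
        constructor
        · rintro ⟨h1, h2, h3⟩
          rcases Nat.lt_succ_iff_lt_or_eq.1 h2 with h4 | rfl
          · exact Or.inr ⟨h1, h4, h3⟩
          · exact Or.inl rfl
        · rintro (rfl | ⟨h1, h2, h3⟩)
          · exact ⟨hm, by omega, hact⟩
          · exact ⟨h1, by omega, h3⟩
  exact key _ hle le_rfl

/-- The asymptotic condition on a counter in terms of its values at all positions. -/
def CounterType.LimitCond : CounterType → (ℕ → Action) → Prop
  | .B, a => ∃ N, ∀ k, cnt a k ≤ N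
  | .S, a => ∀ s, ∃ p, ∀ k ≥ p, a k = .reset → s ≤ cnt a k

/-- For type `B`, the value can only grow until the next reset, so a bound at resets bounds it
everywhere. For type `S`, both sides speak of the values at late resets. -/
theorem condition_counterValues_iff (h : (resetPositions ρ c).Infinite) (t : CounterType) :
    t.Condition (counterValues ρ c) ↔ t.LimitCond fun k => (ρ k).action c := by
  have hm := Nat.nth_strictMono (p := (· ∈ resetPositions ρ c)) h
  cases t with
  | B =>
    constructor
    · rintro ⟨N, hN⟩
      refine ⟨N, fun k => ?_⟩
      classical
      have hex : ∃ r, k ≤ r ∧ (ρ r).action c = .reset := by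
        obtain ⟨r, hr, hr'⟩ := h.exists_gt k
        exact ⟨r, hr'.le, hr⟩
      obtain ⟨n, hn⟩ := exists_nth_eq h (Nat.find_spec hex).2
      refine (cnt_le_of_forall_ne_reset _ (Nat.find_spec hex).1 fun r hr hr' hres => ?_).trans ?_
      · exact Nat.find_min hex hr' ⟨hr, hres⟩
      · rw [← hn, ← counterValues_eq h]
        exact hN n
    · rintro ⟨N, hN⟩
      exact ⟨N, fun i => by rw [counterValues_eq h]; exact hN _⟩
  | S =>
    constructor
    · intro hS s
      obtain ⟨i₀, hi₀⟩ := StronglyUnbounded.exists_ge hS s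
      refine ⟨Nat.nth (· ∈ resetPositions ρ c) i₀, fun k hk hres => ?_⟩
      obtain ⟨n, rfl⟩ := exists_nth_eq h hres
      rw [← counterValues_eq h]
      exact hi₀ n (hm.le_iff_le.1 hk)
    · intro hS
      refine tendsto_atTop.2 fun s => ?_
      obtain ⟨p, hp⟩ := hS s
      filter_upwards [eventually_ge_atTop p] with i hi
      rw [counterValues_eq h]
      exact hp _ (hi.trans (hm.id_le i)) (nth_mem_resetPositions h i)

theorem infinite_resetPositions_iff : (resetPositions ρ c).Infinite ↔
    ∀ n, ∃ k ≥ n, (ρ k).action c = .reset := by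
  constructor
  · intro h n
    obtain ⟨k, hk, hk'⟩ := h.exists_gt n
    exact ⟨k, hk'.le, hk⟩
  · intro h
    refine Set.infinite_of_not_bddAbove ?_
    rintro ⟨n, hn⟩
    obtain ⟨k, hk, hk'⟩ := h (n + 1)
    have := hn hk'
    omega

end

end OmegaBS

/-! ### Languages represented by expressions, and Kleene's theorem with constrained path lengths. -/

namespace OmegaBS

open Filter

variable {α : Type*}

/-! ### Definable languages -/

/-- Languages with costs that are represented by a `T`-regular expression. -/
def Definable (T : Variant) (R : CostLang α) : Prop :=
  ∃ e : BSExpr α, e.IsVariant T ∧ Represents e.val R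

theorem Definable.costMono {T : Variant} {R : CostLang α} (h : Definable T R) : CostMono R :=
  h.choose_spec.2.mono_right

theorem Definable.of_represents {T : Variant} {X R : CostLang α} (h : Definable T X)
    (h' : Represents X R) : Definable T R :=
  let ⟨e, he, hr⟩ := h
  ⟨e, he, hr.trans h'⟩

theorem Definable.zero (T : Variant) : Definable T (0 : CostLang α) :=
  ⟨.empty, trivial, Represents.refl CostMono.zero⟩

theorem Definable.add {T : Variant} {R R' : CostLang α} (h : Definable T R)
    (h' : Definable T R') : Definable T (R + R') :=
  let ⟨e, he, hr⟩ := h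
  let ⟨f, hf, hr'⟩ := h'
  ⟨.mix e f, ⟨he, hf⟩, hr.add hr'⟩

theorem Definable.mul {T : Variant} {R R' : CostLang α} (h : Definable T R)
    (h' : Definable T R') : Definable T (R * R') :=
  let ⟨e, he, hr⟩ := h
  let ⟨f, hf, hr'⟩ := h'
  ⟨.concat e f, ⟨he, hf⟩, hr.mul hr'⟩

theorem Definable.star {T : Variant} {R : CostLang α} (h : Definable T R) :
    Definable T (iter anyCount R) :=
  let ⟨e, he, hr⟩ := h
  ⟨.star e, he, hr.iter countMono_anyCount⟩

theorem Definable.bexp {T : Variant} {R : CostLang α} (hT : T.AllowsB) (h : Definable T R) :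
    Definable T (iter atMost R) :=
  let ⟨e, he, hr⟩ := h
  ⟨.bexp e, ⟨hT, he⟩, hr.iter countMono_atMost⟩

theorem Definable.sexp {T : Variant} {R : CostLang α} (hT : T.AllowsS) (h : Definable T R) :
    Definable T (iter atLeast R) :=
  let ⟨e, he, hr⟩ := h
  ⟨.sexp e, ⟨hT, he⟩, hr.iter countMono_atLeast⟩

/-- The union of a family of languages with costs. -/
def union {ι : Type*} (R : ι → CostLang α) : CostLang α := fun b s => {w | ∃ i, w ∈ R i b s}

theorem mem_union {ι : Type*} {R : ι → CostLang α} {b s : ℕ} {w : List α} :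
    w ∈ union R b s ↔ ∃ i, w ∈ R i b s := Iff.rfl

theorem mem_sum_apply {ι : Type*} (S : Finset ι) (R : ι → CostLang α) {b s : ℕ} {w : List α} :
    w ∈ (∑ i ∈ S, R i) b s ↔ ∃ i ∈ S, w ∈ R i b s := by
  classical
  induction S using Finset.induction_on with
  | empty => simp
  | insert i S hi ih => rw [Finset.sum_insert hi, mem_add_apply, ih]; simp

theorem Definable.union {T : Variant} {ι : Type*} [Finite ι] {R : ι → CostLang α}
    (h : ∀ i, Definable T (R i)) : Definable T (OmegaBS.union R) := by
  classical
  have := Fintype.ofFinite ι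
  have key : ∀ S : Finset ι, Definable T (∑ i ∈ S, R i) := by
    intro S
    induction S using Finset.induction_on with
    | empty => exact Definable.zero T
    | insert i S hi ih => rw [Finset.sum_insert hi]; exact (h i).add ih
  have e : OmegaBS.union R = ∑ i ∈ Finset.univ, R i := by
    funext b s
    ext w
    rw [mem_sum_apply, mem_union]
    simp
  rw [e]
  exact key _

/-- The language `R` if `p` holds, and the empty language otherwise. -/
def onlyIf (p : Prop) (R : CostLang α) : CostLang α := fun b s => {w | p ∧ w ∈ R b s}

theorem Definable.onlyIf {T : Variant} {p : Prop} {R : CostLang α} (h : p → Definable T R) :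
    Definable T (onlyIf p R) := by
  by_cases hp : p
  · have e : OmegaBS.onlyIf p R = R := by
      funext b s
      ext w
      exact ⟨fun h => h.2, fun h => ⟨hp, h⟩⟩
    rw [e]
    exact h hp
  · have e : OmegaBS.onlyIf p R = 0 := by
      funext b s
      ext w
      exact ⟨fun h => hp h.1, fun h => h.elim⟩
    rw [e]
    exact Definable.zero T

/-- A language contained in a definable singleton is definable. -/
theorem Definable.of_singleton {T : Variant} {w₀ : List α} {e : BSExpr α} (he : e.IsVariant T)
    (hval : ∀ b s w, w ∈ e.val b s ↔ w = w₀) {R : CostLang α} (hR : CostMono R)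
    (hsub : ∀ b s, ∀ w ∈ R b s, w = w₀) : Definable T R := by
  -- If no single bound keeps `w₀` at all thresholds, then for every bound the language is empty
  -- above some threshold, and it is represented by the empty expression.
  by_cases h : ∃ b, ∀ s, w₀ ∈ R b s
  · obtain ⟨b₀, h⟩ := h
    refine ⟨e, he, e.costMono_val, hR, fun b => ⟨b₀, fun s w hw => ?_⟩,
      fun b => ⟨b, fun s => ⟨s, fun w hw => (hval _ _ _).2 (hsub _ _ w hw)⟩⟩⟩
    rw [(hval _ _ _).1 hw]
    exact h s
  · push Not at h
    refine ⟨.empty, trivial, CostMono.zero, hR, fun b => ⟨b, fun s w hw => hw.elim⟩,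
      fun b => ⟨b, fun s' => ?_⟩⟩
    obtain ⟨s, hs⟩ := h b
    exact ⟨s, fun w hw => (hs (hsub _ _ w hw ▸ hw)).elim⟩

/-! ### Paths in finite graphs labelled by languages -/

section Paths

variable {X : Type*}

/-- Words along nonempty paths whose intermediate vertices belong to `V`; the number is the
length of the path. -/
inductive LPath (L : X → X → Language α) (V : Set X) : X → X → ℕ → List α → Prop
  | edge {x y : X} {u : List α} : u ∈ L x y → LPath L V x y 1 u
  | cons {x z y : X} {k : ℕ} {u v : List α} : u ∈ L x z → z ∈ V → LPath L V z y k v →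
      LPath L V x y (k + 1) (u ++ v)

variable {L : X → X → Language α} {V : Set X} {x y z : X} {k m : ℕ} {u v w : List α}

theorem LPath.mono {L' : X → X → Language α} {V' : Set X} (h : LPath L V x y k w)
    (hL : ∀ x y, ∀ w ∈ L x y, w ∈ L' x y) (hV : V ⊆ V') : LPath L' V' x y k w := by
  induction h with
  | edge h => exact .edge (hL _ _ _ h)
  | cons h hz _ ih => exact .cons (hL _ _ _ h) (hV hz) ih

theorem LPath.append (h : LPath L V x z k u) (hz : z ∈ V) (h' : LPath L V z y m v) :
    LPath L V x y (k + m) (u ++ v) := by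
  induction h with
  | edge h => rw [Nat.add_comm]; exact .cons h hz h'
  | cons h hz' _ ih =>
    rw [List.append_assoc, Nat.add_right_comm]
    exact .cons h hz' (ih hz h')

theorem LPath.pos (h : LPath L V x y k w) : 1 ≤ k := by
  cases h <;> omega

theorem LPath.append_loops (h : LPath L V x z k u) (hz : z ∈ V) {l : List (ℕ × List α)}
    (hl : ∀ p ∈ l, LPath L V z z p.1 p.2) :
    LPath L V x z (k + (l.map Prod.fst).sum) (u ++ (l.map Prod.snd).flatten) := by
  induction l generalizing k u with
  | nil => simpa using h
  | cons p l ih =>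
    have := ih (h.append hz (hl p (by simp))) fun q hq => hl q (by simp [hq])
    simpa [Nat.add_assoc] using this

/-- Decomposition of a path at its visits of a vertex. -/
theorem LPath.split (h : LPath L (insert z V) x y k w) : LPath L V x y k w ∨
    ∃ k₁ u k₂ v, ∃ l : List (ℕ × List α), LPath L V x z k₁ u ∧
      (∀ p ∈ l, LPath L V z z p.1 p.2) ∧ LPath L V z y k₂ v ∧
      w = u ++ (l.map Prod.snd).flatten ++ v ∧ k = k₁ + (l.map Prod.fst).sum + k₂ := by
  induction h with
  | edge h => exact Or.inl (.edge h)
  | @cons x z' y k u v h hz' _ ih =>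
    rcases ih with ih | ⟨k₁, u', k₂, v', l, h1, h2, h3, rfl, rfl⟩
    · rcases hz' with rfl | hz'
      · exact Or.inr ⟨1, u, k, v, [], .edge h, by simp, ih, by simp, by simp; omega⟩
      · exact Or.inl (.cons h hz' ih)
    · rcases hz' with rfl | hz'
      · refine Or.inr ⟨1, u, k₂, v', (k₁, u') :: l, .edge h, ?_, h3, by simp, by simp; omega⟩
        rintro p (_ | ⟨_, hp⟩)
        · exact h1
        · exact h2 p hp
      · exact Or.inr ⟨k₁ + 1, u ++ u', k₂, v', l, .cons h hz' h1, h2, h3, by simp, by omega⟩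

/-- A long path visits some vertex often. -/
theorem LPath.exists_loops (hV : V.Finite) (s : ℕ) : ∃ K, ∀ (L : X → X → Language α) (x y : X)
    (k : ℕ) (w : List α), LPath L V x y k w → K ≤ k →
      ∃ z, ∃ k₁ u k₂ v, ∃ l : List (ℕ × List α), LPath L V x z k₁ u ∧
        (∀ p ∈ l, LPath L V z z p.1 p.2) ∧ LPath L V z y k₂ v ∧
        w = u ++ (l.map Prod.snd).flatten ++ v ∧ s ≤ l.length := by
  induction V, hV using Set.Finite.induction_on with
  | empty =>
    refine ⟨2, fun L x y k w h hk => ?_⟩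
    cases h with
    | edge _ => omega
    | cons _ hz _ => exact hz.elim
  | @insert z V hz hV ih =>
    obtain ⟨K, hK⟩ := ih
    -- If `z` has fewer than `s` loops and the two end pieces and all the loops are shorter than
    -- `K`, the path is shorter than `(s + 2) * K`. Otherwise one of these pieces, which avoids `z`
    -- inside, has length at least `K`, and the induction hypothesis applies to it; the rest is
    -- attached at its ends.
    refine ⟨(s + 2) * K + 1, fun L x y k w h hk => ?_⟩
    have hsub : V ⊆ insert z V := Set.subset_insert z V
    have up : ∀ {x y k w}, LPath L V x y k w → LPath L (insert z V) x y k w :=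
      fun h => h.mono (fun _ _ _ h => h) hsub
    have hmem : ∀ {x y k w}, LPath L V x y k w → K ≤ k →
      ∃ z', ∃ k₁ u k₂ v, ∃ l : List (ℕ × List α), LPath L (insert z V) x z' k₁ u ∧
        (∀ p ∈ l, LPath L (insert z V) z' z' p.1 p.2) ∧ LPath L (insert z V) z' y k₂ v ∧
        w = u ++ (l.map Prod.snd).flatten ++ v ∧ s ≤ l.length := by
      intro x y k w h hk
      obtain ⟨z', k₁, u, k₂, v, l, h1, h2, h3, h4⟩ := hK L x y k w h hk
      exact ⟨z', k₁, u, k₂, v, l, up h1, fun p hp => up (h2 p hp), up h3, h4⟩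
    rcases h.split with h | ⟨k₁, u, k₂, v, l, h1, h2, h3, rfl, rfl⟩
    · exact hmem h (by nlinarith)
    by_cases hs : s ≤ l.length
    · exact ⟨z, k₁, u, k₂, v, l, up h1, fun p hp => up (h2 p hp), up h3, rfl, hs⟩
    have hzi : z ∈ insert z V := Set.mem_insert z V
    have h3' : LPath L (insert z V) z y k₂ v := up h3
    have hl' : ∀ p ∈ l, LPath L (insert z V) z z p.1 p.2 := fun p hp => up (h2 p hp)
    by_cases hk1 : K ≤ k₁
    · obtain ⟨z', j₁, u', j₂, v', l', g1, g2, g3, rfl, g4⟩ := hmem h1 hk1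
      exact ⟨z', j₁, u', _, _, l', g1, g2, (g3.append_loops hzi hl').append hzi h3', by simp, g4⟩
    by_cases hk2 : K ≤ k₂
    · obtain ⟨z', j₁, u', j₂, v', l', g1, g2, g3, rfl, g4⟩ := hmem h3 hk2
      exact ⟨z', _, _, j₂, v', l', ((up h1).append_loops hzi hl').append hzi g1, g2, g3, by simp,
        g4⟩
    obtain ⟨p, hp, hpK⟩ : ∃ p ∈ l, K ≤ p.1 := by
      by_contra! hcon
      have : (l.map Prod.fst).sum ≤ (l.map Prod.fst).length • K := by
        refine List.sum_le_card_nsmul _ _ fun n hn => ?_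
        obtain ⟨p, hp, rfl⟩ := List.mem_map.1 hn
        exact (hcon p hp).le
      simp only [List.length_map, smul_eq_mul] at this
      have h5 : l.length * K ≤ s * K := Nat.mul_le_mul_right K (by omega)
      nlinarith
    obtain ⟨l₁, l₂, rfl⟩ := List.append_of_mem hp
    obtain ⟨z', j₁, u', j₂, v', l', g1, g2, g3, e, g4⟩ := hmem (h2 p hp) hpK
    refine ⟨z', _, _, _, _, l', ((up h1).append_loops (l := l₁) hzi fun q hq => hl' q ?_).append hzi
        g1, g2, (g3.append_loops (l := l₂) hzi fun q hq => hl' q ?_).append hzi h3', by simp [e], g4⟩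
    · simp [hq]
    · simp [hq]

/-- Words along paths in `V`, where the length of the path satisfies `P`. -/
def pathLang (P : CountCond) (L : X → X → CostLang α) (V : Set X) (x y : X) : CostLang α :=
  fun b s => {w | ∃ k, P b s k ∧ LPath (fun x y => L x y b s) V x y k w}

theorem costMono_pathLang {P : CountCond} (hP : CountMono P) {L : X → X → CostLang α}
    (hL : ∀ x y, CostMono (L x y)) (V : Set X) (x y : X) : CostMono (pathLang P L V x y) := by
  rintro b b' s s' hb hs w ⟨k, hk, h⟩
  exact ⟨k, hP hb hs hk, h.mono (fun x y => hL x y hb hs) subset_rfl⟩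

/-- Kleene's theorem, for a constraint on the length of paths. -/
theorem Definable.pathLang_of {T : Variant} {P : CountCond} (hP : CountMono P)
    (hdown : ∀ {b s k k'}, P b s k → k' ≤ k → P b s k')
    (hone : ∀ b s, P (b + 1) s 1)
    (hsum : ∀ {b s k₁ k₂} {l : List ℕ}, P b s k₁ → P b s k₂ → P b s l.length →
      (∀ k ∈ l, P b s k) → P (b * b + 2 * b) s (k₁ + l.sum + k₂))
    (hiter : ∀ {R : CostLang α}, Definable T R → Definable T (iter P R))
    {L : X → X → CostLang α} (hL : ∀ x y, Definable T (L x y)) (hV : V.Finite) (x y : X) :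
    Definable T (pathLang P L V x y) := by
  have hmono := fun x y => (hL x y).costMono
  induction V, hV using Set.Finite.induction_on generalizing x y with
  | empty =>
    refine (hL x y).of_represents ⟨hmono x y, costMono_pathLang hP hmono _ x y,
      fun b => ⟨b + 1, fun s w hw => ⟨1, hone b s, .edge (hmono x y (Nat.le_succ b) le_rfl w hw)⟩⟩,
      fun b => ⟨b, fun s => ⟨s, ?_⟩⟩⟩
    rintro w ⟨k, -, h⟩
    cases h with
    | edge h => exact h
    | cons _ hz _ => exact hz.elim
  | @insert z V hz hV ih =>
    -- Paths through `z` consist of a path to the first visit, loops at `z`, and a path from the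
    -- last visit. Both the number of loops and the lengths of the pieces satisfy `P`, which by
    -- `hsum` costs the bound `b * b + 2 * b`: for `atMost`, there are at most `b` loops and two end
    -- pieces, each of length at most `b`. In the other direction nothing is lost, since loops have
    -- positive length.
    have hmul := ((ih x z).mul (hiter (ih z z))).mul (ih z y)
    have hadd := (ih x y).add hmul
    refine hadd.of_represents ⟨hadd.costMono, costMono_pathLang hP hmono _ x y,
      fun b => ⟨b * b + 2 * b, ?_⟩, fun b => ⟨b, fun s => ⟨s, ?_⟩⟩⟩
    · have hle : b ≤ b * b + 2 * b := by nlinarith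
      have up : ∀ {s x y k w}, LPath (fun x y => L x y b s) V x y k w →
          LPath (fun x y => L x y (b * b + 2 * b) s) (insert z V) x y k w :=
        fun h => h.mono (fun x y => hmono x y hle le_rfl) (Set.subset_insert z V)
      rintro s w (⟨k, hk, h⟩ | ⟨w, ⟨u, ⟨k₁, hk1, h1⟩, w', ⟨l, rfl, hl, hn⟩, rfl⟩, v,
        ⟨k₂, hk2, h2⟩, rfl⟩)
      · exact ⟨k, hP hle le_rfl hk, up h⟩
      · have : ∀ u : {u // u ∈ l}, ∃ k, P b s k ∧ LPath (fun x y => L x y b s) V z z k u :=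
          fun u => hl u.1 u.2
        choose K hK hK' using this
        set l' : List (ℕ × List α) := l.attach.map fun u => (K u, u.1) with hl'
        have hsnd : l'.map Prod.snd = l := by simp [hl', Function.comp_def]
        have hlen : (l'.map Prod.fst).length = l.length := by simp [hl']
        have hzi : z ∈ insert z V := Set.mem_insert z V
        refine ⟨k₁ + (l'.map Prod.fst).sum + k₂, hsum hk1 hk2 (hlen ▸ hn) ?_, ?_⟩
        · intro k hk
          simp only [hl', List.map_map, List.mem_map] at hk
          obtain ⟨u, -, rfl⟩ := hk
          exact hK u
        · have h3 := ((up h1).append_loops hzi (l := l') ?_).append hzi (up h2)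
          · rwa [hsnd] at h3
          · intro p hp
            simp only [hl', List.mem_map] at hp
            obtain ⟨u, -, rfl⟩ := hp
            exact up (hK' u)
    · rintro w ⟨k, hk, h⟩
      rcases h.split with h | ⟨k₁, u, k₂, v, l, h1, h2, h3, rfl, rfl⟩
      · exact Or.inl ⟨k, hk, h⟩
      · refine Or.inr ⟨_, ⟨u, ⟨k₁, hdown hk (by omega), h1⟩, _, ⟨_, rfl, ?_, ?_⟩, rfl⟩, v,
          ⟨k₂, hdown hk (by omega), h3⟩, rfl⟩
        · intro u' hu'
          obtain ⟨p, hp, rfl⟩ := List.mem_map.1 hu'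
          have : p.1 ≤ (l.map Prod.fst).sum := List.le_sum_of_mem (List.mem_map.2 ⟨p, hp, rfl⟩)
          exact ⟨p.1, hdown hk (by omega), h2 p hp⟩
        · have : (l.map Prod.fst).length • 1 ≤ (l.map Prod.fst).sum := by
            refine List.card_nsmul_le_sum _ _ fun n hn => ?_
            obtain ⟨p, hp, rfl⟩ := List.mem_map.1 hn
            exact (h2 p hp).pos
          simp only [List.length_map, smul_eq_mul] at this ⊢
          exact hdown hk (by omega)

theorem Definable.pathLang_anyCount {T : Variant} {L : X → X → CostLang α}
    (hL : ∀ x y, Definable T (L x y)) (hV : V.Finite) (x y : X) :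
    Definable T (pathLang anyCount L V x y) :=
  Definable.pathLang_of countMono_anyCount (fun _ _ => trivial) (fun _ _ => trivial)
    (fun _ _ _ _ => trivial) Definable.star hL hV x y

theorem Definable.pathLang_atMost {T : Variant} (hT : T.AllowsB) {L : X → X → CostLang α}
    (hL : ∀ x y, Definable T (L x y)) (hV : V.Finite) (x y : X) :
    Definable T (pathLang atMost L V x y) := by
  refine Definable.pathLang_of countMono_atMost (fun h h' => h'.trans h)
    (fun b _ => Nat.le_add_left 1 b) ?_ (Definable.bexp hT) hL hV x y
  intro b s k₁ k₂ l h1 h2 h3 h4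
  have h5 := List.sum_le_card_nsmul l b h4
  simp only [atMost, smul_eq_mul] at h1 h2 h3 h5 ⊢
  nlinarith

/-- Lower bounds are not inherited by the pieces of a path, so Kleene's induction does not apply.
Instead, a long path in a finite graph visits one vertex `z` often, and it suffices to count the
loops at `z`, with no constraint inside them. Conversely every loop has length at least one. -/
theorem Definable.pathLang_atLeast {T : Variant} (hT : T.AllowsS) [Finite X]
    {L : X → X → CostLang α} (hL : ∀ x y, Definable T (L x y)) (x y : X) :
    Definable T (pathLang atLeast L Set.univ x y) := by
  have hmono := fun x y => (hL x y).costMono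
  have hany := fun x y => Definable.pathLang_anyCount hL (Set.finite_univ (α := X)) x y
  have hu : Definable T (OmegaBS.union fun z => pathLang anyCount L Set.univ x z *
      iter atLeast (pathLang anyCount L Set.univ z z) * pathLang anyCount L Set.univ z y) :=
    Definable.union fun z => ((hany x z).mul (Definable.sexp hT (hany z z))).mul (hany z y)
  refine hu.of_represents ⟨hu.costMono, costMono_pathLang countMono_atLeast hmono _ x y,
    fun b => ⟨b, ?_⟩, fun b => ⟨b, fun s => ?_⟩⟩
  · rintro s w ⟨z, _, ⟨u, ⟨k₁, -, h1⟩, w', ⟨l, rfl, hl, hn⟩, rfl⟩, v, ⟨k₂, -, h2⟩, rfl⟩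
    have : ∀ u : {u // u ∈ l}, ∃ k, LPath (fun x y => L x y b s) Set.univ z z k u := by
      intro u
      obtain ⟨k, -, h⟩ := hl u.1 u.2
      exact ⟨k, h⟩
    choose K hK using this
    set l' : List (ℕ × List α) := l.attach.map fun u => (K u, u.1) with hl'
    have hsnd : l'.map Prod.snd = l := by simp [hl', Function.comp_def]
    have hlen : (l'.map Prod.fst).length = l.length := by simp [hl']
    have hl'' : ∀ p ∈ l', LPath (fun x y => L x y b s) Set.univ z z p.1 p.2 := by
      intro p hp
      simp only [hl', List.mem_map] at hp
      obtain ⟨u, -, rfl⟩ := hp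
      exact hK u
    have h3 := (h1.append_loops (Set.mem_univ z) hl'').append (Set.mem_univ z) h2
    rw [hsnd] at h3
    refine ⟨_, ?_, h3⟩
    have : (l'.map Prod.fst).length • 1 ≤ (l'.map Prod.fst).sum := by
      refine List.card_nsmul_le_sum _ _ fun n hn => ?_
      obtain ⟨p, hp, rfl⟩ := List.mem_map.1 hn
      exact (hl'' p hp).pos
    simp only [hlen, smul_eq_mul, atLeast] at this hn ⊢
    omega
  · obtain ⟨K, hK⟩ := LPath.exists_loops (α := α) (Set.finite_univ (α := X)) s
    refine ⟨max K s, ?_⟩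
    rintro w ⟨k, hk, h⟩
    have hks : s ≤ max K s := le_max_right _ _
    have h' := h.mono (L' := fun x y => L x y b s) (fun x y => hmono x y le_rfl hks) subset_rfl
    obtain ⟨z, k₁, u, k₂, v, l, h1, h2, h3, rfl, h4⟩ :=
      hK _ x y k w h' ((le_max_left _ _).trans hk)
    refine ⟨z, _, ⟨u, ⟨k₁, trivial, h1⟩, _, ⟨_, rfl, ?_, by simpa [atLeast] using h4⟩, rfl⟩, v,
      ⟨k₂, trivial, h3⟩, rfl⟩
    intro u' hu'
    obtain ⟨p, hp, rfl⟩ := List.mem_map.1 hu'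
    exact ⟨p.1, trivial, h2 p hp⟩

end Paths

end OmegaBS

/-! ### Finite runs: certificates for `S`-counters, profiles, and minimal blocks. -/

namespace OmegaBS

open Filter

variable {α : Type*}

/-! ### Counters with a certificate -/

/-- A weaker threshold tolerates a smaller initial value. -/
theorem okS.weaken {s s' d n n' : ℕ} {e : Bool} {l : List Action} (h : okS s e n l)
    (hs : s' + d ≤ s) (hn : s' ≤ n' ∨ n ≤ n' + d) : okS s' e n' l := by
  induction l generalizing n n' with
  | nil => exact fun he => by have := h he; omega
  | cons a l ih =>
    cases a with
    | inc => exact ih (n := n + 1) h (by omega)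
    | reset => exact ⟨by have := h.1; omega, ih h.2 (by omega)⟩
    | none => exact ih (n := n) h hn

/-- The initial value of an `S`-counter: it is large if `β` certifies this. -/
def startVal (s : ℕ) (β : Bool) : ℕ := if β then s else 0

/-- The constraints on a counter along a list of actions; the booleans tell whether the value of
an `S`-counter is certified to be large before and after the list. -/
def okCounter (c : CounterType) (b s : ℕ) (β β' : Bool) (l : List Action) : Prop :=
  match c with
  | .B => okB b 0 l
  | .S => okS s β' (startVal s β) l

theorem okCounter.mono {c : CounterType} {b b' s s' : ℕ} {β β' : Bool} {l : List Action}
    (h : okCounter c b s β β' l) (hb : b ≤ b') (hs : s' ≤ s) : okCounter c b' s' β β' l := by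
  cases c with
  | B => exact okB.mono h hb le_rfl
  | S =>
    refine okS.weaken (d := 0) h hs ?_
    cases β <;> simp [startVal]

theorem okB.append_zero {b b' : ℕ} {l l' : List Action} (h : okB b 0 l) (h' : okB b' 0 l') :
    okB (b + b') 0 (l ++ l') := by
  rw [okB_append]
  refine ⟨h.mono (by omega) le_rfl, ?_⟩
  have h1 := h.countFrom_le (Nat.zero_le b)
  exact (h'.add (m := countFrom 0 l)).mono (by omega) (by omega)

theorem okS.append_startVal {s n : ℕ} {β e : Bool} {l l' : List Action} (h : okS s β n l)
    (h' : okS s e (startVal s β) l') : okS s e n (l ++ l') := by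
  rw [okS_append]
  refine ⟨h.to_false, h'.mono le_rfl ?_⟩
  cases β
  · exact Nat.zero_le _
  · exact (okS_true_iff.1 h).2

theorem okCounter.append {c : CounterType} {b s : ℕ} {β β' β'' : Bool} {l l' : List Action}
    (h : okCounter c b s β β' l) (h' : okCounter c b s β' β'' l') :
    okCounter c (b + b) s β β'' (l ++ l') := by
  cases c with
  | B => exact okB.append_zero h h'
  | S => exact okS.append_startVal h h'

theorem okS_of_reset_not_mem {s n : ℕ} {l : List Action} (h : Action.reset ∉ l) :
    okS s false n l := by
  induction l generalizing n with
  | nil => simp [okS]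
  | cons a l ih =>
    have h' : Action.reset ∉ l := fun h' => h (List.mem_cons_of_mem _ h')
    cases a with
    | inc => exact ih h'
    | reset => exact absurd (by simp) h
    | none => exact ih h'

theorem okS_const {s : ℕ} {β : Bool} {l : List Action} (h : Action.reset ∉ l) :
    okS s β (startVal s β) l := by
  cases β with
  | false => exact okS_of_reset_not_mem h
  | true =>
    refine okS_true_iff.2 ⟨okS_of_reset_not_mem h, ?_⟩
    rw [countFrom_of_not_mem h]
    simp [startVal]

/-- Splitting a list of actions, with a certificate at the cut. -/
theorem okCounter.exists_split {c : CounterType} {b s : ℕ} {β β'' : Bool} {l l' : List Action}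
    (h : okCounter c b (s + s) β β'' (l ++ l')) :
    ∃ β', okCounter c b s β β' l ∧ okCounter c b s β' β'' l' := by
  cases c with
  | B =>
    obtain ⟨h1, h2⟩ := okB_append.1 h
    exact ⟨false, h1, h2.mono le_rfl (Nat.zero_le _)⟩
  | S =>
    obtain ⟨h1, h2⟩ := okS_append.1 h
    have hweak : okS s false (startVal s β) l :=
      h1.weaken (d := s) le_rfl (by cases β <;> simp [startVal])
    -- The value at the cut is rounded to `s` or to `0`. With a certified start and no reset in `l`,
    -- it is at least `s`. In all other cases it is the same for both starting values, and the
    -- certificate records whether it reaches `s`; if not, forgetting it loses at most `s`, which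
    -- the doubled threshold pays for.
    by_cases hc : Action.reset ∉ l ∧ β = true
    · obtain ⟨hr, rfl⟩ := hc
      exact ⟨true, okS_const hr, h2.weaken (d := s) le_rfl (Or.inl le_rfl)⟩
    · have heq : countFrom (startVal (s + s) β) l = countFrom (startVal s β) l := by
        by_cases hr : Action.reset ∈ l
        · exact countFrom_eq_of_mem hr
        · have : β = false := by
            cases β
            · rfl
            · exact absurd ⟨hr, rfl⟩ hc
          subst this
          rfl
      by_cases hm : s ≤ countFrom (startVal s β) l
      · exact ⟨true, okS_true_iff.2 ⟨hweak, hm⟩, h2.weaken (d := s) le_rfl (Or.inl le_rfl)⟩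
      · refine ⟨false, hweak, h2.weaken (d := s) le_rfl (Or.inr ?_)⟩
        rw [heq]
        exact (not_le.1 hm).le.trans (Nat.le_add_left _ _)

/-- The constraints hold on each list of `ls`, with certificates between the lists. -/
def OkChain (c : CounterType) (b s : ℕ) : Bool → List (List Action) → Bool → Prop
  | β, [], β' => β = β'
  | β, l :: ls, β' => ∃ β₁, okCounter c b s β β₁ l ∧ OkChain c b s β₁ ls β'

theorem OkChain.const {b s : ℕ} {β : Bool} {ls : List (List Action)}
    (h : ∀ l ∈ ls, Action.reset ∉ l) : OkChain .S b s β ls β := by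
  induction ls with
  | nil => rfl
  | cons l ls ih =>
    exact ⟨β, okS_const (h l (by simp)), ih fun l hl => h l (by simp [hl])⟩

/-- The certificate switches to `true` at the list that counts to `s` alone; without resets it can
be kept from there on. -/
theorem OkChain.raise {b s : ℕ} {ls : List (List Action)} (h : ∀ l ∈ ls, Action.reset ∉ l)
    (h' : ∃ l ∈ ls, s ≤ countFrom 0 l) : OkChain .S b s false ls true := by
  induction ls with
  | nil => simp at h'
  | cons l ls ih =>
    have hls : ∀ l ∈ ls, Action.reset ∉ l := fun l hl => h l (by simp [hl])
    by_cases hl : s ≤ countFrom 0 l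
    · exact ⟨true, okS_true_iff.2 ⟨okS_of_reset_not_mem (h l (by simp)), hl⟩, OkChain.const hls⟩
    · refine ⟨false, okS_of_reset_not_mem (h l (by simp)), ih hls ?_⟩
      obtain ⟨m, hm, hm'⟩ := h'
      rcases List.mem_cons.1 hm with rfl | hm
      · exact absurd hm' hl
      · exact ⟨m, hm, hm'⟩

theorem OkChain.of_okB {b s : ℕ} {β : Bool} {ls : List (List Action)}
    (h : ∀ l ∈ ls, okB b 0 l) : OkChain .B b s β ls β := by
  induction ls with
  | nil => rfl
  | cons l ls ih => exact ⟨β, h l (by simp), ih fun l hl => h l (by simp [hl])⟩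

/-- Every list resets the counter, so the value after it depends on that list alone and the errors
made by rounding do not accumulate: doubling the threshold suffices for any number of lists. -/
theorem OkChain.exists_of_reset {b s n : ℕ} {β e : Bool} {ls : List (List Action)}
    {l' : List Action} (h : okS (s + s) e n (ls.flatten ++ l'))
    (hn : s ≤ startVal s β ∨ n ≤ startVal s β + s) (hr : ∀ l ∈ ls, Action.reset ∈ l) :
    ∃ β', OkChain .S b s β ls β' ∧ okS s e (startVal s β') l' := by
  induction ls generalizing n β with
  | nil => exact ⟨β, rfl, h.weaken le_rfl hn⟩
  | cons l ls ih =>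
    rw [List.flatten_cons, List.append_assoc, okS_append] at h
    have h1 := h.1.weaken le_rfl hn
    have heq : countFrom n l = countFrom (startVal s β) l := countFrom_eq_of_mem (hr l (by simp))
    have hr' : ∀ l ∈ ls, Action.reset ∈ l := fun l hl => hr l (by simp [hl])
    by_cases hm : s ≤ countFrom n l
    · obtain ⟨β', h2, h3⟩ := ih (β := true) h.2 (Or.inl le_rfl) hr'
      exact ⟨β', ⟨true, okS_true_iff.2 ⟨h1, heq ▸ hm⟩, h2⟩, h3⟩
    · obtain ⟨β', h2, h3⟩ := ih (β := false) h.2 (Or.inr (by simp [startVal]; omega)) hr'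
      exact ⟨β', ⟨false, h1, h2⟩, h3⟩

theorem okB.of_mem_flatten {b : ℕ} {ls : List (List Action)} {l' : List Action} {n : ℕ}
    (h : okB b n (ls.flatten ++ l')) : (∀ l ∈ ls, okB b 0 l) ∧ okB b 0 l' := by
  induction ls generalizing n with
  | nil => exact ⟨by simp, okB.mono h le_rfl (Nat.zero_le _)⟩
  | cons l ls ih =>
    rw [List.flatten_cons, List.append_assoc, okB_append] at h
    obtain ⟨h1, h2⟩ := ih h.2
    refine ⟨?_, h2⟩
    rintro m (_ | ⟨_, hm⟩)
    · exact h.1.mono le_rfl (Nat.zero_le _)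
    · exact h1 m hm

theorem countFrom_append_zero {l l' : List Action} (h' : Action.reset ∉ l') :
    countFrom 0 (l ++ l') = countFrom 0 l + countFrom 0 l' := by
  rw [countFrom_append, countFrom_of_not_mem h']

theorem countFrom_flatten_le {s : ℕ} {ls : List (List Action)}
    (h : ∀ l ∈ ls, Action.reset ∉ l) (hs : ∀ l ∈ ls, countFrom 0 l ≤ s) :
    countFrom 0 ls.flatten ≤ ls.length * s := by
  induction ls with
  | nil => simp [countFrom_nil]
  | cons l ls ih =>
    have h1 := ih (fun l hl => h l (by simp [hl])) fun l hl => hs l (by simp [hl])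
    have h2 := hs l (by simp)
    rw [List.flatten_cons, countFrom_append_zero fun hm => ?_]
    · rw [List.length_cons, Nat.add_mul]
      omega
    · obtain ⟨m, hm, hm'⟩ := List.mem_flatten.1 hm
      exact h m (by simp [hm]) hm'

theorem length_le_countFrom_flatten {ls : List (List Action)}
    (h : ∀ l ∈ ls, Action.reset ∉ l) (hs : ∀ l ∈ ls, 1 ≤ countFrom 0 l) :
    ls.length ≤ countFrom 0 ls.flatten := by
  induction ls with
  | nil => simp
  | cons l ls ih =>
    have h1 := ih (fun l hl => h l (by simp [hl])) fun l hl => hs l (by simp [hl])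
    have h2 := hs l (by simp)
    rw [List.flatten_cons, countFrom_append_zero fun hm => ?_]
    · rw [List.length_cons]
      omega
    · obtain ⟨m, hm, hm'⟩ := List.mem_flatten.1 hm
      exact h m (by simp [hm]) hm'

/-! ### Profiles of lists of transitions -/

/-- Nothing, increments without resets, or resets. -/
def Action.rank : Action → Fin 3
  | .none => 0
  | .inc => 1
  | .reset => 2

section Profiles

variable {Q Γ : Type}

/-- The actions on a counter along a list of transitions. -/
def acts (c : Γ) (π : List (Transition Q Γ)) : List Action := π.map fun t => t.action c

/-- For each counter, the strongest kind of action along a list of transitions. -/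
noncomputable def profile : List (Transition Q Γ) → Γ → Fin 3
  | [] => ⊥
  | t :: π => (fun c => (t.action c).rank) ⊔ profile π

theorem acts_append (c : Γ) (π π' : List (Transition Q Γ)) :
    acts c (π ++ π') = acts c π ++ acts c π' := List.map_append

theorem acts_flatten (c : Γ) (ls : List (List (Transition Q Γ))) :
    acts c ls.flatten = (ls.map (acts c)).flatten := List.map_flatten

theorem profile_append (π π' : List (Transition Q Γ)) :
    profile (π ++ π') = profile π ⊔ profile π' := by
  induction π with
  | nil => simp [profile]
  | cons t π ih => simp [profile, ih, sup_assoc]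

theorem profile_apply_cons (t : Transition Q Γ) (π : List (Transition Q Γ)) (c : Γ) :
    profile (t :: π) c = (t.action c).rank ⊔ profile π c := rfl

theorem profile_cases (π : List (Transition Q Γ)) (c : Γ) :
    (profile π c = 0 ∧ ∀ n, countFrom n (acts c π) = n) ∧ Action.reset ∉ acts c π ∨
    (profile π c = 1 ∧ 1 ≤ countFrom 0 (acts c π)) ∧ Action.reset ∉ acts c π ∨
    profile π c = 2 ∧ Action.reset ∈ acts c π := by
  induction π with
  | nil => exact Or.inl ⟨⟨rfl, fun n => rfl⟩, by simp [acts]⟩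
  | cons t π ih =>
    rw [profile_apply_cons]
    have hacts : acts c (t :: π) = t.action c :: acts c π := rfl
    rw [hacts]
    cases ht : t.action c with
    | none =>
      simpa [Action.rank, countFrom_cons, Action.apply] using ih
    | reset =>
      refine Or.inr (Or.inr ⟨?_, by simp⟩)
      simp only [Action.rank]
      generalize profile π c = p
      revert p
      decide
    | inc =>
      rcases ih with ⟨⟨h1, h2⟩, h3⟩ | ⟨⟨h1, h2⟩, h3⟩ | ⟨h1, h2⟩
      · refine Or.inr (Or.inl ⟨⟨by rw [h1]; rfl, ?_⟩, by simpa using h3⟩)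
        simp [countFrom_cons, Action.apply, h2]
      · refine Or.inr (Or.inl ⟨⟨by rw [h1]; rfl, ?_⟩, by simpa using h3⟩)
        rw [countFrom_cons, countFrom_of_not_mem h3]
        omega
      · exact Or.inr (Or.inr ⟨by rw [h1]; rfl, by simp [h2]⟩)

theorem profile_eq_two {π : List (Transition Q Γ)} {c : Γ} (h : profile π c = 2) :
    Action.reset ∈ acts c π := by
  rcases profile_cases π c with ⟨⟨h1, -⟩, -⟩ | ⟨⟨h1, -⟩, -⟩ | ⟨-, h1⟩
  · rw [h1] at h; exact absurd h (by decide)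
  · rw [h1] at h; exact absurd h (by decide)
  · exact h1

theorem profile_ne_two {π : List (Transition Q Γ)} {c : Γ} (h : profile π c ≠ 2) :
    Action.reset ∉ acts c π := by
  rcases profile_cases π c with ⟨-, h1⟩ | ⟨-, h1⟩ | ⟨h1, -⟩
  · exact h1
  · exact h1
  · exact absurd h1 h

theorem profile_eq_one {π : List (Transition Q Γ)} {c : Γ} (h : profile π c = 1) :
    1 ≤ countFrom 0 (acts c π) := by
  rcases profile_cases π c with ⟨⟨h1, -⟩, -⟩ | ⟨⟨-, h1⟩, -⟩ | ⟨h1, -⟩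
  · rw [h1] at h; exact absurd h (by decide)
  · exact h1
  · rw [h1] at h; exact absurd h (by decide)

theorem profile_ne_one {π : List (Transition Q Γ)} {c : Γ} (h : profile π c ≠ 1) {b n : ℕ}
    (hn : n ≤ b) (hb : okB b 0 (acts c π)) : countFrom n (acts c π) ≤ b := by
  rcases profile_cases π c with ⟨⟨-, h1⟩, -⟩ | ⟨⟨h1, -⟩, -⟩ | ⟨-, h1⟩
  · rw [h1]; exact hn
  · exact absurd h1 h
  · rw [countFrom_eq_of_mem h1 (n' := 0)]
    exact hb.countFrom_le (Nat.zero_le b)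

/-- A minimal list of transitions of profile `T`. -/
def IsBlock (T : Γ → Fin 3) (π : List (Transition Q Γ)) : Prop :=
  profile π = T ∧ ∃ π' t, π = π' ++ [t] ∧ (π' = [] ∨ profile π' < T)

/-- A list of transitions that is too short for the profile `T`. -/
def IsTail (T : Γ → Fin 3) (π : List (Transition Q Γ)) : Prop := π = [] ∨ profile π < T

/-- Greedy cutting: the tail is extended by one transition at a time and becomes a block as soon as
its profile reaches `T`. -/
theorem exists_blocks {T : Γ → Fin 3} (π : List (Transition Q Γ)) (h : profile π ≤ T) :
    ∃ (Bs : List (List (Transition Q Γ))) (π' : List (Transition Q Γ)), π = Bs.flatten ++ π' ∧ (∀ B ∈ Bs, IsBlock T B) ∧ IsTail T π' := by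
  induction π using List.reverseRecOn with
  | nil => exact ⟨[], [], rfl, by simp, Or.inl rfl⟩
  | append_singleton π t ih =>
    rw [profile_append] at h
    obtain ⟨Bs, π', rfl, h1, h2⟩ := ih (le_sup_left.trans h)
    rw [profile_append] at h
    have hle : profile (π' ++ [t]) ≤ T := by
      rw [profile_append]
      exact sup_le (le_sup_right.trans (le_sup_left.trans h)) (le_sup_right.trans h)
    rcases hle.lt_or_eq with hlt | heq
    · exact ⟨Bs, π' ++ [t], by simp, h1, Or.inr hlt⟩
    · refine ⟨Bs ++ [π' ++ [t]], [], by simp, ?_, Or.inl rfl⟩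
      intro B hB
      rcases List.mem_append.1 hB with hB | hB
      · exact h1 B hB
      · rw [List.mem_singleton.1 hB]
        exact ⟨heq, π', t, rfl, h2⟩

theorem finite_transition [Finite Q] [Finite Γ] : Finite (Transition Q Γ) := by
  have : Finite Action := Finite.of_injective Action.rank (by
    intro a b h
    cases a <;> cases b <;> first | rfl | exact absurd h (by decide))
  refine Finite.of_injective
    (fun t : Transition Q Γ => (t.source, t.action, t.target)) ?_
  rintro ⟨a, b, c⟩ ⟨a', b', c'⟩ h
  simp only [Prod.mk.injEq] at h
  obtain ⟨rfl, rfl, rfl⟩ := h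
  rfl

end Profiles

/-! ### Finite runs -/

section Runs

variable {Γ : Type} (A : Automaton α Γ)

/-- Finite runs of an automaton. -/
inductive Automaton.RunOn : A.State → List α → List (Transition A.State Γ) → A.State → Prop
  | nil (p : A.State) : RunOn p [] [] p
  | cons {a : α} {t : Transition A.State Γ} {w : List α} {π : List (Transition A.State Γ)}
      {q : A.State} : t ∈ A.δ a → RunOn t.target w π q → RunOn t.source (a :: w) (t :: π) q

variable {A} {p q r : A.State} {w w' : List α} {π π' : List (Transition A.State Γ)}

theorem Automaton.RunOn.append (h : A.RunOn p w π r) (h' : A.RunOn r w' π' q) :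
    A.RunOn p (w ++ w') (π ++ π') q := by
  induction h with
  | nil p => exact h'
  | cons ht _ ih => exact .cons ht (ih h')

theorem Automaton.RunOn.exists_split (h : A.RunOn p w (π ++ π') q) :
    ∃ r u v, w = u ++ v ∧ A.RunOn p u π r ∧ A.RunOn r v π' q := by
  induction π generalizing p w with
  | nil => exact ⟨p, [], w, rfl, .nil p, h⟩
  | cons t π ih =>
    cases h with
    | cons ht h =>
      obtain ⟨r, u, v, rfl, h1, h2⟩ := ih h
      exact ⟨r, _, v, rfl, .cons ht h1, h2⟩

theorem Automaton.RunOn.eq_nil (h : A.RunOn p w [] q) : w = [] ∧ p = q := by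
  cases h
  exact ⟨rfl, rfl⟩

theorem Automaton.RunOn.length_eq (h : A.RunOn p w π q) : w.length = π.length := by
  induction h with
  | nil => rfl
  | cons _ _ ih => simp [ih]

variable (A) in
/-- The words that have a run of the form `C` satisfying the constraints on counters. -/
def runLang (C : List (Transition A.State Γ) → Prop) (x y : A.State × (Γ → Bool)) : CostLang α :=
  fun b s => {w | ∃ π, C π ∧ A.RunOn x.1 w π y.1 ∧
    ∀ c, okCounter (A.type c) b s (x.2 c) (y.2 c) (acts c π)}

theorem costMono_runLang (C : List (Transition A.State Γ) → Prop)
    (x y : A.State × (Γ → Bool)) : CostMono (runLang A C x y) := by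
  rintro b b' s s' hb hs w ⟨π, hC, hπ, h⟩
  exact ⟨π, hC, hπ, fun c => (h c).mono hb hs⟩

theorem Definable.runLang_eq_nil {T : Variant} (x y : A.State × (Γ → Bool)) :
    Definable T (runLang A (fun π => π = []) x y) := by
  refine Definable.of_singleton (w₀ := []) (e := .eps) trivial (fun _ _ _ => Iff.rfl)
    (costMono_runLang _ x y) ?_
  rintro b s w ⟨π, rfl, h, -⟩
  exact h.eq_nil.1

theorem Definable.runLang_single {T : Variant} [Finite α] [Finite Γ]
    (C : Transition A.State Γ → Prop) (x y : A.State × (Γ → Bool)) :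
    Definable T (runLang A (fun π => ∃ t, C t ∧ π = [t]) x y) := by
  have := A.finite_state
  have := finite_transition (Q := A.State) (Γ := Γ)
  have e : runLang A (fun π => ∃ t, C t ∧ π = [t]) x y =
      OmegaBS.union fun p : Transition A.State Γ × α => fun b s =>
        {w | w = [p.2] ∧ w ∈ runLang A (fun π => C p.1 ∧ π = [p.1]) x y b s} := by
    funext b s
    ext w
    constructor
    · rintro ⟨π, ⟨t, ht, rfl⟩, h, h'⟩
      have hl := h.length_eq
      obtain ⟨a, rfl⟩ := List.length_eq_one_iff.1 hl
      exact ⟨(t, a), rfl, [t], ⟨ht, rfl⟩, h, h'⟩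
    · rintro ⟨⟨t, a⟩, -, π, ⟨ht, rfl⟩, h, h'⟩
      exact ⟨_, ⟨t, ht, rfl⟩, h, h'⟩
  rw [e]
  refine Definable.union fun p => ?_
  refine Definable.of_singleton (w₀ := [p.2]) (e := .letter p.2) trivial (fun _ _ _ => Iff.rfl)
    (fun b b' s s' hb hs w hw => ⟨hw.1, costMono_runLang _ x y hb hs w hw.2⟩) fun _ _ _ h => h.1

/-- By minimality, a block is a single transition or a run of strictly smaller profile followed by
one transition, and the induction hypothesis covers that run. -/
theorem Definable.runLang_isBlock {V : Variant} [Finite α] [Finite Γ] {T : Γ → Fin 3}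
    (ih : ∀ T' < T, ∀ x y, Definable V (runLang A (fun π => π ≠ [] ∧ profile π = T') x y))
    (x y : A.State × (Γ → Bool)) : Definable V (runLang A (IsBlock T) x y) := by
  have := A.finite_state
  have h1 := Definable.runLang_single (A := A) (T := V) (fun t => profile [t] = T) x y
  have h2 : Definable V (OmegaBS.union fun p : (A.State × (Γ → Bool)) × (Γ → Fin 3) => OmegaBS.onlyIf (p.2 < T)
      (runLang A (fun π => π ≠ [] ∧ profile π = p.2) x p.1 *
        runLang A (fun π => ∃ t, p.2 ⊔ profile [t] = T ∧ π = [t]) p.1 y)) :=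
    Definable.union fun p => Definable.onlyIf fun hp =>
      (ih p.2 hp x p.1).mul (Definable.runLang_single (fun t => p.2 ⊔ profile [t] = T) p.1 y)
  have h3 := h1.add h2
  -- Joining two pieces doubles the bound (`okCounter.append`), and cutting a run with a certificate
  -- halves the threshold (`okCounter.exists_split`).
  refine h3.of_represents ⟨h3.costMono, costMono_runLang _ x y, fun b => ⟨b + b, ?_⟩,
    fun b => ⟨b, fun s => ⟨s + s, ?_⟩⟩⟩
  · rintro s w (⟨π, ⟨t, ht, rfl⟩, hrun, hok⟩ | ⟨⟨z, T'⟩, hT', u, ⟨π, ⟨hπ, hpr⟩, hrun, hok⟩, v,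
      ⟨_, ⟨t, ht, rfl⟩, hrun', hok'⟩, rfl⟩)
    · exact ⟨[t], ⟨ht, [], t, rfl, Or.inl rfl⟩, hrun, fun c => (hok c).mono (by omega) le_rfl⟩
    · refine ⟨π ++ [t], ⟨?_, π, t, rfl, Or.inr (hpr ▸ hT')⟩, hrun.append hrun', fun c => ?_⟩
      · rw [profile_append, hpr, ht]
      · rw [acts_append]
        exact (hok c).append (hok' c)
  · rintro w ⟨_, ⟨hpr, π, t, rfl, hπ⟩, hrun, hok⟩
    by_cases hnil : π = []
    · subst hnil
      exact Or.inl ⟨[t], ⟨t, hpr, rfl⟩, hrun, fun c => (hok c).mono le_rfl (by omega)⟩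
    · obtain ⟨r, u, v, rfl, hu, hv⟩ := hrun.exists_split
      have : ∀ c, ∃ β, okCounter (A.type c) b s (x.2 c) β (acts c π) ∧
          okCounter (A.type c) b s β (y.2 c) (acts c [t]) := by
        intro c
        have := hok c
        rw [acts_append] at this
        exact this.exists_split
      choose β hβ hβ' using this
      refine Or.inr ⟨((r, β), profile π), hπ.resolve_left hnil, u, ⟨π, ⟨hnil, rfl⟩, hu, hβ⟩, v,
        ⟨[t], ⟨t, ?_, rfl⟩, hv, hβ'⟩, rfl⟩
      rw [← hpr, profile_append]

theorem Definable.runLang_isTail {V : Variant} [Finite Γ] {T : Γ → Fin 3}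
    (ih : ∀ T' < T, ∀ x y, Definable V (runLang A (fun π => π ≠ [] ∧ profile π = T') x y))
    (x y : A.State × (Γ → Bool)) : Definable V (runLang A (IsTail T) x y) := by
  have e : runLang A (IsTail T) x y = runLang A (fun π => π = []) x y +
      OmegaBS.union fun T' => OmegaBS.onlyIf (T' < T) (runLang A (fun π => π ≠ [] ∧ profile π = T') x y) := by
    funext b s
    ext w
    constructor
    · rintro ⟨π, hπ, h, h'⟩
      by_cases hnil : π = []
      · exact Or.inl ⟨π, hnil, h, h'⟩
      · exact Or.inr ⟨profile π, hπ.resolve_left hnil, π, ⟨hnil, rfl⟩, h, h'⟩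
    · rintro (⟨π, rfl, h, h'⟩ | ⟨T', hT', π, ⟨-, rfl⟩, h, h'⟩)
      · exact ⟨[], Or.inl rfl, h, h'⟩
      · exact ⟨π, Or.inr hT', h, h'⟩
  rw [e]
  exact (Definable.runLang_eq_nil x y).add
    (Definable.union fun T' => Definable.onlyIf fun hT' => ih T' hT' x y)

/-- What is known about a run along a path of blocks. -/
theorem exists_run_of_lPath {T : Γ → Fin 3} {b s k : ℕ} {x z : A.State × (Γ → Bool)}
    {w : List α}
    (h : LPath (fun x y => runLang A (IsBlock T) x y b s) Set.univ x z k w) :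
    ∃ π, π ≠ [] ∧ A.RunOn x.1 w π z.1 ∧ profile π = T ∧
      (∀ c, A.type c = .S → okS s (z.2 c) (startVal s (x.2 c)) (acts c π)) ∧
      (∀ c, A.type c = .B → T c ≠ 1 → ∀ n ≤ b, okB (b + b) n (acts c π)) ∧
      (∀ c, A.type c = .B → okB (k * b) 0 (acts c π)) ∧
      ∀ c, T c = 1 → k ≤ countFrom 0 (acts c π) := by
  induction h with
  | @edge x y u hu =>
    obtain ⟨π, ⟨hpr, π', t, rfl, hπ⟩, hrun, hok⟩ := hu
    refine ⟨_, by simp, hrun, hpr, fun c hc => ?_, fun c hc hT n hn => ?_, fun c hc => ?_,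
      fun c hT => ?_⟩
    · have := hok c
      rw [hc] at this
      exact this
    · have h1 := hok c
      rw [hc] at h1
      have h2 : okB b 0 (acts c (π' ++ [t])) := h1
      exact (h2.add (m := n)).mono (by omega) (by omega)
    · have h1 := hok c
      rw [hc] at h1
      exact okB.mono h1 (by omega) le_rfl
    · exact profile_eq_one (by rw [hpr, hT])
  | @cons x z y k u v hu _ _ ih =>
    obtain ⟨π, ⟨hpr, π', t, rfl, hπ⟩, hrun, hok⟩ := hu
    obtain ⟨π₂, -, h2, h3, h4, h5, h6, h7⟩ := ih
    refine ⟨_, by simp, hrun.append h2, ?_, fun c hc => ?_, fun c hc hT n hn => ?_, fun c hc => ?_,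
      fun c hT => ?_⟩
    · rw [profile_append, hpr, h3, sup_idem]
    · have h1 := hok c
      rw [hc] at h1
      rw [acts_append]
      exact okS.append_startVal h1 (h4 c hc)
    · have h1 := hok c
      rw [hc] at h1
      have h1' : okB b 0 (acts c (π' ++ [t])) := h1
      rw [acts_append, okB_append]
      refine ⟨(h1'.add (m := n)).mono (by omega) (by omega), h5 c hc hT _ ?_⟩
      -- A block that does not merely increment the counter leaves it untouched or resets it, so the
      -- next block is again entered with a value at most `b`; no error accumulates along the path.
      exact profile_ne_one (by rwa [hpr]) hn h1'
    · have h1 := hok c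
      rw [hc] at h1
      rw [acts_append]
      exact (okB.append_zero (b := b) h1 (h6 c hc)).mono (by rw [Nat.add_mul]; omega) le_rfl
    · have h8 := h7 c hT
      have h9 : 1 ≤ countFrom 0 (acts c (π' ++ [t])) := profile_eq_one (by rw [hpr, hT])
      rw [acts_append, countFrom_append, countFrom_of_not_mem (profile_ne_two ?_)]
      · omega
      · rw [h3, hT]
        decide

/-- A sequence of blocks with certificates gives a path. -/
theorem lPath_of_okChain {T : Γ → Fin 3} {b s : ℕ} {Bs : List (List (Transition A.State Γ))}
    (hne : Bs ≠ []) (hB : ∀ B ∈ Bs, IsBlock T B) {β β' : Γ → Bool}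
    (hrun : A.RunOn p w Bs.flatten q)
    (h : ∀ c, OkChain (A.type c) b s (β c) (Bs.map (acts c)) (β' c)) :
    LPath (fun x y => runLang A (IsBlock T) x y b s) Set.univ (p, β) (q, β') Bs.length w := by
  induction Bs generalizing p w β with
  | nil => exact absurd rfl hne
  | cons B Bs ih =>
    choose β₁ h1 h2 using h
    obtain ⟨r, u, v, rfl, hu, hv⟩ := hrun.exists_split
    have hmem : u ∈ runLang A (IsBlock T) (p, β) (r, β₁) b s := ⟨B, hB B (by simp), hu, h1⟩
    by_cases hnil : Bs = []
    · subst hnil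
      obtain ⟨rfl, rfl⟩ := hv.eq_nil
      have : β₁ = β' := funext fun c => h2 c
      subst this
      simpa using LPath.edge (V := Set.univ)
        (L := fun x y => runLang A (IsBlock T) x y b s) hmem
    · exact .cons hmem (Set.mem_univ _)
        (ih hnil (fun B hB' => hB B (by simp [hB'])) hv h2)

end Runs

end OmegaBS

/-! ### Runs of a given profile form a definable language. -/

namespace OmegaBS

open Filter

variable {α : Type*}

section

variable {Γ : Type} {A : Automaton α Γ}

/-- Some `B`-counter is incremented, and not reset, in runs of profile `T`. -/
def BoundsBlocks (A : Automaton α Γ) (T : Γ → Fin 3) : Prop := ∃ c, A.type c = .B ∧ T c = 1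

open Classical in
/-- The constraint on the number of blocks in a run of profile `T`. -/
noncomputable def blockCount (A : Automaton α Γ) (T : Γ → Fin 3) : CountCond :=
  if BoundsBlocks A T then atMost else anyCount

/-- The certificates of counters that are incremented, and not reset, may be raised. -/
def MayRaise (T : Γ → Fin 3) (z z' : A.State × (Γ → Bool)) : Prop :=
  z.1 = z'.1 ∧ ∀ c, z.2 c ≠ z'.2 c → T c = 1 ∧ z'.2 c = true

variable (A) in
/-- The words obtained by runs of blocks followed by a tail; the second summand is for counters
that are large because there are many blocks. -/
noncomputable def blockLang (T : Γ → Fin 3) (x y : A.State × (Γ → Bool)) : CostLang α :=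
  (union fun z => pathLang (blockCount A T) (fun x y => runLang A (IsBlock T) x y) Set.univ x z *
    runLang A (IsTail T) z y) +
  onlyIf (¬ BoundsBlocks A T ∧ ∃ c, A.type c = .S)
    (union fun p : (A.State × (Γ → Bool)) × (A.State × (Γ → Bool)) => onlyIf (MayRaise T p.1 p.2)
      (pathLang atLeast (fun x y => runLang A (IsBlock T) x y) Set.univ x p.1 *
        runLang A (IsTail T) p.2 y))

theorem Definable.blockLang {V : Variant} (hV : A.IsVariant V) [Finite α] [Finite Γ]
    {T : Γ → Fin 3}
    (ih : ∀ T' < T, ∀ x y, Definable V (runLang A (fun π => π ≠ [] ∧ profile π = T') x y))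
    (x y : A.State × (Γ → Bool)) : Definable V (blockLang A T x y) := by
  have := A.finite_state
  have hblock := fun x y => Definable.runLang_isBlock (A := A) ih x y
  have htail := fun x y => Definable.runLang_isTail (A := A) ih x y
  refine (Definable.union fun z => Definable.mul ?_ (htail z y)).add
    (Definable.onlyIf fun h => Definable.union fun p => Definable.onlyIf fun _ =>
      Definable.mul ?_ (htail p.2 y))
  · rw [blockCount]
    split_ifs with h
    · obtain ⟨c, hc, -⟩ := h
      exact Definable.pathLang_atMost ((hV c).1 hc) hblock Set.finite_univ x z
    · exact Definable.pathLang_anyCount hblock Set.finite_univ x z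
  · obtain ⟨-, c, hc⟩ := h
    exact Definable.pathLang_atLeast ((hV c).2 hc) hblock x p.1

theorem isTail_profile_le {T : Γ → Fin 3} {π : List (Transition A.State Γ)} (h : IsTail T π) :
    profile π ≤ T := by
  rcases h with rfl | h
  · exact bot_le
  · exact h.le

/-- If blocks only increment `c`, there are at most `b` of them and each adds at most `b`. Otherwise
values inside the blocks stay below `2 * b`. The tail adds at most `b` more. -/
theorem okB_of_blocks {T : Γ → Fin 3} {b k : ℕ} {c : Γ} {π π' : List (Transition A.State Γ)}
    (hk : T c = 1 → k ≤ b)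
    (h1 : T c ≠ 1 → ∀ n ≤ b, okB (b + b) n (acts c π)) (h2 : okB (k * b) 0 (acts c π))
    (h3 : okB b 0 (acts c π')) : okB (b * b + 3 * b) 0 (acts c (π ++ π')) := by
  rw [acts_append]
  by_cases hT : T c = 1
  · have : k * b ≤ b * b := Nat.mul_le_mul_right b (hk hT)
    exact (okB.append_zero h2 h3).mono (by omega) le_rfl
  · exact (okB.append_zero (h1 hT 0 (Nat.zero_le b)) h3).mono (by nlinarith) le_rfl

theorem mem_runLang_of_mem_blockLang {T : Γ → Fin 3} {x y : A.State × (Γ → Bool)} {b s : ℕ}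
    {w : List α} (h : w ∈ blockLang A T x y b s) :
    w ∈ runLang A (fun π => π ≠ [] ∧ profile π = T) x y (b * b + 3 * b) s := by
  rcases h with ⟨z, u, ⟨k, hk, hpath⟩, v, ⟨π', hπ', hrun', hok'⟩, rfl⟩ |
    ⟨⟨hB, -⟩, ⟨z, z'⟩, ⟨hz, hraise⟩, u, ⟨k, hk, hpath⟩, v, ⟨π', hπ', hrun', hok'⟩, rfl⟩
  · obtain ⟨π, h1, h2, h3, h4, h5, h6, h7⟩ := exists_run_of_lPath hpath
    refine ⟨π ++ π', ⟨by simp [h1], ?_⟩, h2.append hrun', fun c => ?_⟩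
    · rw [profile_append, h3]
      exact sup_eq_left.2 (isTail_profile_le hπ')
    · have h8 := hok' c
      cases hc : A.type c with
      | B =>
        rw [hc] at h8
        refine okB_of_blocks (fun hT => ?_) (h5 c hc) (h6 c hc) h8
        rwa [blockCount, if_pos ⟨c, hc, hT⟩] at hk
      | S =>
        rw [hc] at h8
        have h9 := okS.append_startVal (h4 c hc) h8
        rwa [← acts_append] at h9
  · obtain ⟨π, h1, h2, h3, h4, h5, h6, h7⟩ := exists_run_of_lPath hpath
    simp only at hz hraise
    refine ⟨π ++ π', ⟨by simp [h1], ?_⟩, h2.append (hz ▸ hrun'), fun c => ?_⟩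
    · rw [profile_append, h3]
      exact sup_eq_left.2 (isTail_profile_le hπ')
    · have h8 := hok' c
      cases hc : A.type c with
      | B =>
        rw [hc] at h8
        exact okB_of_blocks (fun hT => absurd ⟨c, hc, hT⟩ hB) (h5 c hc) (h6 c hc) h8
      | S =>
        rw [hc] at h8
        -- A raised certificate is truthful: each of the at least `s` blocks increments `c`, and
        -- none resets it.
        have h9 : okS s (z'.2 c) (startVal s (x.2 c)) (acts c π) := by
          by_cases heq : z.2 c = z'.2 c
          · rw [← heq]
            exact h4 c hc
          · obtain ⟨hT, htrue⟩ := hraise c heq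
            rw [htrue]
            refine okS_true_iff.2 ⟨(h4 c hc).to_false, ?_⟩
            exact (le_trans hk (h7 c hT)).trans (countFrom_mono (Nat.zero_le _))
        have h10 := okS.append_startVal h9 h8
        rwa [← acts_append] at h10

theorem profile_le_of_mem_blocks {T : Γ → Fin 3} {Bs : List (List (Transition A.State Γ))}
    (hB : ∀ B ∈ Bs, IsBlock T B) (c : Γ) (hT : T c ≠ 2) :
    ∀ l ∈ Bs.map (acts c), Action.reset ∉ l := by
  intro l hl
  obtain ⟨B, hB', rfl⟩ := List.mem_map.1 hl
  exact profile_ne_two (by rw [(hB B hB').1]; exact hT)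

theorem reset_not_mem_of_isTail {T : Γ → Fin 3} {π : List (Transition A.State Γ)}
    (h : IsTail T π) (c : Γ) (hT : T c ≠ 2) : Action.reset ∉ acts c π := by
  refine profile_ne_two fun h2 => hT ?_
  have := isTail_profile_le h c
  rw [h2] at this
  exact le_antisymm (Fin.le_last _) this

theorem length_le_of_okB {T : Γ → Fin 3} {Bs : List (List (Transition A.State Γ))}
    (hB : ∀ B ∈ Bs, IsBlock T B) {c : Γ} (hT : T c = 1) {b : ℕ} {l : List Action}
    (h : okB b 0 ((Bs.map (acts c)).flatten ++ l)) : Bs.length ≤ b := by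
  have h1 : (Bs.map (acts c)).length ≤ _ := length_le_countFrom_flatten
    (profile_le_of_mem_blocks hB c (by rw [hT]; decide)) fun l hl => by
      obtain ⟨B, hB', rfl⟩ := List.mem_map.1 hl
      exact profile_eq_one (by rw [(hB B hB').1]; exact hT)
  rw [okB_append] at h
  have h2 := h.1.countFrom_le (Nat.zero_le b)
  rw [List.length_map] at h1
  omega

/-- The run is cut greedily into blocks and a tail. The question is how an uncertified `S`-counter
without resets becomes large: in one block, in the tail, or by the number of blocks. In the last
case there are more than `b + s` blocks; more than `b` excludes a `B`-counter that bounds their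
number, and `s` of them are what the second summand of `blockLang` asks for. The summand `(b + s +
2) * (s + 1)` of the threshold enforces this alternative, and `s + s` pays for the certificates of
counters that are reset in every block. -/
theorem mem_blockLang_of_mem_runLang {T : Γ → Fin 3} {x y : A.State × (Γ → Bool)} {b s : ℕ}
    {w : List α}
    (h : w ∈ runLang A (fun π => π ≠ [] ∧ profile π = T) x y b
      ((b + s + 2) * (s + 1) + (s + s))) :
    w ∈ blockLang A T x y b s := by
  obtain ⟨π, ⟨hne, hpr⟩, hrun, hok⟩ := h
  obtain ⟨Bs, π', rfl, hB, hπ'⟩ := exists_blocks π hpr.le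
  have hBs : Bs ≠ [] := by
    rintro rfl
    simp only [List.flatten_nil, List.nil_append] at hne hpr
    exact absurd (hπ'.resolve_left hne) (by rw [hpr]; exact lt_irrefl T)
  obtain ⟨r, u, v, rfl, hu, hv⟩ := hrun.exists_split
  have hacts : ∀ c, acts c (Bs.flatten ++ π') = (Bs.map (acts c)).flatten ++ acts c π' := by
    intro c
    rw [acts_append, acts_flatten]
  have hok' : ∀ c, okCounter (A.type c) b ((b + s + 2) * (s + 1) + (s + s)) (x.2 c) (y.2 c)
      ((Bs.map (acts c)).flatten ++ acts c π') := fun c => hacts c ▸ hok c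
  have hlast : Bs.getLast hBs ∈ Bs := List.getLast_mem hBs
  have hprB : ∀ B ∈ Bs, profile B = T := fun B h => (hB B h).1
  -- the number of blocks is large if no block or tail has a large count
  have hmany : ∀ c, A.type c = .S → T c ≠ 2 → x.2 c = false → y.2 c = true →
      (¬ ∃ l ∈ Bs.map (acts c), s ≤ countFrom 0 l) → ¬ s ≤ countFrom 0 (acts c π') →
      b + s < Bs.length := by
    intro c hc hT hx hy h1 h2
    have h3 := hok' c
    rw [hc, hx, hy] at h3
    have h4 := (okS_true_iff.1 (show okS _ true 0 _ from h3)).2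
    rw [countFrom_append_zero (reset_not_mem_of_isTail hπ' c hT)] at h4
    have h5 := countFrom_flatten_le (s := s) (profile_le_of_mem_blocks hB c hT) fun l hl => by
      by_contra! hlt
      exact h1 ⟨l, hl, hlt.le⟩
    rw [List.length_map] at h5
    by_contra! hlt
    have h6 : Bs.length * s ≤ (b + s) * s := Nat.mul_le_mul_right s hlt
    nlinarith
  -- Such a counter goes from zero to a large value without a reset, so it is incremented.
  have hone : ∀ c, A.type c = .S → T c ≠ 2 → x.2 c = false → y.2 c = true → T c = 1 := by
    intro c hc hT hx hy
    have h3 := hok' c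
    rw [hc, hx, hy, ← hacts] at h3
    have h4 := (okS_true_iff.1 (show okS _ true 0 _ from h3)).2
    rcases profile_cases (Bs.flatten ++ π') c with ⟨⟨h5, h6⟩, -⟩ | ⟨⟨h5, -⟩, -⟩ | ⟨h5, -⟩
    · rw [h6] at h4
      nlinarith
    · rw [← hpr, h5]
    · exact absurd (hpr ▸ h5) hT
  -- certificates, where those of the counters in `E` are raised after the blocks
  have hcert : ∀ c, ((A.type c = .S ∧ T c ≠ 2 ∧ x.2 c = false ∧ y.2 c = true) →
        (∃ l ∈ Bs.map (acts c), s ≤ countFrom 0 l) ∨ s ≤ countFrom 0 (acts c π')) →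
      ∃ β, OkChain (A.type c) b s (x.2 c) (Bs.map (acts c)) β ∧
        okCounter (A.type c) b s β (y.2 c) (acts c π') := by
    intro c hex
    have h3 := hok' c
    cases hc : A.type c with
    | B =>
      rw [hc] at h3
      have h4 := okB.of_mem_flatten h3
      exact ⟨_, OkChain.of_okB h4.1, h4.2⟩
    | S =>
      rw [hc] at h3
      by_cases hT : T c = 2
      · have h5 : okS (s + s) (y.2 c) (startVal ((b + s + 2) * (s + 1) + (s + s)) (x.2 c))
            ((Bs.map (acts c)).flatten ++ acts c π') :=
          okS.mono (show okS _ _ _ _ from h3) (Nat.le_add_left _ _) le_rfl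
        refine OkChain.exists_of_reset h5 ?_ fun l hl => ?_
        · cases x.2 c <;> simp [startVal]
        · obtain ⟨B, hB', rfl⟩ := List.mem_map.1 hl
          exact profile_eq_two (by rw [hprB B hB', hT])
      · have hr := profile_le_of_mem_blocks hB c hT
        have hr' := reset_not_mem_of_isTail hπ' c hT
        cases hx : x.2 c with
        | true =>
          refine ⟨true, OkChain.const hr, ?_⟩
          cases hy : y.2 c with
          | true => exact okS_const hr'
          | false => exact okS_of_reset_not_mem hr'
        | false =>
          cases hy : y.2 c with
          | false => exact ⟨false, OkChain.const hr, okS_const hr'⟩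
          | true =>
            rcases hex ⟨hc, hT, hx, hy⟩ with h6 | h6
            · exact ⟨true, OkChain.raise hr h6, okS_const hr'⟩
            · exact ⟨false, OkChain.const hr, okS_true_iff.2 ⟨okS_of_reset_not_mem hr', h6⟩⟩
  by_cases hbad : ∃ c, (A.type c = .S ∧ T c ≠ 2 ∧ x.2 c = false ∧ y.2 c = true) ∧
      (¬ ∃ l ∈ Bs.map (acts c), s ≤ countFrom 0 l) ∧ ¬ s ≤ countFrom 0 (acts c π')
  · obtain ⟨c₀, ⟨h1, h2, h3, h4⟩, h5, h6⟩ := hbad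
    have hlen := hmany c₀ h1 h2 h3 h4 h5 h6
    have hnB : ¬ BoundsBlocks A T := by
      rintro ⟨c, hc, hT⟩
      have h7 := hok' c
      rw [hc] at h7
      have := length_le_of_okB hB hT h7
      omega
    -- The number of blocks is now large enough for all counters of this kind, so every one of them
    -- stays uncertified during the blocks and is raised after them, whether or not a single block
    -- would have sufficed.
    have hcert' : ∀ c, ∃ β β', OkChain (A.type c) b s (x.2 c) (Bs.map (acts c)) β ∧
        (β ≠ β' → T c = 1 ∧ β' = true) ∧ okCounter (A.type c) b s β' (y.2 c) (acts c π') := by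
      intro c
      by_cases hc : A.type c = .S ∧ T c ≠ 2 ∧ x.2 c = false ∧ y.2 c = true
      · have h8 := hone c hc.1 hc.2.1 hc.2.2.1 hc.2.2.2
        refine ⟨false, true, ?_, fun _ => ⟨h8, rfl⟩, ?_⟩
        · rw [hc.1, hc.2.2.1]
          exact OkChain.const (profile_le_of_mem_blocks hB c hc.2.1)
        · rw [hc.1, hc.2.2.2]
          exact okS_const (reset_not_mem_of_isTail hπ' c hc.2.1)
      · obtain ⟨β, h8, h9⟩ := hcert c fun h => absurd h hc
        exact ⟨β, β, h8, fun h => absurd rfl h, h9⟩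
    choose β β' g1 g2 g3 using hcert'
    refine Or.inr ⟨⟨hnB, c₀, h1⟩, ((r, β), (r, β')), ⟨rfl, g2⟩, u,
      ⟨Bs.length, ?_, lPath_of_okChain hBs hB hu g1⟩, v, ⟨π', hπ', hv, g3⟩, rfl⟩
    simp only [atLeast]
    omega
  · have hgood : ∀ c, ∃ β, OkChain (A.type c) b s (x.2 c) (Bs.map (acts c)) β ∧
        okCounter (A.type c) b s β (y.2 c) (acts c π') := by
      intro c
      refine hcert c fun hc => ?_
      by_contra! hcon
      exact hbad ⟨c, hc, by simpa using hcon.1, by simpa using hcon.2⟩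
    choose β g1 g2 using hgood
    refine Or.inl ⟨(r, β), u, ⟨Bs.length, ?_, lPath_of_okChain hBs hB hu g1⟩, v,
      ⟨π', hπ', hv, g2⟩, rfl⟩
    rw [blockCount]
    split_ifs with h
    · obtain ⟨c, hc, hT⟩ := h
      have h7 := hok' c
      rw [hc] at h7
      exact length_le_of_okB hB hT h7
    · trivial

/-- The words with a run of a given profile form a definable language. -/
theorem Definable.runLang_profile {V : Variant} (hV : A.IsVariant V) [Finite α] [Finite Γ]
    (T : Γ → Fin 3) (x y : A.State × (Γ → Bool)) :
    Definable V (runLang A (fun π => π ≠ [] ∧ profile π = T) x y) := by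
  induction T using WellFoundedLT.induction generalizing x y with
  | ind T ih =>
    have h := Definable.blockLang hV (T := T) ih x y
    exact h.of_represents ⟨h.costMono, costMono_runLang _ x y,
      fun b => ⟨_, fun s w hw => mem_runLang_of_mem_blockLang hw⟩,
      fun b => ⟨b, fun s => ⟨_, fun w hw => mem_blockLang_of_mem_runLang hw⟩⟩⟩

end

end OmegaBS

/-! ### From automata to expressions. -/

namespace OmegaBS

open Filter

variable {α : Type*}

section

variable {Γ : Type} {A : Automaton α Γ}

/-! ### Regularity of the words leading to a state -/

theorem definable_runOn (V : Variant) [Finite α] (p q : A.State) :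
    Definable V (fun _ _ => {w | ∃ π, A.RunOn p w π q} : CostLang α) := by
  have := A.finite_state
  set L : A.State → A.State → CostLang α := fun p q _ _ =>
    {w | ∃ a, w = [a] ∧ ∃ t ∈ A.δ a, t.source = p ∧ t.target = q} with hLdef
  have hL : ∀ p q, Definable V (L p q) := by
    intro p q
    have e : L p q = OmegaBS.union fun a => fun _ _ =>
        {w | w = [a] ∧ ∃ t ∈ A.δ a, t.source = p ∧ t.target = q} := rfl
    rw [e]
    refine Definable.union fun a => ?_
    exact Definable.of_singleton (w₀ := [a]) (e := .letter a) trivial (fun _ _ _ => Iff.rfl)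
      (fun _ _ _ _ _ _ _ h => h) fun _ _ _ h => h.1
  have e : (fun _ _ => {w | ∃ π, A.RunOn p w π q} : CostLang α) =
      OmegaBS.onlyIf (p = q) 1 + pathLang anyCount L Set.univ p q := by
    funext b s
    ext w
    constructor
    · rintro ⟨π, h⟩
      have key : w = [] ∧ p = q ∨ ∃ k, LPath (fun p q => L p q b s) Set.univ p q k w := by
        induction h with
        | nil p => exact Or.inl ⟨rfl, rfl⟩
        | @cons a t w π q ht hrun ih =>
          have hmem : [a] ∈ L t.source t.target b s := ⟨a, rfl, t, ht, rfl, rfl⟩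
          rcases ih with ⟨rfl, rfl⟩ | ⟨k, hk⟩
          · exact Or.inr ⟨1, .edge hmem⟩
          · exact Or.inr ⟨k + 1, LPath.cons (L := fun p q => L p q b s) hmem (Set.mem_univ _) hk⟩
      rcases key with ⟨rfl, rfl⟩ | ⟨k, hk⟩
      · exact Or.inl ⟨rfl, rfl⟩
      · exact Or.inr ⟨k, trivial, hk⟩
    · rintro (⟨rfl, h⟩ | ⟨k, -, hk⟩)
      · rw [mem_one_apply] at h
        subst h
        exact ⟨[], .nil p⟩
      · change ∃ π, A.RunOn p w π q
        induction hk with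
        | edge h =>
          obtain ⟨a, rfl, t, ht, rfl, rfl⟩ := h
          exact ⟨[t], .cons ht (.nil _)⟩
        | cons h _ _ ih =>
          obtain ⟨a, rfl, t, ht, rfl, rfl⟩ := h
          obtain ⟨π, hπ⟩ := ih
          exact ⟨t :: π, .cons ht hπ⟩
  have hnil : Definable V (OmegaBS.onlyIf (p = q) (1 : CostLang α)) := Definable.onlyIf fun _ =>
    ⟨.eps, trivial, Represents.refl CostMono.one⟩
  rw [e]
  exact hnil.add (Definable.pathLang_anyCount hL Set.finite_univ p q)

theorem exists_regularExpression_runOn [Finite α] (p q : A.State) :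
    ∃ r : RegularExpression α, ∀ w, w ∈ r.matches' ↔ ∃ π, A.RunOn p w π q := by
  obtain ⟨e, -, he⟩ := definable_runOn .BS p q
  refine ⟨e.toRegular, fun w => ?_⟩
  rw [BSExpr.mem_matches'_toRegular]
  constructor
  · rintro ⟨b, hb⟩
    obtain ⟨b', hb'⟩ := he.sound b
    exact hb' 0 w hb
  · intro h
    obtain ⟨b', hb'⟩ := he.complete 0
    obtain ⟨s, hs⟩ := hb' 0
    exact ⟨b', hs w h⟩

/-! ### Cutting an infinite run -/

theorem runOn_seg {x : Stream' α} {ρ : ℕ → Transition A.State Γ} (h : A.IsRun x ρ) {a b : ℕ}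
    (hab : a ≤ b) : A.RunOn (ρ a).source (seg x.get a b) (seg ρ a b) (ρ b).source := by
  induction b, hab using Nat.le_induction with
  | base =>
    rw [seg_self, seg_self]
    exact .nil _
  | succ b hab ih =>
    rw [seg_succ _ hab, seg_succ _ hab, ← h.2 b]
    exact ih.append (.cons (h.1 b) (.nil _))

theorem of_runOn_seg {x : ℕ → α} {ρ : ℕ → Transition A.State Γ} {a b : ℕ} {p q : A.State}
    (h : A.RunOn p (seg x a b) (seg ρ a b) q) :
    (∀ j, a ≤ j → j < b → ρ j ∈ A.δ (x j)) ∧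
    (∀ j, a ≤ j → j + 1 < b → (ρ j).target = (ρ (j + 1)).source) ∧
    (a < b → (ρ a).source = p) := by
  by_cases hab : a < b
  · obtain ⟨n, rfl⟩ := Nat.exists_eq_add_of_le hab.le
    clear hab
    induction n generalizing a p with
    | zero => exact ⟨fun j h1 h2 => by omega, fun j h1 h2 => by omega, fun h => by omega⟩
    | succ n ih =>
      rw [show a + (n + 1) = a + 1 + n by omega] at h ⊢
      rw [seg_cons x (by omega), seg_cons ρ (by omega)] at h
      cases h with
      | cons ht h =>
        obtain ⟨h1, h2, h3⟩ := ih h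
        refine ⟨fun j hj hj' => ?_, fun j hj hj' => ?_, fun _ => rfl⟩
        · rcases hj.eq_or_lt with rfl | hj
          · exact ht
          · exact h1 j hj hj'
        · rcases hj.eq_or_lt with rfl | hj
          · exact (h3 (by omega)).symm
          · exact h2 j hj hj'
  · exact ⟨fun j h1 h2 => by omega, fun j h1 h2 => by omega, fun h => absurd h hab⟩

theorem acts_seg (ρ : ℕ → Transition A.State Γ) (c : Γ) (a b : ℕ) :
    acts c (seg ρ a b) = seg (fun k => (ρ k).action c) a b := (seg_map _ ρ a b).symm

variable (A) in
/-- The words of runs from `z` to `z` that reset all counters. -/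
def loopLang (z : A.State × (Γ → Bool)) : CostLang α :=
  runLang A (fun π => π ≠ [] ∧ profile π = fun _ => 2) z z

variable (A) in
/-- The words of runs from the initial state to `q`. -/
def leadLang (q : A.State) : Language α := {w | ∃ π, A.RunOn A.init w π q}

theorem absorbs_leadLang (z : A.State × (Γ → Bool)) : Absorbs (leadLang A z.1) (loopLang A z) := by
  rintro w ⟨π, hπ⟩ b u ⟨π', -, hπ', -⟩
  exact ⟨_, hπ.append hπ'⟩

/-- The value of a counter before an action stays large in a segment if either the value at the
beginning is certified or it is small compared to the next value. -/
theorem okS_seg_of_half (a : ℕ → Action) {p q s n : ℕ} {e : Bool}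
    (hs : ∀ k, p ≤ k → a k = .reset → s + s ≤ cnt a k)
    {r : ℕ} (hpr : p ≤ r) (hrq : r < q) (hr : a r = .reset)
    (hmin : ∀ k, p ≤ k → k < r → a k ≠ .reset)
    (hn : s ≤ n ∨ 2 * cnt a p < cnt a r) (he : e = true → s ≤ cnt a q) :
    okS s e n (seg a p q) := by
  have hnr : Action.reset ∉ seg a p r := by
    intro h
    obtain ⟨k, hk, hk', hk''⟩ := mem_seg.1 h
    exact hmin k hk hk' hk''
  have hmem : Action.reset ∈ seg a p q := mem_seg.2 ⟨r, hpr, hrq, hr⟩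
  have hcnt := cnt_eq_countFrom a hpr
  rw [countFrom_of_not_mem hnr] at hcnt
  have hsr := hs r hpr hr
  have h1 : okS s false n (seg a p q) := by
    rw [← seg_append a hpr hrq.le, okS_append]
    refine ⟨okS_of_reset_not_mem hnr, ?_⟩
    rw [seg_cons a hrq, hr]
    refine ⟨?_, ?_⟩
    -- At the first reset the true value is at least `s + s`. Either the certified start already
    -- provides `s`, or more than half of the value was accumulated after `p`.
    · rw [countFrom_of_not_mem hnr]
      omega
    · have h0 : cnt a (r + 1) = 0 := by rw [cnt_succ, hr]; rfl
      rw [← h0, okS_seg_iff a hrq]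
      intro k hk hk' hk''
      have := hs k (by omega) hk''
      omega
  cases e with
  | false => exact h1
  | true =>
    refine okS_true_iff.2 ⟨h1, ?_⟩
    rw [countFrom_eq_of_mem hmem (n' := cnt a p), ← cnt_eq_countFrom a (by omega)]
    exact he rfl

/-- By the pigeonhole principle some pair of a state and certificates recurs infinitely often; the
cuts are taken among its occurrences, so far apart that every counter is reset in between. -/
theorem mem_omegaTerm_of_mem_lang [Finite Γ] {x : Stream' α} (hx : x ∈ A.lang) :
    ∃ z, x ∈ omegaTerm (leadLang A z.1) (loopLang A z) := by
  classical
  have := A.finite_state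
  have := Fintype.ofFinite Γ
  obtain ⟨ρ, hrun, hinit, hacc⟩ := hx
  set act : Γ → ℕ → Action := fun c k => (ρ k).action c with hact
  have hinf : ∀ c n, ∃ k, n ≤ k ∧ act c k = .reset := fun c n => by
    obtain ⟨k, hk, hk'⟩ := infinite_resetPositions_iff.1 (hacc c).1 n
    exact ⟨k, hk, hk'⟩
  have hlim : ∀ c, (A.type c).LimitCond (act c) := fun c =>
    (condition_counterValues_iff (hacc c).1 _).1 (hacc c).2
  set nx : Γ → ℕ → ℕ := fun c n => Nat.find (hinf c n) with hnx
  have hnx1 : ∀ c n, n ≤ nx c n := fun c n => (Nat.find_spec (hinf c n)).1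
  have hnx2 : ∀ c n, act c (nx c n) = .reset := fun c n => (Nat.find_spec (hinf c n)).2
  have hnx3 : ∀ c n k, n ≤ k → k < nx c n → act c k ≠ .reset := fun c n k hk hk' h =>
    Nat.find_min (hinf c n) hk' ⟨hk, h⟩
  -- A counter is certified at `k` if its value there is at least half of its value at the next
  -- reset. This criterion does not mention a threshold, so the same certificates serve every `s`.
  set Z : ℕ → A.State × (Γ → Bool) := fun k => ((ρ k).source,
    fun c => decide (cnt (act c) (nx c k) ≤ 2 * cnt (act c) k)) with hZ
  obtain ⟨z, hz⟩ := Finite.exists_infinite_fiber Z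
  have hz' : ∀ n, ∃ m > n, Z m = z ∧ ∀ c, nx c n < m := by
    intro n
    have hinf' : (Z ⁻¹' {z}).Infinite := Set.infinite_coe_iff.1 hz
    obtain ⟨m, hm, hm'⟩ := hinf'.exists_gt (n + Finset.univ.sup fun c => nx c n)
    refine ⟨m, by omega, hm, fun c => ?_⟩
    have := Finset.le_sup (f := fun c => nx c n) (Finset.mem_univ c)
    omega
  choose next hn1 hn2 hn3 using hz'
  set k : ℕ → ℕ := fun i => next^[i] (next 0) with hk
  have hks : ∀ i, k (i + 1) = next (k i) := fun i => Function.iterate_succ_apply' next i _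
  have hkz : ∀ i, Z (k i) = z := by
    intro i
    cases i with
    | zero => exact hn2 0
    | succ i => rw [hks]; exact hn2 _
  have hkm : StrictMono k := strictMono_nat_of_lt_succ fun i => by rw [hks]; exact hn1 _
  have hsrc : ∀ i, (ρ (k i)).source = z.1 := fun i => congrArg Prod.fst (hkz i)
  have hbit : ∀ i c, z.2 c = decide (cnt (act c) (nx c (k i)) ≤ 2 * cnt (act c) (k i)) := by
    intro i c
    rw [← hkz i]
  have hB : ∃ N, ∀ c, A.type c = .B → ∀ j, cnt (act c) j ≤ N := by
    have : ∀ c, ∃ N, A.type c = .B → ∀ j, cnt (act c) j ≤ N := by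
      intro c
      have h1 := hlim c
      cases hc : A.type c with
      | B =>
        rw [hc] at h1
        obtain ⟨N, hN⟩ := h1
        exact ⟨N, fun _ => hN⟩
      | S => exact ⟨0, fun h => by cases h⟩
    choose N hN using this
    exact ⟨Finset.univ.sup N, fun c hc j => (hN c hc j).trans (Finset.le_sup (Finset.mem_univ c))⟩
  have hS : ∀ s, ∃ p, ∀ c, A.type c = .S → ∀ j ≥ p, act c j = .reset → s ≤ cnt (act c) j := by
    intro s
    have : ∀ c, ∃ p, A.type c = .S → ∀ j ≥ p, act c j = .reset → s ≤ cnt (act c) j := by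
      intro c
      have h1 := hlim c
      cases hc : A.type c with
      | S =>
        rw [hc] at h1
        obtain ⟨p, hp⟩ := h1 s
        exact ⟨p, fun _ => hp⟩
      | B => exact ⟨0, fun h => by cases h⟩
    choose p hp using this
    exact ⟨Finset.univ.sup p, fun c hc j hj =>
      hp c hc j ((Finset.le_sup (Finset.mem_univ c)).trans hj)⟩
  obtain ⟨N, hN⟩ := hB
  have hmem : ∀ i s, (∀ c, A.type c = .S → okS s (z.2 c) (startVal s (z.2 c))
      (seg (act c) (k i) (k (i + 1)))) → seg x.get (k i) (k (i + 1)) ∈ loopLang A z N s := by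
    intro i s h
    have hlt : k i < k (i + 1) := hkm (Nat.lt_succ_self i)
    refine ⟨seg ρ (k i) (k (i + 1)), ⟨?_, ?_⟩, ?_, fun c => ?_⟩
    · intro he
      have := length_seg ρ (k i) (k (i + 1))
      rw [he, List.length_nil] at this
      omega
    · funext c
      by_contra hne
      refine profile_ne_two hne ?_
      rw [acts_seg]
      exact mem_seg.2 ⟨nx c (k i), hnx1 c _, by rw [hks]; exact hn3 _ c, hnx2 c _⟩
    · have := runOn_seg hrun hlt.le
      rwa [hsrc, hsrc] at this
    · rw [acts_seg]
      cases hc : A.type c with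
      | S => exact h c hc
      | B => exact (okB_seg (act c) hlt.le fun j _ => hN c hc j).mono le_rfl (Nat.zero_le _)
  refine ⟨z, k, hkm, ⟨seg ρ 0 (k 0), ?_⟩, N, fun i => hmem i 0 fun c _ => okS_zero, fun s => ?_⟩
  · have := runOn_seg hrun (Nat.zero_le (k 0))
    rwa [hsrc, hinit] at this
  · obtain ⟨p, hp⟩ := hS (s + s)
    refine ⟨p, fun i hi => hmem i s fun c hc => ?_⟩
    have hpi : p ≤ k i := hi.trans (hkm.id_le i)
    have hlt : k i < k (i + 1) := hkm (Nat.lt_succ_self i)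
    refine okS_seg_of_half (act c) (fun j hj => hp c hc j (hpi.trans hj)) (hnx1 c _)
      (by rw [hks]; exact hn3 _ c) (hnx2 c _) (hnx3 c _) ?_ fun he => ?_
    · have := hbit i c
      cases hzc : z.2 c with
      | true => exact Or.inl le_rfl
      | false =>
        rw [hzc] at this
        exact Or.inr (not_le.1 (decide_eq_false_iff_not.1 this.symm))
    · have h1 := hbit (i + 1) c
      rw [he] at h1
      have h2 := of_decide_eq_true h1.symm
      have h3 := hp c hc (nx c (k (i + 1))) (by have := hnx1 c (k (i + 1)); omega) (hnx2 c _)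
      omega

/-- Gluing finite runs. -/
theorem exists_isRun {x : Stream' α} {k : ℕ → ℕ} (hk : StrictMono k) (hk0 : k 0 = 0)
    {P : ℕ → A.State} {π : ℕ → List (Transition A.State Γ)}
    (h : ∀ i, A.RunOn (P i) (seg x.get (k i) (k (i + 1))) (π i) (P (i + 1))) :
    ∃ ρ, A.IsRun x ρ ∧ (ρ 0).source = P 0 ∧ ∀ i, seg ρ (k i) (k (i + 1)) = π i := by
  have hlen : ∀ i, (π i).length = k (i + 1) - k i := fun i => by
    rw [← (h i).length_eq, length_seg]
  have hne : ∀ i, π i ≠ [] := by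
    intro i he
    have h1 := hlen i
    have h2 : k i < k (i + 1) := hk (Nat.lt_succ_self i)
    rw [he, List.length_nil] at h1
    omega
  have hpre : ∀ i, (pre π i).length = k i := by
    intro i
    induction i with
    | zero => exact hk0.symm
    | succ i ih =>
      have h2 : k i < k (i + 1) := hk (Nat.lt_succ_self i)
      rw [pre_succ, List.length_append, ih, hlen]
      omega
  obtain ⟨ρ, hρ⟩ := exists_seg_eq hne
  have hρ' : ∀ i, seg ρ (k i) (k (i + 1)) = π i := fun i => by
    have := hρ i
    rwa [hpre, hpre] at this
  have hall : ∀ i, A.RunOn (P 0) (seg x.get 0 (k i)) (seg ρ 0 (k i)) (P i) := by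
    intro i
    induction i with
    | zero =>
      rw [hk0, seg_self, seg_self]
      exact .nil _
    | succ i ih =>
      have h2 : k i < k (i + 1) := hk (Nat.lt_succ_self i)
      rw [← seg_append x.get (Nat.zero_le _) h2.le, ← seg_append ρ (Nat.zero_le _) h2.le]
      refine ih.append ?_
      rw [hρ']
      exact h i
  refine ⟨ρ, ⟨fun j => ?_, fun j => ?_⟩, ?_, hρ'⟩
  · have : j + 1 ≤ k (j + 1) := hk.id_le (j + 1)
    exact (of_runOn_seg (hall (j + 1))).1 j (Nat.zero_le j) this
  · have : j + 2 ≤ k (j + 2) := hk.id_le (j + 2)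
    exact (of_runOn_seg (hall (j + 2))).2.1 j (Nat.zero_le j) (by omega)
  · have : 1 ≤ k 1 := hk.id_le 1
    exact (of_runOn_seg (hall 1)).2.2 (by omega)

/-- Values in a run made of blocks that reset the counter and are bounded. -/
theorem exists_bound_of_blocks {a : ℕ → Action} {k : ℕ → ℕ} (hk : StrictMono k) {N : ℕ}
    (hmem : ∀ i, 1 ≤ i → Action.reset ∈ seg a (k i) (k (i + 1)))
    (hok : ∀ i, 1 ≤ i → okB N 0 (seg a (k i) (k (i + 1)))) : ∃ N', ∀ j, cnt a j ≤ N' := by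
  have hpos : ∀ j, cnt a j ≤ j := by
    intro j
    have := countFrom_le_add_length 0 (seg a 0 j)
    rw [length_seg] at this
    rw [cnt]
    omega
  -- The first block is unconstrained, so the value after it is bounded by its length `k 1` only.
  -- From then on every block resets the counter.
  have hcut : ∀ i, 1 ≤ i → cnt a (k i) ≤ N + k 1 := by
    intro i hi
    induction i, hi using Nat.le_induction with
    | base => exact (hpos _).trans (Nat.le_add_left _ _)
    | succ i hi ih =>
      rw [cnt_eq_countFrom a (hk (Nat.lt_succ_self i)).le,
        countFrom_eq_of_mem (hmem i hi) (n' := 0)]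
      exact ((hok i hi).countFrom_le (Nat.zero_le _)).trans (Nat.le_add_right _ _)
  refine ⟨N + (N + k 1), fun j => ?_⟩
  by_cases hj : j < k 1
  · exact (hpos j).trans (by omega)
  · obtain ⟨i, hi, hi'⟩ := exists_index_of_strictMono (t := fun i => k (i + 1))
      (fun a b hab => hk (by omega)) (j := j) (by simpa using hj)
    have h1 := hcut (i + 1) (by omega)
    have h2 := (hok (i + 1) (by omega)).add (m := cnt a (k (i + 1)))
    rw [Nat.zero_add] at h2
    have h3 := cnt_le_of_okB a hi (Nat.le_add_left _ _) (h2.of_seg_le hi hi'.le)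
    omega

/-- Loops lead from `z` to `z`, so the certificates established at the end of one loop are those
assumed by the next; hence the conditions on single loops hold for the counter values of the glued
run. -/
theorem lang_of_mem_omegaTerm {x : Stream' α} {z : A.State × (Γ → Bool)}
    (hx : x ∈ omegaTerm (leadLang A z.1) (loopLang A z)) : x ∈ A.lang := by
  obtain ⟨k, hk, ⟨π₀, hπ₀⟩, N, h0, h1⟩ := hx
  obtain ⟨f, hf, h⟩ := exists_threshold
    (p := fun i s => seg x.get (k i) (k (i + 1)) ∈ loopLang A z N s) h0 h1
  choose π hπ hrun hok using h
  -- The prefix and the first loop are merged into one piece, which starts at `0` and is subject to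
  -- no condition.
  set K : ℕ → ℕ := fun i => if i = 0 then 0 else k i with hK
  have hKs : ∀ i, K (i + 1) = k (i + 1) := fun i => rfl
  have hK0 : K 0 = 0 := rfl
  have hKm : StrictMono K := by
    refine strictMono_nat_of_lt_succ fun i => ?_
    rw [hKs]
    cases i with
    | zero =>
      have : k 0 < k 1 := hk Nat.one_pos
      rw [hK0]
      simp only [Nat.zero_add]
      omega
    | succ i => exact hk (Nat.lt_succ_self _)
  set π' : ℕ → List (Transition A.State Γ) := fun i => if i = 0 then π₀ ++ π 0 else π i with hπ'
  set P : ℕ → A.State := fun i => if i = 0 then A.init else z.1 with hP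
  have hruns : ∀ i, A.RunOn (P i) (seg x.get (K i) (K (i + 1))) (π' i) (P (i + 1)) := by
    intro i
    cases i with
    | zero =>
      have h2 := hπ₀.append (hrun 0)
      rw [seg_append x.get (Nat.zero_le _) (hk.monotone (Nat.zero_le 1))] at h2
      exact h2
    | succ i => exact hrun (i + 1)
  obtain ⟨ρ, hρ, hρ0, hseg⟩ := exists_isRun hKm hK0 hruns
  have hacts : ∀ c i, 1 ≤ i → seg (fun j => (ρ j).action c) (K i) (K (i + 1)) = acts c (π i) := by
    intro c i hi
    rw [← acts_seg, hseg]
    simp only [hπ']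
    rw [if_neg (by omega)]
  have hres : ∀ c i, 1 ≤ i → Action.reset ∈ seg (fun j => (ρ j).action c) (K i) (K (i + 1)) := by
    intro c i hi
    rw [hacts c i hi]
    exact profile_eq_two (congrFun (hπ i).2 c)
  have hinf : ∀ c, (resetPositions ρ c).Infinite := by
    intro c
    rw [infinite_resetPositions_iff]
    intro n
    obtain ⟨j, hj, -, hj'⟩ := mem_seg.1 (hres c (n + 1) (by omega))
    have := hKm.id_le (n + 1)
    simp only [id_eq] at this
    exact ⟨j, by omega, hj'⟩
  refine ⟨ρ, hρ, hρ0, fun c => ⟨hinf c, ?_⟩⟩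
  rw [condition_counterValues_iff (hinf c)]
  cases hc : A.type c with
  | B =>
    refine exists_bound_of_blocks (N := N) hKm (hres c) fun i hi => ?_
    rw [hacts c i hi]
    have := hok i c
    rwa [hc] at this
  | S =>
    intro s
    obtain ⟨i₀, hi₀⟩ := hf.exists_ge s
    have hS : ∀ i, i₀ ≤ i → okS s (z.2 c) (startVal s (z.2 c)) (acts c (π i)) := by
      intro i hi
      have := (hok i c).mono le_rfl (hi₀ i hi)
      rwa [hc] at this
    have hval : ∀ i, i₀ ≤ i → 1 ≤ i →
        startVal s (z.2 c) ≤ cnt (fun j => (ρ j).action c) (K (i + 1)) := by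
      intro i hi hi'
      have h2 := hS i hi
      cases hz : z.2 c with
      | false => exact Nat.zero_le _
      | true =>
        rw [hz] at h2
        rw [cnt_eq_countFrom _ (hKm (Nat.lt_succ_self i)).le,
          countFrom_eq_of_mem (hres c i hi') (n' := startVal s true), hacts c i hi']
        exact (okS_true_iff.1 h2).2
    -- The loop that contains `j` needs a preceding one that already meets the threshold `s` and is
    -- not the merged first piece; the shift by `2` ensures both.
    refine ⟨K (i₀ + 2), fun j hj hj' => ?_⟩
    obtain ⟨i, hi, hi'⟩ := exists_index_of_strictMono hKm (j := j) (by rw [hK0]; omega)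
    have hlt : i₀ + 2 < i + 1 := hKm.lt_iff_lt.1 (lt_of_le_of_lt hj hi')
    obtain ⟨m, rfl⟩ : ∃ m, i = m + 1 := ⟨i - 1, by omega⟩
    have h2 := (hS (m + 1) (by omega)).to_false.mono le_rfl (hval m (by omega) (by omega))
    rw [← hacts c (m + 1) (by omega), okS_seg_iff _ (hKm (Nat.lt_succ_self _)).le] at h2
    exact h2 j hi hi' hj'

/-- Languages recognized by automata are regular. -/
theorem isOmegaRegular_lang {V : Variant} [Finite α] [Finite Γ] (hV : A.IsVariant V) :
    IsOmegaRegular V A.lang := by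
  classical
  have := A.finite_state
  have := Fintype.ofFinite (A.State × (Γ → Bool))
  have he : ∀ z : A.State × (Γ → Bool), ∃ e : BSExpr α, e.IsVariant V ∧
      Represents e.val (loopLang A z) := fun z => Definable.runLang_profile hV _ z z
  choose e heV he using he
  choose r hr using fun z : A.State × (Γ → Bool) => exists_regularExpression_runOn A.init z.1
  have hrm : ∀ z, (r z).matches' = leadLang A z.1 := fun z => by
    ext w
    exact hr z w
  refine ⟨(Finset.univ.toList).map fun z => (r z, e z), ?_, ?_⟩
  · intro p hp
    obtain ⟨z, -, rfl⟩ := List.mem_map.1 hp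
    exact heV z
  · rw [lang_eq_omegaTerm]
    ext x
    constructor
    · rintro ⟨p, hp, hx⟩
      obtain ⟨z, -, rfl⟩ := List.mem_map.1 hp
      rw [hrm] at hx
      exact lang_of_mem_omegaTerm (omegaTerm_subset_of_sound (he z).sound hx)
    · intro hx
      obtain ⟨z, hz⟩ := mem_omegaTerm_of_mem_lang hx
      refine ⟨(r z, e z), List.mem_map.2 ⟨z, by simp, rfl⟩, ?_⟩
      rw [hrm]
      exact omegaTerm_subset_of_complete (absorbs_leadLang z) (he z).complete hz

end

end OmegaBS

/-! ### Block automata with hierarchical counters, and their sums, products and loops. -/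

namespace OmegaBS

open Filter

variable {α : Type*}

/-! ### Operations on ordered counters -/

/-- An operation on counters that are numbered by the natural numbers. -/
abbrev CounterOp := ℕ → Action

/-- When a counter is touched, all smaller counters are reset. -/
def CounterOp.IsHierarchical (o : CounterOp) : Prop := ∀ i, o i ≠ .none → ∀ j < i, o j = .reset

/-- Reset the counters smaller than `c` and do `x` to the counter `c`. -/
def opAt (c : ℕ) (x : Action) : CounterOp := fun j =>
  if j < c then .reset else if j = c then x else .none

theorem opAt_of_lt {c j : ℕ} {x : Action} (h : j < c) : opAt c x j = .reset := if_pos h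

theorem opAt_self (c : ℕ) (x : Action) : opAt c x c = x := by simp [opAt]

theorem opAt_of_gt {c j : ℕ} {x : Action} (h : c < j) : opAt c x j = .none := by
  rw [opAt, if_neg (by omega), if_neg (by omega)]

theorem opAt_none_of_ge {c j : ℕ} (h : c ≤ j) : opAt c .none j = .none := by
  rcases h.eq_or_lt with rfl | h
  · exact opAt_self _ _
  · exact opAt_of_gt h

theorem isHierarchical_opAt (c : ℕ) (x : Action) : (opAt c x).IsHierarchical := by
  intro i hi j hj
  have : i ≤ c := by
    by_contra! h
    exact hi (opAt_of_gt h)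
  exact opAt_of_lt (by omega)

/-- The flags `false` and `true` mean that the counter starts at zero and that its final value is
checked as if a reset followed. With these flags a reset splits the constraints without loss, so
block automata accept their languages exactly and not merely up to `Represents`. -/
theorem okCounter_append_reset {t : CounterType} {b s : ℕ} {l l' : List Action} :
    okCounter t b s false true (l ++ .reset :: l') ↔
      okCounter t b s false true l ∧ okCounter t b s false true l' := by
  cases t with
  | B => exact okB_append
  | S =>
    simp only [okCounter, startVal]
    rw [okS_append, okS_true_iff (l := l), and_assoc]
    rfl

theorem okCounter_append_reset_flatten {t : CounterType} {b s : ℕ} {l : List Action}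
    {ls : List (List Action)} :
    okCounter t b s false true (l ++ (ls.map (Action.reset :: ·)).flatten) ↔
      okCounter t b s false true l ∧ ∀ l' ∈ ls, okCounter t b s false true l' := by
  induction ls generalizing l with
  | nil => simp
  | cons l' ls ih =>
    rw [List.map_cons, List.flatten_cons, List.cons_append, okCounter_append_reset, ih]
    simp

theorem okCounter_filter {t : CounterType} {b s : ℕ} {β β' : Bool} {l : List Action}
    {p : Action → Bool} (hp : ∀ a, a ≠ .none → p a = true) :
    okCounter t b s β β' (l.filter p) ↔ okCounter t b s β β' l := by
  have hB : ∀ n, okB b n (l.filter p) ↔ okB b n l := by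
    induction l with
    | nil => exact fun n => Iff.rfl
    | cons a l ih =>
      intro n
      cases a with
      | inc => rw [List.filter_cons_of_pos (hp _ (by simp))]; exact and_congr Iff.rfl (ih _)
      | reset => rw [List.filter_cons_of_pos (hp _ (by simp))]; exact ih _
      | none =>
        by_cases h : p .none = true
        · rw [List.filter_cons_of_pos h]; exact ih _
        · rw [List.filter_cons_of_neg h]; exact ih _
  have hS : ∀ n, okS s β' n (l.filter p) ↔ okS s β' n l := by
    clear hB
    induction l with
    | nil => exact fun n => Iff.rfl
    | cons a l ih =>
      intro n
      cases a with
      | inc => rw [List.filter_cons_of_pos (hp _ (by simp))]; exact ih _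
      | reset => rw [List.filter_cons_of_pos (hp _ (by simp))]; exact and_congr Iff.rfl (ih _)
      | none =>
        by_cases h : p .none = true
        · rw [List.filter_cons_of_pos h]; exact ih _
        · rw [List.filter_cons_of_neg h]; exact ih _
  cases t with
  | B => exact hB 0
  | S => exact hS _

/-- The action is not trivial. -/
def Action.touches : Action → Bool
  | .none => false
  | _ => true

theorem Action.touches_of_ne {a : Action} (h : a ≠ .none) : a.touches = true := by
  cases a <;> first | rfl | exact absurd rfl h

theorem filter_touches_eq_nil {l : List Action} (h : ∀ a ∈ l, a = .none) :
    l.filter Action.touches = [] :=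
  List.filter_eq_nil_iff.2 fun a ha => by simp [h a ha, Action.touches]

theorem okCounter_append_none {t : CounterType} {b s : ℕ} {β β' : Bool} {l l' : List Action}
    (h : ∀ a ∈ l', a = .none) : okCounter t b s β β' (l ++ l') ↔ okCounter t b s β β' l := by
  rw [← okCounter_filter (l := l ++ l') fun _ => Action.touches_of_ne, List.filter_append,
    filter_touches_eq_nil h, List.append_nil, okCounter_filter fun _ => Action.touches_of_ne]

theorem okCounter_none_append {t : CounterType} {b s : ℕ} {β β' : Bool} {l l' : List Action}
    (h : ∀ a ∈ l, a = .none) : okCounter t b s β β' (l ++ l') ↔ okCounter t b s β β' l' := by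
  rw [← okCounter_filter (l := l ++ l') fun _ => Action.touches_of_ne, List.filter_append,
    filter_touches_eq_nil h, List.nil_append, okCounter_filter fun _ => Action.touches_of_ne]

theorem okB_replicate_inc {b n k : ℕ} (hn : n ≤ b) :
    okB b n (List.replicate k .inc) ↔ n + k ≤ b := by
  induction k generalizing n with
  | zero => simpa [okB]
  | succ k ih =>
    rw [List.replicate_succ, okB]
    constructor
    · rintro ⟨h1, h2⟩
      have := (ih h1).1 h2
      omega
    · intro h
      exact ⟨by omega, (ih (by omega)).2 (by omega)⟩

theorem okS_replicate_inc {s n k : ℕ} :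
    okS s true n (List.replicate k .inc) ↔ s ≤ n + k := by
  induction k generalizing n with
  | zero => simp [okS]
  | succ k ih =>
    rw [List.replicate_succ, okS, ih]
    omega

theorem filter_touches_inc {l : List Action} {ls : List (List Action)} (h : ∀ a ∈ l, a = .none)
    (h' : ∀ l' ∈ ls, ∀ a ∈ l', a = .none) :
    (l ++ (ls.map (Action.inc :: ·)).flatten).filter Action.touches =
      List.replicate ls.length .inc := by
  rw [List.filter_append, filter_touches_eq_nil h, List.nil_append]
  induction ls with
  | nil => rfl
  | cons l' ls ih =>
    rw [List.map_cons, List.flatten_cons, List.filter_append, ih fun m hm => h' m (by simp [hm]),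
      List.filter_cons_of_pos rfl, filter_touches_eq_nil (h' l' (by simp))]
    rfl

/-! ### Automata that read one block -/

/-- Nondeterministic automata with counters numbered by the natural numbers, reading nonempty
words; the last letter is read by a transition without operation on counters. -/
structure BlockAut (α : Type*) where
  State : Type
  finite_state : Finite State
  init : Set State
  step : State → α → CounterOp → State → Prop
  last : State → α → Prop

namespace BlockAut

/-- A run of the automaton from a state on a word, with the list of its operations. -/
inductive Run (A : BlockAut α) : A.State → List α → List CounterOp → Prop
  | last {q : A.State} {a : α} : A.last q a → Run A q [a] []
  | step {q q' : A.State} {a : α} {w : List α} {o : CounterOp} {os : List CounterOp} :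
      A.step q a o q' → Run A q' w os → Run A q (a :: w) (o :: os)

/-- All operations are hierarchical and touch only the counters smaller than `ℓ`. -/
def Below (A : BlockAut α) (ℓ : ℕ) : Prop :=
  ∀ q a o q', A.step q a o q' → o.IsHierarchical ∧ ∀ j ≥ ℓ, o j = .none

/-- The words accepted by `A`, with the constraints on the first `ℓ` counters. -/
def rel (A : BlockAut α) (τ : ℕ → CounterType) (ℓ : ℕ) : CostLang α := fun b s =>
  {w | ∃ q ∈ A.init, ∃ os, A.Run q w os ∧
    ∀ j < ℓ, okCounter (τ j) b s false true (os.map (· j))}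

variable {A B : BlockAut α} {τ : ℕ → CounterType} {ℓ : ℕ}

theorem Below.mono {m : ℕ} (h : A.Below ℓ) (hm : ℓ ≤ m) : A.Below m := fun q a o q' hs =>
  ⟨(h q a o q' hs).1, fun j hj => (h q a o q' hs).2 j (hm.trans hj)⟩

theorem Below.map_eq_none (h : A.Below ℓ) {q : A.State} {w : List α} {os : List CounterOp}
    (hr : A.Run q w os) {j : ℕ} (hj : ℓ ≤ j) : ∀ x ∈ os.map (· j), x = .none := by
  induction hr with
  | last _ => simp
  | step hs _ ih =>
    rw [List.map_cons]
    rintro x (_ | ⟨_, hx⟩)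
    · exact (h _ _ _ _ hs).2 j hj
    · exact ih x hx

theorem costMono_rel : CostMono (A.rel τ ℓ) := by
  rintro b b' s s' hb hs w ⟨q, hq, os, hr, hok⟩
  exact ⟨q, hq, os, hr, fun j hj => (hok j hj).mono hb hs⟩

/-- The automaton without states. -/
def zero : BlockAut α where
  State := Empty
  finite_state := inferInstance
  init := ∅
  step _ _ _ _ := False
  last _ _ := False

/-- The automaton that reads one letter. -/
def letter (a : α) : BlockAut α where
  State := Unit
  finite_state := inferInstance
  init := Set.univ
  step _ _ _ _ := False
  last _ x := x = a

theorem rel_zero : (zero : BlockAut α).rel τ ℓ = 0 := by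
  funext b s
  ext w
  exact ⟨fun ⟨q, _⟩ => q.elim, fun h => h.elim⟩

theorem rel_letter (a : α) : (letter a).rel τ 0 = fun _ _ => {w | w = [a]} := by
  funext b s
  ext w
  constructor
  · rintro ⟨q, -, os, hr, -⟩
    cases hr with
    | last h => exact congrArg (fun x => [x]) h
    | step h _ => exact h.elim
  · rintro rfl
    refine ⟨(), trivial, [], .last rfl, fun j hj => absurd hj (Nat.not_lt_zero j)⟩

/-- The disjoint union of two automata. -/
def sum (A B : BlockAut α) : BlockAut α where
  State := A.State ⊕ B.State
  finite_state := by
    have := A.finite_state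
    have := B.finite_state
    infer_instance
  init := {q | Sum.elim (· ∈ A.init) (· ∈ B.init) q}
  step
    | .inl q, a, o, .inl q' => A.step q a o q'
    | .inr q, a, o, .inr q' => B.step q a o q'
    | _, _, _, _ => False
  last
    | .inl q, a => A.last q a
    | .inr q, a => B.last q a

/-- First read a word of `A`, with `op` at its last letter, then a word of `B`. -/
def mul (A B : BlockAut α) (op : CounterOp) : BlockAut α where
  State := A.State ⊕ B.State
  finite_state := by
    have := A.finite_state
    have := B.finite_state
    infer_instance
  init := {q | Sum.elim (· ∈ A.init) (fun _ => False) q}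
  step
    | .inl q, a, o, .inl q' => A.step q a o q'
    | .inl q, a, o, .inr q' => o = op ∧ A.last q a ∧ q' ∈ B.init
    | .inr q, a, o, .inr q' => B.step q a o q'
    | .inr _, _, _, .inl _ => False
  last
    | .inl _, _ => False
    | .inr q, a => B.last q a

/-- Read several words of `A`, with `op` between consecutive words. -/
def loop (A : BlockAut α) (op : CounterOp) : BlockAut α where
  State := A.State
  finite_state := A.finite_state
  init := A.init
  step q a o q' := A.step q a o q' ∨ o = op ∧ A.last q a ∧ q' ∈ A.init
  last := A.last

theorem elim_of_run_sum {x : (A.sum B).State} {w : List α} {os : List CounterOp}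
    (h : (A.sum B).Run x w os) : Sum.elim (A.Run · w os) (B.Run · w os) x := by
  induction h with
  | @last x a h =>
    cases x with
    | inl q => exact Run.last (A := A) h
    | inr q => exact Run.last (A := B) h
  | @step x x' a w o os h _ ih =>
    cases x with
    | inl q =>
      cases x' with
      | inl q' => exact Run.step (A := A) h ih
      | inr q' => exact h.elim
    | inr q =>
      cases x' with
      | inl q' => exact h.elim
      | inr q' => exact Run.step (A := B) h ih

theorem run_sum_inl {q : A.State} {w : List α} {os : List CounterOp} :
    (A.sum B).Run (.inl q) w os ↔ A.Run q w os := by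
  refine ⟨elim_of_run_sum, fun h => ?_⟩
  induction h with
  | @last q a h => exact .last (A := A.sum B) (q := .inl q) h
  | @step q q' a w o os h _ ih => exact .step (A := A.sum B) (q := .inl q) (q' := .inl q') h ih

theorem run_sum_inr {q : B.State} {w : List α} {os : List CounterOp} :
    (A.sum B).Run (.inr q) w os ↔ B.Run q w os := by
  refine ⟨elim_of_run_sum, fun h => ?_⟩
  induction h with
  | @last q a h => exact .last (A := A.sum B) (q := .inr q) h
  | @step q q' a w o os h _ ih => exact .step (A := A.sum B) (q := .inr q) (q' := .inr q') h ih

theorem elim_of_run_mul {op : CounterOp} {x : (A.mul B op).State} {w : List α}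
    {os : List CounterOp} (h : (A.mul B op).Run x w os) :
    Sum.elim (fun q => ∃ u os₁ v os₂, ∃ q' ∈ B.init, A.Run q u os₁ ∧
      B.Run q' v os₂ ∧ w = u ++ v ∧ os = os₁ ++ op :: os₂) (B.Run · w os) x := by
  induction h with
  | @last x a h =>
    cases x with
    | inl q => exact h.elim
    | inr q => exact Run.last (A := B) h
  | @step x x' a w o os h _ ih =>
    cases x with
    | inl q =>
      cases x' with
      | inl q' =>
        obtain ⟨u, os₁, v, os₂, p, hp, h1, h2, rfl, rfl⟩ := ih
        exact ⟨a :: u, o :: os₁, v, os₂, p, hp, .step h h1, h2, rfl, rfl⟩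
      | inr q' =>
        obtain ⟨rfl, h1, h2⟩ := h
        exact ⟨[a], [], w, os, q', h2, .last h1, ih, rfl, rfl⟩
    | inr q =>
      cases x' with
      | inl q' => exact h.elim
      | inr q' => exact Run.step (A := B) h ih

theorem run_mul_inr {op : CounterOp} {q : B.State} {w : List α} {os : List CounterOp} :
    (A.mul B op).Run (.inr q) w os ↔ B.Run q w os := by
  refine ⟨elim_of_run_mul, fun h => ?_⟩
  induction h with
  | @last q a h => exact .last (A := A.mul B op) (q := .inr q) h
  | @step q q' a w o os h _ ih =>
    exact .step (A := A.mul B op) (q := .inr q) (q' := .inr q') h ih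

theorem run_mul_inl {op : CounterOp} {q : A.State} {w : List α} {os : List CounterOp} :
    (A.mul B op).Run (.inl q) w os ↔ ∃ u os₁ v os₂, ∃ q' ∈ B.init, A.Run q u os₁ ∧
      B.Run q' v os₂ ∧ w = u ++ v ∧ os = os₁ ++ op :: os₂ := by
  refine ⟨elim_of_run_mul, ?_⟩
  rintro ⟨u, os₁, v, os₂, q', hq', h, h', rfl, rfl⟩
  induction h with
  | @last q a h =>
    exact .step (A := A.mul B op) (q := .inl q) (q' := .inr q') ⟨rfl, h, hq'⟩
      (run_mul_inr.2 h')
  | @step q p a w o os h _ ih =>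
    exact .step (A := A.mul B op) (q := .inl q) (q' := .inl p) h ih

theorem run_loop_append {op : CounterOp} {q : A.State} {u : List α} {os₁ : List CounterOp}
    (h : A.Run q u os₁) {ls : List (List α × List CounterOp)}
    (hls : ∀ p ∈ ls, ∃ q ∈ A.init, A.Run q p.1 p.2) :
    (A.loop op).Run q (u ++ (ls.map Prod.fst).flatten)
      (os₁ ++ (ls.map fun p => op :: p.2).flatten) := by
  induction ls generalizing q u os₁ with
  | nil =>
    simp only [List.map_nil, List.flatten_nil, List.append_nil]
    induction h with
    | last h => exact .last (A := A.loop op) h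
    | step h _ ih => exact .step (A := A.loop op) (Or.inl h) ih
  | cons p ls ih =>
    obtain ⟨q', hq', hp⟩ := hls p (by simp)
    have h2 := ih hp fun p' hp' => hls p' (by simp [hp'])
    induction h with
    | last h => exact .step (A := A.loop op) (Or.inr ⟨rfl, h, hq'⟩) h2
    | step h _ ih' => exact .step (A := A.loop op) (Or.inl h) ih'

theorem exists_of_run_loop {op : CounterOp} {q : (A.loop op).State} {w : List α}
    {os : List CounterOp} (h : (A.loop op).Run q w os) :
    ∃ u os₁, A.Run q u os₁ ∧ ∃ ls : List (List α × List CounterOp),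
      (∀ p ∈ ls, ∃ q ∈ A.init, A.Run q p.1 p.2) ∧ w = u ++ (ls.map Prod.fst).flatten ∧
      os = os₁ ++ (ls.map fun p => op :: p.2).flatten := by
  induction h with
  | @last q a h => exact ⟨[a], [], .last h, [], by simp⟩
  | @step q q' a w o os h _ ih =>
    obtain ⟨u, os₁, h1, ls, h2, rfl, rfl⟩ := ih
    rcases h with h | ⟨rfl, h, h'⟩
    · exact ⟨a :: u, o :: os₁, .step h h1, ls, h2, rfl, rfl⟩
    · refine ⟨[a], [], .last h, (u, os₁) :: ls, ?_, rfl, rfl⟩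
      rintro p (_ | ⟨_, hp⟩)
      · exact ⟨q', h', h1⟩
      · exact h2 p hp

theorem Below.sum (hA : A.Below ℓ) (hB : B.Below ℓ) : (A.sum B).Below ℓ := by
  rintro (q | q) a o (q' | q') h
  · exact hA _ _ _ _ h
  · exact h.elim
  · exact h.elim
  · exact hB _ _ _ _ h

theorem Below.mul {op : CounterOp} (hA : A.Below ℓ) (hB : B.Below ℓ) (hop : op.IsHierarchical)
    (hop' : ∀ j ≥ ℓ, op j = .none) : (A.mul B op).Below ℓ := by
  rintro (q | q) a o (q' | q') h
  · exact hA _ _ _ _ h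
  · exact h.1 ▸ ⟨hop, hop'⟩
  · exact h.elim
  · exact hB _ _ _ _ h

theorem Below.loop {op : CounterOp} (hA : A.Below ℓ) (hop : op.IsHierarchical)
    (hop' : ∀ j ≥ ℓ, op j = .none) : (A.loop op).Below ℓ := by
  rintro q a o q' (h | ⟨rfl, -⟩)
  · exact hA _ _ _ _ h
  · exact ⟨hop, hop'⟩

theorem rel_sum : (A.sum B).rel τ ℓ = A.rel τ ℓ + B.rel τ ℓ := by
  funext b s
  ext w
  constructor
  · rintro ⟨q | q, hq, os, hr, hok⟩
    · exact Or.inl ⟨q, hq, os, run_sum_inl.1 hr, hok⟩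
    · exact Or.inr ⟨q, hq, os, run_sum_inr.1 hr, hok⟩
  · rintro (⟨q, hq, os, hr, hok⟩ | ⟨q, hq, os, hr, hok⟩)
    · exact ⟨.inl q, hq, os, run_sum_inl.2 hr, hok⟩
    · exact ⟨.inr q, hq, os, run_sum_inr.2 hr, hok⟩

/-- Between the two words exactly the counters shared by both factors are reset. A counter belonging
to one factor only is untouched by the other, and it must not be reset in between: an `S`-counter
would then be checked on a part that never increments it. -/
theorem rel_mul {m : ℕ} (hA : A.Below ℓ) (hB : B.Below m) :
    (A.mul B (opAt (min ℓ m) .none)).rel τ (max ℓ m) = A.rel τ ℓ * B.rel τ m := by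
  have key : ∀ {b s : ℕ} {q : A.State} {q' : B.State} {u v : List α} {os os' : List CounterOp},
      A.Run q u os → B.Run q' v os' →
      ((∀ j < max ℓ m, okCounter (τ j) b s false true
        ((os ++ opAt (min ℓ m) .none :: os').map (· j))) ↔
      (∀ j < ℓ, okCounter (τ j) b s false true (os.map (· j))) ∧
      ∀ j < m, okCounter (τ j) b s false true (os'.map (· j))) := by
    intro b s q q' u v os os' h h'
    have h1 : ∀ j, j < min ℓ m → (okCounter (τ j) b s false true
        ((os ++ opAt (min ℓ m) .none :: os').map (· j)) ↔
        okCounter (τ j) b s false true (os.map (· j)) ∧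
        okCounter (τ j) b s false true (os'.map (· j))) := by
      intro j hj
      rw [List.map_append, List.map_cons, opAt_of_lt hj, okCounter_append_reset]
    have h2 : ∀ j, ℓ ≤ j → (okCounter (τ j) b s false true
        ((os ++ opAt (min ℓ m) .none :: os').map (· j)) ↔
        okCounter (τ j) b s false true (os'.map (· j))) := by
      intro j hj
      rw [List.append_cons, List.map_append, List.map_append]
      refine okCounter_none_append fun x hx => ?_
      rcases List.mem_append.1 hx with hx | hx
      · exact hA.map_eq_none h hj x hx
      · simp only [List.map_cons, List.map_nil, List.mem_singleton] at hx
        rw [hx]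
        exact opAt_none_of_ge (by omega)
    have h3 : ∀ j, m ≤ j → (okCounter (τ j) b s false true
        ((os ++ opAt (min ℓ m) .none :: os').map (· j)) ↔
        okCounter (τ j) b s false true (os.map (· j))) := by
      intro j hj
      rw [List.map_append]
      refine okCounter_append_none fun x hx => ?_
      rw [List.map_cons] at hx
      rcases List.mem_cons.1 hx with rfl | hx
      · exact opAt_none_of_ge (by omega)
      · exact hB.map_eq_none h' hj x hx
    constructor
    · refine fun H => ⟨fun j hj => ?_, fun j hj => ?_⟩
      · by_cases hjm : j < m
        · exact ((h1 j (by omega)).1 (H j (by omega))).1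
        · exact (h3 j (by omega)).1 (H j (by omega))
      · by_cases hjm : j < ℓ
        · exact ((h1 j (by omega)).1 (H j (by omega))).2
        · exact (h2 j (by omega)).1 (H j (by omega))
    · rintro ⟨H, H'⟩ j hj
      by_cases hjl : j < ℓ
      · by_cases hjm : j < m
        · exact (h1 j (by omega)).2 ⟨H j hjl, H' j hjm⟩
        · exact (h3 j (by omega)).2 (H j hjl)
      · exact (h2 j (by omega)).2 (H' j (by omega))
  funext b s
  ext w
  constructor
  · rintro ⟨q | q, hq, os, hr, hok⟩
    · obtain ⟨u, os₁, v, os₂, q', hq', h1, h2, rfl, rfl⟩ := run_mul_inl.1 hr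
      obtain ⟨h3, h4⟩ := (key h1 h2).1 hok
      exact ⟨u, ⟨q, hq, os₁, h1, h3⟩, v, ⟨q', hq', os₂, h2, h4⟩, rfl⟩
    · exact hq.elim
  · rintro ⟨u, ⟨q, hq, os₁, h1, h3⟩, v, ⟨q', hq', os₂, h2, h4⟩, rfl⟩
    exact ⟨.inl q, hq, _, run_mul_inl.2 ⟨u, os₁, v, os₂, q', hq', h1, h2, rfl, rfl⟩,
      (key h1 h2).2 ⟨h3, h4⟩⟩

/-- The common part of all loops: a word of the loop is a first word followed by `ls.length` words
preceded by the loop operation, hence `ls.length + 1` factors. -/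
theorem rel_loop_of {n : ℕ} {x : Action} {P : CountCond}
    (hP : ∀ {b s : ℕ} {q : A.State} {u : List α} {os₁ : List CounterOp}
      {ls : List (List α × List CounterOp)}, A.Run q u os₁ →
      (∀ p ∈ ls, ∃ q ∈ A.init, A.Run q p.1 p.2) →
      ((∀ j < n, okCounter (τ j) b s false true
        ((os₁ ++ (ls.map fun p => opAt ℓ x :: p.2).flatten).map (· j))) ↔
      P b s (ls.length + 1) ∧ (∀ j < ℓ, okCounter (τ j) b s false true (os₁.map (· j))) ∧
      ∀ p ∈ ls, ∀ j < ℓ, okCounter (τ j) b s false true (p.2.map (· j))))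
    (hpos : ∀ b s, ¬ P b s 0) :
    (A.loop (opAt ℓ x)).rel τ n = iter P (A.rel τ ℓ) := by
  funext b s
  ext w
  constructor
  · rintro ⟨q, hq, os, hr, hok⟩
    obtain ⟨u, os₁, h1, ls, h2, rfl, rfl⟩ := exists_of_run_loop hr
    obtain ⟨h3, h4, h5⟩ := (hP h1 h2).1 hok
    refine ⟨u :: ls.map Prod.fst, rfl, ?_, by simpa using h3⟩
    rintro v (_ | ⟨_, hv⟩)
    · exact ⟨q, hq, os₁, h1, h4⟩
    · obtain ⟨p, hp, rfl⟩ := List.mem_map.1 hv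
      obtain ⟨q', hq', h6⟩ := h2 p hp
      exact ⟨q', hq', p.2, h6, h5 p hp⟩
  · rintro ⟨l, rfl, hl, hn⟩
    cases l with
    | nil => exact absurd hn (hpos _ _)
    | cons u l =>
      obtain ⟨q, hq, os₁, h1, h3⟩ := hl u (by simp)
      have : ∃ ls : List (List α × List CounterOp), ls.map Prod.fst = l ∧
          ∀ p ∈ ls, ∃ q ∈ A.init, A.Run q p.1 p.2 ∧
            ∀ j < ℓ, okCounter (τ j) b s false true (p.2.map (· j)) := by
        clear hn
        induction l with
        | nil => exact ⟨[], rfl, by simp⟩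
        | cons v l ih =>
          obtain ⟨ls, h4, h5⟩ := ih fun v' hv' => hl v' (by
            rcases List.mem_cons.1 hv' with rfl | h
            · simp
            · simp [h])
          obtain ⟨q', hq', os', h6, h7⟩ := hl v (by simp)
          refine ⟨(v, os') :: ls, by rw [List.map_cons, h4], ?_⟩
          rintro p (_ | ⟨_, hp⟩)
          · exact ⟨q', hq', h6, h7⟩
          · exact h5 p hp
      obtain ⟨ls, rfl, hls⟩ := this
      have hls' : ∀ p ∈ ls, ∃ q ∈ A.init, A.Run q p.1 p.2 := fun p hp => by
        obtain ⟨q', hq', h6, -⟩ := hls p hp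
        exact ⟨q', hq', h6⟩
      refine ⟨q, hq, _, run_loop_append h1 hls', (hP h1 hls').2
        ⟨by simpa using hn, h3, fun p hp => ?_⟩⟩
      obtain ⟨q', -, -, h7⟩ := hls p hp
      exact h7

theorem okCounter_loop_of_lt {b s j : ℕ} {x : Action} {os₁ : List CounterOp} (hj : j < ℓ)
    {ls : List (List α × List CounterOp)} :
    okCounter (τ j) b s false true
        ((os₁ ++ (ls.map fun p => opAt ℓ x :: p.2).flatten).map (· j)) ↔
      okCounter (τ j) b s false true (os₁.map (· j)) ∧
        ∀ p ∈ ls, okCounter (τ j) b s false true (p.2.map (· j)) := by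
  have := okCounter_append_reset_flatten (t := τ j) (b := b) (s := s) (l := os₁.map (· j))
    (ls := ls.map fun p => p.2.map (· j))
  rw [List.map_append, List.map_flatten, List.map_map]
  rw [List.map_map] at this
  simp only [List.mem_map, forall_exists_index, and_imp, forall_apply_eq_imp_iff₂] at this
  rw [← this]
  have e : (List.map (fun o : CounterOp => o j) ∘ fun p : List α × List CounterOp =>
      opAt ℓ x :: p.2) = ((fun l => Action.reset :: l) ∘ fun p => p.2.map (· j)) := by
    funext p
    simp [opAt_of_lt hj]
  rw [e]

theorem rel_loop_none : (A.loop (opAt ℓ .none)).rel τ ℓ = iter posCount (A.rel τ ℓ) := by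
  refine rel_loop_of (fun {b s q u os₁ ls} _ _ => ?_) fun _ _ h => absurd h (by simp [posCount])
  constructor
  · exact fun h => ⟨Nat.succ_pos _, fun j hj => ((okCounter_loop_of_lt hj).1 (h j hj)).1,
      fun p hp j hj => ((okCounter_loop_of_lt hj).1 (h j hj)).2 p hp⟩
  · exact fun h j hj => (okCounter_loop_of_lt hj).2 ⟨h.2.1 j hj, fun p hp => h.2.2 p hp j hj⟩

/-- The body does not touch counter `ℓ`, which therefore counts the passages from one factor to the
next; `k` increments separate `k + 1` factors. This explains the shifts by one in `posAtMost` and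
`posAtLeast`. -/
theorem rel_loop_inc {P : CountCond} (hA : A.Below ℓ) (hP : ∀ b s k,
    okCounter (τ ℓ) b s false true (List.replicate k .inc) ↔ P b s (k + 1))
    (hpos : ∀ b s, ¬ P b s 0) :
    (A.loop (opAt ℓ .inc)).rel τ (ℓ + 1) = iter P (A.rel τ ℓ) := by
  refine rel_loop_of (fun {b s q u os₁ ls} h1 h2 => ?_) hpos
  have key : okCounter (τ ℓ) b s false true
      ((os₁ ++ (ls.map fun p => opAt ℓ .inc :: p.2).flatten).map (· ℓ)) ↔
      P b s (ls.length + 1) := by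
    rw [← hP, ← okCounter_filter fun _ => Action.touches_of_ne]
    have := filter_touches_inc (l := os₁.map (· ℓ)) (ls := ls.map fun p => p.2.map (· ℓ))
      (hA.map_eq_none h1 le_rfl) (fun l' hl' => by
        obtain ⟨p, hp, rfl⟩ := List.mem_map.1 hl'
        obtain ⟨q', -, h3⟩ := h2 p hp
        exact hA.map_eq_none h3 le_rfl)
    rw [List.length_map, List.map_map] at this
    rw [← this, List.map_append, List.map_flatten, List.map_map]
    have e : (List.map (fun o : CounterOp => o ℓ) ∘ fun p : List α × List CounterOp =>
        opAt ℓ .inc :: p.2) = ((fun l => Action.inc :: l) ∘ fun p => p.2.map (· ℓ)) := by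
      funext p
      simp [opAt_self]
    rw [e]
  constructor
  · exact fun h => ⟨key.1 (h ℓ (Nat.lt_succ_self _)),
      fun j hj => ((okCounter_loop_of_lt hj).1 (h j (by omega))).1,
      fun p hp j hj => ((okCounter_loop_of_lt hj).1 (h j (by omega))).2 p hp⟩
  · intro h j hj
    rcases Nat.lt_succ_iff_lt_or_eq.1 hj with hj | rfl
    · exact (okCounter_loop_of_lt hj).2 ⟨h.2.1 j hj, fun p hp => h.2.2 p hp j hj⟩
    · exact key.2 h.1

theorem rel_loop_inc_B (hA : A.Below ℓ) (hτ : τ ℓ = .B) :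
    (A.loop (opAt ℓ .inc)).rel τ (ℓ + 1) = iter posAtMost (A.rel τ ℓ) := by
  refine rel_loop_inc hA (fun b s k => ?_) fun _ _ h => absurd h.1 (by simp)
  rw [hτ]
  refine (okB_replicate_inc (Nat.zero_le b)).trans ?_
  simp [posAtMost]

theorem rel_loop_inc_S (hA : A.Below ℓ) (hτ : τ ℓ = .S) :
    (A.loop (opAt ℓ .inc)).rel τ (ℓ + 1) = iter posAtLeast (A.rel τ ℓ) := by
  refine rel_loop_inc hA (fun b s k => ?_) fun _ _ h => absurd h (by simp [posAtLeast])
  rw [hτ]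
  refine okS_replicate_inc.trans ?_
  simp [posAtLeast, startVal]

/-- An idle counter of type `B` satisfies every bound. The analogous statement for type `S` fails,
as the value would remain zero; this is the reason for the grades. -/
theorem rel_succ (hA : A.Below ℓ) (hτ : τ ℓ = .B) : A.rel τ (ℓ + 1) = A.rel τ ℓ := by
  funext b s
  ext w
  refine exists_congr fun q => and_congr Iff.rfl (exists_congr fun os =>
    and_congr_right fun hr => ⟨fun h j hj => h j (by omega), fun h j hj => ?_⟩)
  rcases Nat.lt_succ_iff_lt_or_eq.1 hj with hj | rfl
  · exact h j hj
  · have := okCounter_none_append (t := τ j) (b := b) (s := s) (β := false) (β' := true) (l' := [])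
      (hA.map_eq_none hr le_rfl)
    rw [List.append_nil] at this
    rw [this, hτ]
    trivial

end BlockAut

/-! ### Languages accepted by block automata -/

/-- The language with constraints is accepted by a block automaton with `ℓ` counters. -/
def IsBlockLang (τ : ℕ → CounterType) (ℓ : ℕ) (R : CostLang α) : Prop :=
  ∃ A : BlockAut α, A.Below ℓ ∧ A.rel τ ℓ = R

section

variable {τ : ℕ → CounterType} {ℓ m : ℕ} {R R' : CostLang α}

theorem IsBlockLang.costMono (h : IsBlockLang τ ℓ R) : CostMono R := by
  obtain ⟨A, -, rfl⟩ := h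
  exact BlockAut.costMono_rel

theorem IsBlockLang.zero : IsBlockLang τ ℓ (0 : CostLang α) :=
  ⟨.zero, fun q => q.elim, BlockAut.rel_zero⟩

theorem IsBlockLang.letter (a : α) : IsBlockLang τ 0 (BSExpr.letter a).val :=
  ⟨.letter a, fun _ _ _ _ h => h.elim, BlockAut.rel_letter a⟩

theorem IsBlockLang.add (h : IsBlockLang τ ℓ R) (h' : IsBlockLang τ ℓ R') :
    IsBlockLang τ ℓ (R + R') := by
  obtain ⟨A, hA, rfl⟩ := h
  obtain ⟨B, hB, rfl⟩ := h'
  exact ⟨A.sum B, hA.sum hB, BlockAut.rel_sum⟩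

theorem IsBlockLang.mul (h : IsBlockLang τ ℓ R) (h' : IsBlockLang τ m R') :
    IsBlockLang τ (max ℓ m) (R * R') := by
  obtain ⟨A, hA, rfl⟩ := h
  obtain ⟨B, hB, rfl⟩ := h'
  exact ⟨A.mul B (opAt (min ℓ m) .none), (hA.mono (le_max_left _ _)).mul
    (hB.mono (le_max_right _ _)) (isHierarchical_opAt _ _)
    fun j hj => opAt_none_of_ge (by omega), BlockAut.rel_mul hA hB⟩

theorem IsBlockLang.pos (h : IsBlockLang τ ℓ R) : IsBlockLang τ ℓ (iter posCount R) := by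
  obtain ⟨A, hA, rfl⟩ := h
  exact ⟨A.loop (opAt ℓ .none), hA.loop (isHierarchical_opAt _ _)
    fun j hj => opAt_none_of_ge hj, BlockAut.rel_loop_none⟩

theorem IsBlockLang.posAtMost (h : IsBlockLang τ ℓ R) (hτ : τ ℓ = .B) :
    IsBlockLang τ (ℓ + 1) (iter posAtMost R) := by
  obtain ⟨A, hA, rfl⟩ := h
  exact ⟨A.loop (opAt ℓ .inc), (hA.mono (Nat.le_succ _)).loop (isHierarchical_opAt _ _)
    fun j hj => opAt_of_gt hj, BlockAut.rel_loop_inc_B hA hτ⟩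

theorem IsBlockLang.posAtLeast (h : IsBlockLang τ ℓ R) (hτ : τ ℓ = .S) :
    IsBlockLang τ (ℓ + 1) (iter posAtLeast R) := by
  obtain ⟨A, hA, rfl⟩ := h
  exact ⟨A.loop (opAt ℓ .inc), (hA.mono (Nat.le_succ _)).loop (isHierarchical_opAt _ _)
    fun j hj => opAt_of_gt hj, BlockAut.rel_loop_inc_S hA hτ⟩

theorem IsBlockLang.weaken (h : IsBlockLang τ ℓ R) (hτ : τ ℓ = .B) :
    IsBlockLang τ (ℓ + 1) R := by
  obtain ⟨A, hA, rfl⟩ := h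
  exact ⟨A, hA.mono (Nat.le_succ _), BlockAut.rel_succ hA hτ⟩

end

end OmegaBS

/-! ### Iteration of sums, and sums of languages graded by the number of `S`-counters. -/

namespace OmegaBS

open Filter

variable {α : Type*}

/-! ### Iterating a sum -/

theorem exists_map_eq_of_forall {β γ : Type*} {f : β → γ} {p : β → Prop} {l : List γ}
    (h : ∀ u ∈ l, ∃ a, p a ∧ f a = u) : ∃ l' : List β, l'.map f = l ∧ ∀ a ∈ l', p a := by
  induction l with
  | nil => exact ⟨[], rfl, by simp⟩
  | cons u l ih =>
    obtain ⟨a, ha, rfl⟩ := h u (by simp)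
    obtain ⟨l', rfl, hl'⟩ := ih fun v hv => h v (List.mem_cons_of_mem _ hv)
    exact ⟨a :: l', rfl, by simpa using ⟨ha, hl'⟩⟩

theorem length_flatten_le {β : Type*} {ls : List (List β)} {m : ℕ} (h : ∀ l ∈ ls, l.length ≤ m) :
    ls.flatten.length ≤ ls.length * m := by
  induction ls with
  | nil => simp
  | cons l ls ih =>
    have h1 := h l (by simp)
    have h2 := ih fun l' hl' => h l' (List.mem_cons_of_mem _ hl')
    simp only [List.flatten_cons, List.length_append, List.length_cons, Nat.succ_mul]
    omega

theorem length_le_length_flatten {β : Type*} {ls : List (List β)} (h : ∀ l ∈ ls, l ≠ []) :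
    ls.length ≤ ls.flatten.length := by
  induction ls with
  | nil => simp
  | cons l ls ih =>
    have h1 := List.length_pos_of_ne_nil (h l (by simp))
    have h2 := ih fun l' hl' => h l' (List.mem_cons_of_mem _ hl')
    simp only [List.flatten_cons, List.length_append, List.length_cons]
    omega

section

variable {X Y R : CostLang α} {P P' : CountCond} {b s : ℕ} {w : List α}

/-- A list of words that starts with a word of `Y`, followed by words of `X` whose number
satisfies `P` unless it is zero. -/
def IsHeaded (P : CountCond) (X Y : CostLang α) (b s : ℕ) (l : List (List α)) : Prop :=
  ∃ y xs, l = y :: xs ∧ y ∈ Y b s ∧ (∀ u ∈ xs, u ∈ X b s) ∧ (xs = [] ∨ P b s xs.length)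

theorem mem_one_add_iter : w ∈ (1 + iter P X) b s ↔ ∃ l : List (List α), l.flatten = w ∧
    (∀ u ∈ l, u ∈ X b s) ∧ (l = [] ∨ P b s l.length) := by
  constructor
  · rintro (h | ⟨l, rfl, hl, hn⟩)
    · exact ⟨[], (mem_one_apply.1 h).symm, by simp, Or.inl rfl⟩
    · exact ⟨l, rfl, hl, Or.inr hn⟩
  · rintro ⟨l, rfl, hl, rfl | hn⟩
    · exact Or.inl rfl
    · exact Or.inr ⟨l, rfl, hl, hn⟩

theorem mem_one_add_iter_mul : w ∈ ((1 + iter P X) * iter P' (Y * (1 + iter P X)) : CostLang α) b s ↔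
    ∃ (l₀ : List (List α)) (ls : List (List (List α))), (l₀ ++ ls.flatten).flatten = w ∧ (∀ u ∈ l₀, u ∈ X b s) ∧
      (l₀ = [] ∨ P b s l₀.length) ∧ (∀ l ∈ ls, IsHeaded P X Y b s l) ∧ P' b s ls.length := by
  constructor
  · rintro ⟨u, hu, v, ⟨l, rfl, hl, hn⟩, rfl⟩
    obtain ⟨l₀, rfl, h0, h0'⟩ := mem_one_add_iter.1 hu
    have : ∀ v ∈ l, ∃ L, IsHeaded P X Y b s L ∧ List.flatten L = v := by
      intro v hv
      obtain ⟨y, hy, v', hv', rfl⟩ := hl v hv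
      obtain ⟨xs, rfl, hxs, hxs'⟩ := mem_one_add_iter.1 hv'
      exact ⟨y :: xs, ⟨y, xs, rfl, hy, hxs, hxs'⟩, rfl⟩
    obtain ⟨ls, rfl, hls⟩ := exists_map_eq_of_forall this
    rw [List.length_map] at hn
    exact ⟨l₀, ls, by rw [List.flatten_append, List.flatten_flatten], h0, h0', hls, hn⟩
  · rintro ⟨l₀, ls, rfl, h0, h0', hls, hn⟩
    refine ⟨l₀.flatten, mem_one_add_iter.2 ⟨l₀, rfl, h0, h0'⟩, ls.flatten.flatten,
      ⟨ls.map List.flatten, List.flatten_flatten.symm, fun v hv => ?_, by rwa [List.length_map]⟩,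
      by rw [List.flatten_append]⟩
    obtain ⟨l, hl, rfl⟩ := List.mem_map.1 hv
    obtain ⟨y, xs, rfl, hy, hxs, hxs'⟩ := hls l hl
    exact ⟨y, hy, xs.flatten, mem_one_add_iter.2 ⟨xs, rfl, hxs, hxs'⟩, rfl⟩

/-- The list is cut in front of each word that is taken from `Y`. -/
theorem exists_headed (hP : ∀ k, 1 ≤ k → P b s k) {l : List (List α)}
    (hl : ∀ u ∈ l, u ∈ (X + Y) b s) : ∃ l₀ ls, l = l₀ ++ List.flatten ls ∧
      (∀ u ∈ l₀, u ∈ X b s) ∧ ∀ l ∈ ls, IsHeaded P X Y b s l := by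
  induction l with
  | nil => exact ⟨[], [], rfl, by simp, by simp⟩
  | cons u l ih =>
    obtain ⟨l₀, ls, rfl, h0, hls⟩ := ih fun v hv => hl v (List.mem_cons_of_mem _ hv)
    rcases hl u (by simp) with hu | hu
    · exact ⟨u :: l₀, ls, rfl, by simpa using ⟨hu, h0⟩, hls⟩
    · refine ⟨[], (u :: l₀) :: ls, rfl, by simp, ?_⟩
      rintro l (_ | ⟨_, hl⟩)
      · refine ⟨u, l₀, rfl, hu, h0, l₀.eq_nil_or_concat.imp id fun h => hP _ ?_⟩
        obtain ⟨a, c, rfl⟩ := h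
        simp
      · exact hls l hl

theorem IsHeaded.mem_add {l : List (List α)} (h : IsHeaded P X Y b s l) :
    ∀ u ∈ l, u ∈ (X + Y) b s := by
  obtain ⟨y, xs, rfl, hy, hxs, -⟩ := h
  rintro u (_ | ⟨_, hu⟩)
  · exact Or.inr hy
  · exact Or.inl (hxs u hu)

theorem mem_add_of_headed {l₀ : List (List α)} {ls : List (List (List α))}
    (h0 : ∀ u ∈ l₀, u ∈ X b s) (hls : ∀ l ∈ ls, IsHeaded P X Y b s l) :
    ∀ u ∈ l₀ ++ ls.flatten, u ∈ (X + Y) b s := by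
  intro u hu
  rcases List.mem_append.1 hu with hu | hu
  · exact Or.inl (h0 u hu)
  · obtain ⟨l, hl, hu⟩ := List.mem_flatten.1 hu
    exact (hls l hl).mem_add u hu

theorem IsHeaded.ne_nil {l : List (List α)} (h : IsHeaded P X Y b s l) : l ≠ [] := by
  obtain ⟨y, xs, rfl, -⟩ := h
  simp

theorem iter_zero (hpos : ∀ b s, ¬ P b s 0) : iter P (0 : CostLang α) = 0 := by
  funext b s
  ext w
  constructor
  · rintro ⟨l, -, hl, hn⟩
    cases l with
    | nil => exact absurd hn (hpos b s)
    | cons u l => exact (hl u (by simp)).elim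
  · exact fun h => h.elim

/-- The identity `(X + Y)⁺ = X⁺ + X* (Y X*)⁺`. In the second summand every iterated factor contains
a word of `Y`; when `Y` uses more counters than `X`, this factor uses all of them. -/
theorem represents_pos_add (hX : CostMono X) (hY : CostMono Y) :
    Represents (iter posCount X + (1 + iter posCount X) * iter posCount (Y * (1 + iter posCount X)))
      (iter posCount (X + Y)) := by
  have hp := hX.iter countMono_posCount
  refine ⟨hp.add ((CostMono.one.add hp).mul
    ((hY.mul (CostMono.one.add hp)).iter countMono_posCount)),
    (hX.add hY).iter countMono_posCount, fun b => ⟨b, fun s w hw => ?_⟩,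
    fun b => ⟨b, fun s => ⟨s, fun w hw => ?_⟩⟩⟩
  · rcases hw with ⟨l, rfl, hl, hn⟩ | hw
    · exact ⟨l, rfl, fun u hu => Or.inl (hl u hu), hn⟩
    · obtain ⟨l₀, ls, rfl, h0, -, hls, hn⟩ := mem_one_add_iter_mul.1 hw
      refine ⟨_, rfl, mem_add_of_headed h0 hls, ?_⟩
      have := length_le_length_flatten fun l hl => (hls l hl).ne_nil
      have hn : 1 ≤ ls.length := hn
      simp only [posCount, List.length_append]
      omega
  · obtain ⟨l, rfl, hl, hn⟩ := hw
    obtain ⟨l₀, ls, rfl, h0, hls⟩ := exists_headed (P := posCount) (fun k hk => hk) hl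
    cases ls with
    | nil =>
      rw [List.flatten_nil, List.append_nil] at hn ⊢
      exact Or.inl ⟨l₀, rfl, h0, hn⟩
    | cons l ls =>
      refine Or.inr (mem_one_add_iter_mul.2 ⟨l₀, l :: ls, rfl, h0, ?_, hls, ?_⟩)
      · exact l₀.length.eq_zero_or_pos.imp List.length_eq_zero_iff.1 id
      · simp [posCount]

theorem represents_posAtMost_add (hX : CostMono X) (hY : CostMono Y) :
    Represents (iter posAtMost X +
      (1 + iter posAtMost X) * iter posAtMost (Y * (1 + iter posAtMost X)))
      (iter posAtMost (X + Y)) := by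
  have hp := hX.iter countMono_posAtMost
  refine ⟨hp.add ((CostMono.one.add hp).mul
    ((hY.mul (CostMono.one.add hp)).iter countMono_posAtMost)),
    (hX.add hY).iter countMono_posAtMost, fun b => ⟨(b + 1) + (b + 1) * (b + 2), fun s w hw => ?_⟩,
    fun b => ⟨b, fun s => ⟨s, fun w hw => ?_⟩⟩⟩
  · have hb : b ≤ (b + 1) + (b + 1) * (b + 2) := by omega
    rcases hw with ⟨l, rfl, hl, hn⟩ | hw
    · exact ⟨l, rfl, fun u hu => Or.inl (hX hb le_rfl u (hl u hu)),
        countMono_posAtMost hb le_rfl hn⟩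
    · obtain ⟨l₀, ls, rfl, h0, h0', hls, hn⟩ := mem_one_add_iter_mul.1 hw
      refine ⟨_, rfl, fun u hu => (hX.add hY) hb le_rfl u (mem_add_of_headed h0 hls u hu), ?_⟩
      have h1 := length_le_length_flatten fun l hl => (hls l hl).ne_nil
      have h2 : ls.flatten.length ≤ ls.length * (b + 2) := by
        refine length_flatten_le fun l hl => ?_
        obtain ⟨y, xs, rfl, -, -, rfl | h⟩ := hls l hl
        · simp
        · have := h.2
          simp only [List.length_cons]
          omega
      have h3 : ls.length * (b + 2) ≤ (b + 1) * (b + 2) := Nat.mul_le_mul_right _ hn.2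
      have h4 : l₀.length ≤ b + 1 := by
        rcases h0' with rfl | h
        · simp
        · exact h.2
      have h5 := hn.1
      simp only [posAtMost, List.length_append]
      omega
  · obtain ⟨l, rfl, hl, hn⟩ := hw
    have hl' : ∃ l₀ ls, l = l₀ ++ List.flatten ls ∧ (∀ u ∈ l₀, u ∈ X b s) ∧
        ∀ l ∈ ls, IsHeaded posCount X Y b s l := exists_headed (fun k hk => hk) hl
    obtain ⟨l₀, ls, rfl, h0, hls⟩ := hl'
    have h1 := length_le_length_flatten fun l hl => (hls l hl).ne_nil
    have h2 : (l₀ ++ ls.flatten).length = l₀.length + ls.flatten.length := List.length_append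
    have h3 := hn.2
    cases ls with
    | nil =>
      rw [List.flatten_nil, List.append_nil] at hn ⊢
      exact Or.inl ⟨l₀, rfl, h0, hn⟩
    | cons l ls =>
      refine Or.inr (mem_one_add_iter_mul.2 ⟨l₀, l :: ls, rfl, h0, ?_, fun L hL => ?_, ?_⟩)
      · exact l₀.length.eq_zero_or_pos.imp List.length_eq_zero_iff.1 fun h => ⟨h, by omega⟩
      · have hle : L.length ≤ (l :: ls).flatten.length := by
          rw [List.length_flatten]
          exact List.le_sum_of_mem (List.mem_map_of_mem hL)
        obtain ⟨y, xs, rfl, hy, hxs, h⟩ := hls L hL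
        rw [List.length_cons] at hle
        exact ⟨y, xs, rfl, hy, hxs, h.imp id fun h => ⟨h, by omega⟩⟩
      · exact ⟨by simp, by omega⟩

/-- A long list contains many words of `Y` or a long run of consecutive words of `X`. With at most
`s` words of `Y` and at most `s` words in each run of `X`, its length is at most `s + s * (s + 1)`,
whence the threshold. -/
theorem represents_posAtLeast_add (hX : CostMono X) (hY : CostMono Y) :
    Represents ((1 + iter posCount (X + Y)) * iter posAtLeast X * (1 + iter posCount (X + Y)) +
      (1 + iter posCount X) * iter posAtLeast (Y * (1 + iter posCount X)))
      (iter posAtLeast (X + Y)) := by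
  have hp := CostMono.one.add (hX.iter countMono_posCount)
  have hq := CostMono.one.add ((hX.add hY).iter countMono_posCount)
  refine ⟨((hq.mul (hX.iter countMono_posAtLeast)).mul hq).add (hp.mul
    ((hY.mul hp).iter countMono_posAtLeast)),
    (hX.add hY).iter countMono_posAtLeast, fun b => ⟨b, fun s w hw => ?_⟩,
    fun b => ⟨b, fun s => ⟨s + s * (s + 1), fun w hw => ?_⟩⟩⟩
  · rcases hw with ⟨_, ⟨u, hu, v, ⟨l, rfl, hl, hn⟩, rfl⟩, t, ht, rfl⟩ | hw
    · obtain ⟨l₁, rfl, h1, -⟩ := mem_one_add_iter.1 hu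
      obtain ⟨l₂, rfl, h2, -⟩ := mem_one_add_iter.1 ht
      refine ⟨l₁ ++ l ++ l₂, by simp, fun u hu => ?_, ?_⟩
      · rcases List.mem_append.1 hu with hu | hu
        · exact (List.mem_append.1 hu).elim (h1 u) fun hu => Or.inl (hl u hu)
        · exact h2 u hu
      · have hn : s + 1 ≤ l.length := hn
        simp only [posAtLeast, List.length_append]
        omega
    · obtain ⟨l₀, ls, rfl, h0, -, hls, hn⟩ := mem_one_add_iter_mul.1 hw
      refine ⟨_, rfl, mem_add_of_headed h0 hls, ?_⟩
      have := length_le_length_flatten fun l hl => (hls l hl).ne_nil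
      have hn : s + 1 ≤ ls.length := hn
      simp only [posAtLeast, List.length_append]
      omega
  · obtain ⟨l, rfl, hl, hn⟩ := hw
    obtain ⟨l₀, ls, rfl, h0, hls⟩ := exists_headed (b := b) (s := s) (P := posCount)
      (fun k hk => hk) fun u hu => (hX.add hY) le_rfl (Nat.le_add_right _ _) u (hl u hu)
    have hq' : ∀ l : List (List α), (∀ u ∈ l, u ∈ (X + Y) b s) →
        l.flatten ∈ (1 + iter posCount (X + Y)) b s := fun l hl =>
      mem_one_add_iter.2 ⟨l, rfl, hl, l.length.eq_zero_or_pos.imp List.length_eq_zero_iff.1 id⟩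
    by_cases h1 : s + 1 ≤ ls.length
    · exact Or.inr (mem_one_add_iter_mul.2 ⟨l₀, ls, rfl, h0,
        l₀.length.eq_zero_or_pos.imp List.length_eq_zero_iff.1 id, hls, h1⟩)
    left
    by_cases h2 : s + 1 ≤ l₀.length
    · refine ⟨l₀.flatten, ⟨[], Or.inl rfl, l₀.flatten, ⟨l₀, rfl, h0, h2⟩, rfl⟩, ls.flatten.flatten,
        hq' _ (mem_add_of_headed (l₀ := []) (by simp) hls), by simp⟩
    by_cases h3 : ∃ l ∈ ls, s + 2 ≤ l.length
    · obtain ⟨l, hl', h3⟩ := h3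
      obtain ⟨ls₁, ls₂, rfl⟩ := List.append_of_mem hl'
      obtain ⟨y, xs, rfl, hy, hxs, -⟩ := hls l hl'
      refine ⟨(l₀ ++ ls₁.flatten ++ [y]).flatten ++ xs.flatten, ⟨_, hq' _ ?_, xs.flatten,
        ⟨xs, rfl, hxs, ?_⟩, rfl⟩, ls₂.flatten.flatten, hq' _ ?_, by simp⟩
      · intro u hu
        rcases List.mem_append.1 hu with hu | hu
        · exact mem_add_of_headed h0 (fun l hl => hls l (by simp [hl])) u hu
        · rw [List.mem_singleton.1 hu]
          exact Or.inr hy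
      · simp only [List.length_cons] at h3
        simp only [posAtLeast]
        omega
      · exact mem_add_of_headed (l₀ := []) (by simp) fun l hl => hls l (by simp [hl])
    · exfalso
      push Not at h3
      have h4 := length_flatten_le (m := s + 1) fun l hl => by have := h3 l hl; omega
      have h5 : ls.length * (s + 1) ≤ s * (s + 1) := Nat.mul_le_mul_right _ (by omega)
      have hn : s + s * (s + 1) + 1 ≤ (l₀ ++ ls.flatten).length := hn
      rw [List.length_append] at hn
      omega

end

/-! ### Languages represented by block automata -/

/-- The language is represented by one accepted by a block automaton with `ℓ` counters. -/
def Realizable (τ : ℕ → CounterType) (ℓ : ℕ) (R : CostLang α) : Prop :=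
  ∃ X, IsBlockLang τ ℓ X ∧ Represents X R

namespace Realizable

variable {τ : ℕ → CounterType} {ℓ m : ℕ} {R R' : CostLang α}

theorem of_represents (h : Realizable τ ℓ R) (h' : Represents R R') : Realizable τ ℓ R' := by
  obtain ⟨X, hX, hr⟩ := h
  exact ⟨X, hX, hr.trans h'⟩

theorem of_isBlockLang (h : IsBlockLang τ ℓ R) : Realizable τ ℓ R :=
  ⟨R, h, .refl h.costMono⟩

theorem costMono (h : Realizable τ ℓ R) : CostMono R := by
  obtain ⟨X, -, hr⟩ := h
  exact hr.mono_right

theorem zero : Realizable τ ℓ (0 : CostLang α) := of_isBlockLang .zero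

theorem add (h : Realizable τ ℓ R) (h' : Realizable τ ℓ R') : Realizable τ ℓ (R + R') := by
  obtain ⟨X, hX, hr⟩ := h
  obtain ⟨X', hX', hr'⟩ := h'
  exact ⟨X + X', hX.add hX', hr.add hr'⟩

theorem mul (h : Realizable τ ℓ R) (h' : Realizable τ m R') :
    Realizable τ (max ℓ m) (R * R') := by
  obtain ⟨X, hX, hr⟩ := h
  obtain ⟨X', hX', hr'⟩ := h'
  exact ⟨X * X', hX.mul hX', hr.mul hr'⟩

theorem pos (h : Realizable τ ℓ R) : Realizable τ ℓ (iter posCount R) := by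
  obtain ⟨X, hX, hr⟩ := h
  exact ⟨_, hX.pos, hr.iter countMono_posCount⟩

theorem posAtMost (h : Realizable τ ℓ R) (hτ : τ ℓ = .B) :
    Realizable τ (ℓ + 1) (iter posAtMost R) := by
  obtain ⟨X, hX, hr⟩ := h
  exact ⟨_, hX.posAtMost hτ, hr.iter countMono_posAtMost⟩

theorem posAtLeast (h : Realizable τ ℓ R) (hτ : τ ℓ = .S) :
    Realizable τ (ℓ + 1) (iter posAtLeast R) := by
  obtain ⟨X, hX, hr⟩ := h
  exact ⟨_, hX.posAtLeast hτ, hr.iter countMono_posAtLeast⟩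

theorem weaken (h : Realizable τ ℓ R) (hτ : τ ℓ = .B) : Realizable τ (ℓ + 1) R := by
  obtain ⟨X, hX, hr⟩ := h
  exact ⟨_, hX.weaken hτ, hr⟩

end Realizable

/-! ### Grades -/

/-- Counters are arranged in groups of `M` counters of type `B` and one of type `S`. -/
def groupType (M : ℕ) : ℕ → CounterType := fun ℓ => if ℓ % (M + 1) = M then .S else .B

/-- The number of counters in `k` groups and `d` further counters. -/
def level (M k d : ℕ) : ℕ := k * (M + 1) + d

theorem groupType_level_of_lt {M k d : ℕ} (h : d < M) : groupType M (level M k d) = .B := by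
  have : level M k d % (M + 1) = d := by
    rw [level, Nat.mul_add_mod', Nat.mod_eq_of_lt (by omega)]
  rw [groupType, this, if_neg (by omega)]

theorem groupType_level_self (M k : ℕ) : groupType M (level M k M) = .S := by
  have : level M k M % (M + 1) = M := by
    rw [level, Nat.mul_add_mod', Nat.mod_eq_of_lt (by omega)]
  rw [groupType, this, if_pos rfl]

theorem level_self_succ (M k : ℕ) : level M k M + 1 = level M (k + 1) 0 := by
  simp only [level, Nat.succ_mul]
  omega

theorem level_le_level_succ_zero {M d : ℕ} (k : ℕ) (hd : d ≤ M) :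
    level M k d ≤ level M (k + 1) 0 := by
  simp only [level, Nat.succ_mul]
  omega

theorem level_mono {M k d d' : ℕ} (hd : d ≤ d') : level M k d ≤ level M k d' :=
  Nat.add_le_add_left hd _

section

variable {M d k : ℕ} {R R' X : CostLang α}

theorem Realizable.weaken_level {d' : ℕ} (h : Realizable (groupType M) (level M k d) R)
    (hd : d ≤ d') (hd' : d' ≤ M) : Realizable (groupType M) (level M k d') R := by
  induction d', hd using Nat.le_induction with
  | base => exact h
  | succ d' hd ih => exact (ih (by omega)).weaken (groupType_level_of_lt (by omega))

/-- Idle `B`-counters fill the current group, its `S`-counter counts the loop, and `d` idle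
`B`-counters of the next group restore the offset `d`. -/
theorem Realizable.posAtLeast_level (h : Realizable (groupType M) (level M k d) R)
    (hd : d ≤ M) : Realizable (groupType M) (level M (k + 1) d) (iter OmegaBS.posAtLeast R) := by
  have h1 := (h.weaken_level hd le_rfl).posAtLeast (groupType_level_self M k)
  rw [level_self_succ] at h1
  exact h1.weaken_level (Nat.zero_le d) hd

/-- Sums of languages that are realized with `d`, `level M 1 d`, …, `level M (k - 1) d`
counters. -/
def Graded (M d : ℕ) : ℕ → CostLang α → Prop
  | 0, R => Represents 0 R
  | k + 1, R => ∃ X Y, Graded M d k X ∧ Realizable (groupType M) (level M k d) Y ∧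
      Represents (X + Y) R

namespace Graded

theorem of_represents (h : Graded M d k R) (h' : Represents R R') : Graded M d k R' := by
  cases k with
  | zero => exact Represents.trans h h'
  | succ k =>
    obtain ⟨X, Y, hX, hY, hr⟩ := h
    exact ⟨X, Y, hX, hY, hr.trans h'⟩

theorem costMono (h : Graded M d k R) : CostMono R := by
  cases k with
  | zero => exact Represents.mono_right h
  | succ k =>
    obtain ⟨X, Y, -, -, hr⟩ := h
    exact hr.mono_right

theorem lift (h : Graded M d k R) : Graded M d (k + 1) R :=
  ⟨R, 0, h, .zero, by rw [add_zero]; exact .refl h.costMono⟩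

theorem lift_le {k' : ℕ} (h : Graded M d k R) (hk : k ≤ k') : Graded M d k' R := by
  induction k', hk using Nat.le_induction with
  | base => exact h
  | succ k' _ ih => exact ih.lift

theorem zero : Graded M d k (0 : CostLang α) :=
  lift_le (k := 0) (Represents.refl CostMono.zero) (Nat.zero_le k)

theorem of_realizable (h : Realizable (groupType M) (level M k d) R) : Graded M d (k + 1) R :=
  ⟨0, R, zero, h, by rw [zero_add]; exact .refl h.costMono⟩

theorem add (h : Graded M d k R) (h' : Graded M d k R') : Graded M d k (R + R') := by
  induction k generalizing R R' with
  | zero =>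
    have := Represents.add h h'
    rwa [add_zero] at this
  | succ k ih =>
    obtain ⟨X, Y, hX, hY, hr⟩ := h
    obtain ⟨X', Y', hX', hY', hr'⟩ := h'
    have := hr.add hr'
    rw [add_add_add_comm] at this
    exact ⟨_, _, ih hX hX', hY.add hY', this⟩

/-- A product uses the larger of the two numbers of counters, and an `S`-counter need only be served
by one factor. Hence pieces of lower grade are absorbed by a factor that uses at least as many
counters. -/
theorem mul_realizable {m : ℕ} (h : Graded M d k X) (hd : d ≤ M) (hm : level M k 0 ≤ m)
    (h' : Realizable (groupType M) m R) :
    Realizable (groupType M) m (X * R) ∧ Realizable (groupType M) m (R * X) := by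
  induction k generalizing X with
  | zero =>
    have h1 := Represents.mul h (.refl h'.costMono)
    have h2 := Represents.mul (.refl h'.costMono) h
    rw [zero_mul] at h1
    rw [mul_zero] at h2
    exact ⟨Realizable.zero.of_represents h1, Realizable.zero.of_represents h2⟩
  | succ k ih =>
    obtain ⟨X', Y, hX', hY, hr⟩ := h
    have hm' : level M k d ≤ m := (level_le_level_succ_zero k hd).trans hm
    obtain ⟨h1, h2⟩ := ih hX' ((level_mono (Nat.zero_le d)).trans hm')
    have h3 := hY.mul h'
    have h4 := h'.mul hY
    rw [max_eq_right hm'] at h3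
    rw [max_eq_left hm'] at h4
    have h5 := hr.mul (.refl h'.costMono)
    have h6 := Represents.mul (.refl h'.costMono) hr
    rw [add_mul] at h5
    rw [mul_add] at h6
    exact ⟨(h1.add h3).of_represents h5, (h2.add h4).of_represents h6⟩

theorem one_add_mul_realizable {m : ℕ} (h : Graded M d k X) (hd : d ≤ M)
    (hm : level M k 0 ≤ m) (h' : Realizable (groupType M) m R) :
    Realizable (groupType M) m ((1 + X) * R) := by
  rw [add_mul, one_mul]
  exact h'.add (h.mul_realizable hd hm h').1

theorem realizable_mul_one_add {m : ℕ} (h : Graded M d k X) (hd : d ≤ M)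
    (hm : level M k 0 ≤ m) (h' : Realizable (groupType M) m R) :
    Realizable (groupType M) m (R * (1 + X)) := by
  rw [mul_add, mul_one]
  exact h'.add (h.mul_realizable hd hm h').2

theorem mul (h : Graded M d k R) (h' : Graded M d k R') (hd : d ≤ M) : Graded M d k (R * R') := by
  induction k generalizing R R' with
  | zero =>
    have := Represents.mul h h'
    rwa [mul_zero] at this
  | succ k ih =>
    obtain ⟨X, Y, hX, hY, hr⟩ := h
    obtain ⟨X', Y', hX', hY', hr'⟩ := h'
    have h1 := hY.mul hY'
    rw [max_self] at h1
    have hm : level M k 0 ≤ level M k d := level_mono (Nat.zero_le d)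
    have h2 := ((hX.mul_realizable hd hm hY').1.add (hX'.mul_realizable hd hm hY).2).add h1
    have h3 := hr.mul hr'
    rw [show (X + Y) * (X' + Y') = X * X' + (X * Y' + Y * X' + Y * Y') by
      rw [add_mul, mul_add, mul_add]; abel] at h3
    exact ⟨_, _, ih hX hX', h2, h3⟩

/-- In the expansion of `(X + Y)⁺` the low-grade language `X` occurs next to `Y`, where it is
absorbed, except in the summand `X⁺`, which is left to the induction. -/
theorem pos (h : Graded M d k R) (hd : d ≤ M) : Graded M d k (iter posCount R) := by
  induction k generalizing R with
  | zero =>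
    have := Represents.iter countMono_posCount h
    rwa [iter_zero (fun _ _ h => absurd h (by simp [posCount]))] at this
  | succ k ih =>
    obtain ⟨X, Y, hX, hY, hr⟩ := h
    have hp := ih hX
    have hm : level M k 0 ≤ level M k d := level_mono (Nat.zero_le d)
    exact ⟨_, _, hp, hp.one_add_mul_realizable hd hm (hp.realizable_mul_one_add hd hm hY).pos,
      (represents_pos_add hX.costMono hY.costMono).trans (hr.iter countMono_posCount)⟩

/-- The number of factors is counted by `level M k d`, which is of type `B` because `d < M`; every
grade spends one further `B`-counter of its last group. -/
theorem posAtMost (h : Graded M d k R) (hd : d < M) : Graded M (d + 1) k (iter posAtMost R) := by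
  induction k generalizing R with
  | zero =>
    have := Represents.iter countMono_posAtMost h
    rwa [iter_zero (fun _ _ h => absurd h.1 (by simp))] at this
  | succ k ih =>
    obtain ⟨X, Y, hX, hY, hr⟩ := h
    have hp := ih hX
    have h1 := hp.realizable_mul_one_add hd (level_mono (Nat.zero_le d)) hY
    exact ⟨_, _, hp, hp.one_add_mul_realizable hd (level_mono (Nat.zero_le _)) (h1.posAtMost (groupType_level_of_lt hd)),
      (represents_posAtMost_add hX.costMono hY.costMono).trans (hr.iter countMono_posAtMost)⟩

/-- Many words of `Y` are counted by the `S`-counter of the group, which raises the grade by one.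
Otherwise a long run of words of `X` is used, which is graded by induction and may be surrounded by
arbitrary words of `X + Y`. -/
theorem posAtLeast (h : Graded M d k R) (hd : d ≤ M) :
    Graded M d (k + 1) (iter posAtLeast R) := by
  induction k generalizing R with
  | zero =>
    have := Represents.iter countMono_posAtLeast h
    rw [iter_zero (fun _ _ h => absurd h (by simp [OmegaBS.posAtLeast]))] at this
    exact zero.of_represents this
  | succ k ih =>
    obtain ⟨X, Y, hX, hY, hr⟩ := h
    have hp := hX.pos hd
    have hXY : Graded M d (k + 1) (X + Y) := hX.lift.add (of_realizable hY)
    have hq := hXY.pos hd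
    have hs := ih hX
    have h1 : Graded M d (k + 1) ((1 + iter posCount (X + Y)) * iter OmegaBS.posAtLeast X) := by
      rw [add_mul, one_mul]
      exact hs.add (hq.mul hs hd)
    have h2 : Graded M d (k + 1)
        ((1 + iter posCount (X + Y)) * iter OmegaBS.posAtLeast X * (1 + iter posCount (X + Y))) := by
      rw [mul_add, mul_one]
      exact h1.add (h1.mul hq hd)
    have h3 := hp.lift.one_add_mul_realizable hd (level_mono (Nat.zero_le d))
      ((hp.realizable_mul_one_add hd (level_mono (Nat.zero_le d)) hY).posAtLeast_level hd)
    exact ⟨_, _, h2, h3, (represents_posAtLeast_add hX.costMono hY.costMono).trans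
      (hr.iter countMono_posAtLeast)⟩

end Graded

end

end OmegaBS

/-! ### Graded form of expressions, and terms reduced to a single grade. -/

namespace OmegaBS

open Filter

variable {α : Type*}

/-! ### Expressions as sums of graded languages -/

/-- The nesting depth of the exponent `B`. -/
def BSExpr.bDepth : BSExpr α → ℕ
  | .empty | .eps | .finEps | .letter _ => 0
  | .concat e f | .mix e f => max e.bDepth f.bDepth
  | .star e | .sexp e => e.bDepth
  | .bexp e => e.bDepth + 1

/-- The nesting depth of the exponent `S`. -/
def BSExpr.sDepth : BSExpr α → ℕ
  | .empty | .eps | .finEps | .letter _ => 0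
  | .concat e f | .mix e f => max e.sDepth f.sDepth
  | .star e | .bexp e => e.sDepth
  | .sexp e => e.sDepth + 1

theorem BSExpr.IsVariant.bDepth_eq_zero {T : Variant} (hT : ¬ T.AllowsB) {e : BSExpr α}
    (he : e.IsVariant T) : e.bDepth = 0 := by
  induction e with
  | empty | eps | finEps | letter => rfl
  | concat e f he' hf' | mix e f he' hf' => simp [bDepth, he' he.1, hf' he.2]
  | star e ih | sexp e ih => first | exact ih he | exact ih he.2
  | bexp e => exact absurd he.1 hT

theorem BSExpr.IsVariant.sDepth_eq_zero {T : Variant} (hT : ¬ T.AllowsS) {e : BSExpr α}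
    (he : e.IsVariant T) : e.sDepth = 0 := by
  induction e with
  | empty | eps | finEps | letter => rfl
  | concat e f he' hf' | mix e f he' hf' => simp [sDepth, he' he.1, hf' he.2]
  | star e ih | bexp e ih => first | exact ih he | exact ih he.2
  | sexp e => exact absurd he.1 hT

theorem bDepth_ofRegular (r : RegularExpression α) : (ofRegular r).bDepth = 0 := by
  induction r with
  | zero | epsilon | char => rfl
  | plus e f he hf | comp e f he hf => simp [ofRegular, BSExpr.bDepth, he, hf]
  | star e ih => exact ih

theorem sDepth_ofRegular (r : RegularExpression α) : (ofRegular r).sDepth = 0 := by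
  induction r with
  | zero | epsilon | char => rfl
  | plus e f he hf | comp e f he hf => simp [ofRegular, BSExpr.sDepth, he, hf]
  | star e ih => exact ih

section

variable {X E : CostLang α}

theorem exists_of_mem_add_unit (hE : E = 0 ∨ E = 1) {b s : ℕ} {l : List (List α)}
    (hl : ∀ u ∈ l, u ∈ (X + E) b s) : ∃ l' : List (List α), l'.flatten = l.flatten ∧
      (∀ u ∈ l', u ∈ X b s) ∧ l'.length ≤ l.length := by
  induction l with
  | nil => exact ⟨[], rfl, by simp, le_rfl⟩
  | cons u l ih =>
    obtain ⟨l', h1, h2, h3⟩ := ih fun v hv => hl v (List.mem_cons_of_mem _ hv)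
    rcases hl u (by simp) with hu | hu
    · exact ⟨u :: l', by simp [h1], by simpa using ⟨hu, h2⟩, by simpa using h3⟩
    · rcases hE with rfl | rfl
      · exact hu.elim
      · obtain rfl : u = [] := hu
        exact ⟨l', by simpa using h1, h2, h3.trans (Nat.le_succ _)⟩

theorem CostMono.of_unit (hE : E = 0 ∨ E = 1) : CostMono E := by
  rcases hE with rfl | rfl
  · exact .zero
  · exact .one

theorem iter_anyCount_add_unit (hE : E = 0 ∨ E = 1) :
    iter anyCount (X + E) = iter posCount X + 1 := by
  funext b s
  ext w
  constructor
  · rintro ⟨l, rfl, hl, -⟩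
    obtain ⟨l', h1, h2, -⟩ := exists_of_mem_add_unit hE hl
    rw [← h1]
    rcases l'.length.eq_zero_or_pos with h | h
    · rw [List.length_eq_zero_iff.1 h]
      exact Or.inr rfl
    · exact Or.inl ⟨l', rfl, h2, h⟩
  · rintro (⟨l, rfl, hl, -⟩ | h)
    · exact ⟨l, rfl, fun u hu => Or.inl (hl u hu), trivial⟩
    · exact ⟨[], Eq.symm h, by simp, trivial⟩

theorem represents_atMost_add_unit (hX : CostMono X) (hE : E = 0 ∨ E = 1) :
    Represents (iter posAtMost X + 1) (iter atMost (X + E)) := by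
  refine ⟨(hX.iter countMono_posAtMost).add .one,
    (hX.add (.of_unit hE)).iter countMono_atMost, fun b => ⟨b + 1, fun s w hw => ?_⟩,
    fun b => ⟨b, fun s => ⟨s, fun w hw => ?_⟩⟩⟩
  · rcases hw with ⟨l, rfl, hl, hn⟩ | h
    · exact ⟨l, rfl, fun u hu => Or.inl (hX (Nat.le_succ b) le_rfl u (hl u hu)), hn.2⟩
    · exact ⟨[], Eq.symm h, by simp, Nat.zero_le _⟩
  · obtain ⟨l, rfl, hl, hn⟩ := hw
    obtain ⟨l', h1, h2, h3⟩ := exists_of_mem_add_unit hE hl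
    rw [← h1]
    rcases l'.length.eq_zero_or_pos with h | h
    · rw [List.length_eq_zero_iff.1 h]
      exact Or.inr rfl
    · have hn : l.length ≤ b := hn
      exact Or.inl ⟨l', rfl, h2, h, by omega⟩

theorem represents_atLeast (hX : CostMono X) :
    Represents (iter posAtLeast X) (iter atLeast X) := by
  refine ⟨hX.iter countMono_posAtLeast, hX.iter countMono_atLeast,
    fun b => ⟨b, fun s w hw => ?_⟩, fun b => ⟨b, fun s => ⟨s + 1, fun w hw => ?_⟩⟩⟩
  · obtain ⟨l, rfl, hl, hn⟩ := hw
    have hn : s + 1 ≤ l.length := hn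
    exact ⟨l, rfl, hl, by simp only [atLeast]; omega⟩
  · obtain ⟨l, rfl, hl, hn⟩ := hw
    exact ⟨l, rfl, fun u hu => hX le_rfl (Nat.le_succ s) u (hl u hu), hn⟩

/-- If the empty word is available, padding with it reaches any number of factors, so the exponent
`S` is the same as a star. -/
theorem represents_atLeast_add_one (hX : CostMono X) :
    Represents (iter posCount X + 1) (iter atLeast (X + 1)) := by
  refine ⟨(hX.iter countMono_posCount).add .one, (hX.add .one).iter countMono_atLeast,
    fun b => ⟨b, fun s w hw => ?_⟩, fun b => ⟨b, fun s => ⟨s, fun w hw => ?_⟩⟩⟩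
  · rw [← iter_anyCount_add_unit (Or.inr rfl)] at hw
    obtain ⟨l, rfl, hl, -⟩ := hw
    refine ⟨List.replicate s [] ++ l, by simp, fun u hu => ?_, by simp [atLeast]⟩
    rcases List.mem_append.1 hu with hu | hu
    · exact Or.inr (List.eq_of_mem_replicate hu)
    · exact hl u hu
  · rw [← iter_anyCount_add_unit (Or.inr rfl)]
    obtain ⟨l, rfl, hl, -⟩ := hw
    exact ⟨l, rfl, hl, trivial⟩

end

theorem one_add_one_eq : (1 + 1 : CostLang α) = 1 := by
  funext b s
  ext w
  exact or_self_iff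

theorem Graded.mul_unit {M d k : ℕ} {X E : CostLang α} (h : Graded M d k X)
    (hE : E = 0 ∨ E = 1) : Graded M d k (X * E) ∧ Graded M d k (E * X) := by
  rcases hE with rfl | rfl
  · rw [mul_zero, zero_mul]
    exact ⟨.zero, .zero⟩
  · rw [mul_one, one_mul]
    exact ⟨h, h⟩

/-- Block automata read nonempty words only, so the empty word is kept apart as the summand `E`. The
depths of nesting of `B` and `S` give the offset and the number of grades. -/
theorem BSExpr.exists_graded (e : BSExpr α) {M D K : ℕ} (hD : e.bDepth ≤ D) (hDM : D ≤ M)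
    (hK : e.sDepth ≤ K) : ∃ X E : CostLang α, Graded M D (K + 1) X ∧ (E = 0 ∨ E = 1) ∧
      Represents (X + E) e.val := by
  induction e generalizing D K with
  | empty =>
    refine ⟨0, 0, .zero, Or.inl rfl, ?_⟩
    rw [add_zero]
    exact .refl .zero
  | eps =>
    refine ⟨0, 1, .zero, Or.inr rfl, ?_⟩
    rw [zero_add]
    exact .refl .one
  | finEps =>
    refine ⟨0, 0, .zero, Or.inl rfl, ?_⟩
    rw [add_zero]
    -- Above threshold `0` this language is empty, so it is represented by the empty language.
    refine ⟨.zero, BSExpr.costMono_val .finEps, fun b => ⟨b, fun s w hw => hw.elim⟩,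
      fun b => ⟨b, fun s => ⟨1, fun w hw => ?_⟩⟩⟩
    exact absurd hw.2 one_ne_zero
  | letter a =>
    refine ⟨(BSExpr.letter a).val, 0, ?_, Or.inl rfl, ?_⟩
    · have h : Realizable (groupType M) (level M 0 0) (BSExpr.letter a).val := by
        rw [show level M 0 0 = 0 by simp [level]]
        exact .of_isBlockLang (.letter a)
      exact (Graded.of_realizable (h.weaken_level (Nat.zero_le D) hDM)).lift_le (by omega)
    · rw [add_zero]
      exact .refl (BSExpr.costMono_val _)
  | concat e f he hf =>
    obtain ⟨X, E, hX, hE, hr⟩ := he (le_of_max_le_left hD) hDM (le_of_max_le_left hK)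
    obtain ⟨X', E', hX', hE', hr'⟩ := hf (le_of_max_le_right hD) hDM (le_of_max_le_right hK)
    refine ⟨X * X' + (X * E' + E * X'), E * E', (hX.mul hX' hDM).add
      ((hX.mul_unit hE').1.add (hX'.mul_unit hE).2), ?_, ?_⟩
    · rcases hE with rfl | rfl
      · exact Or.inl (zero_mul _)
      · rwa [one_mul]
    · have h := hr.mul hr'
      rwa [show (X + E) * (X' + E') = X * X' + (X * E' + E * X') + E * E' by
        rw [add_mul, mul_add, mul_add]; abel] at h
  | mix e f he hf =>
    obtain ⟨X, E, hX, hE, hr⟩ := he (le_of_max_le_left hD) hDM (le_of_max_le_left hK)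
    obtain ⟨X', E', hX', hE', hr'⟩ := hf (le_of_max_le_right hD) hDM (le_of_max_le_right hK)
    refine ⟨X + X', E + E', hX.add hX', ?_, ?_⟩
    · rcases hE with rfl | rfl
      · rwa [zero_add]
      · rcases hE' with rfl | rfl
        · exact Or.inr (add_zero 1)
        · exact Or.inr one_add_one_eq
    · have h := hr.add hr'
      rwa [add_add_add_comm] at h
  | star e he =>
    obtain ⟨X, E, hX, hE, hr⟩ := he hD hDM hK
    refine ⟨_, 1, hX.pos hDM, Or.inr rfl, ?_⟩
    rw [← iter_anyCount_add_unit hE]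
    exact hr.iter countMono_anyCount
  | bexp e he =>
    obtain ⟨D, rfl⟩ : ∃ D', D = D' + 1 := ⟨D - 1, by simp only [bDepth] at hD; omega⟩
    obtain ⟨X, E, hX, hE, hr⟩ := he (Nat.le_of_succ_le_succ hD) (by omega) hK
    exact ⟨_, 1, hX.posAtMost hDM, Or.inr rfl,
      (represents_atMost_add_unit hX.costMono hE).trans (hr.iter countMono_atMost)⟩
  | sexp e he =>
    obtain ⟨K, rfl⟩ : ∃ K', K = K' + 1 := ⟨K - 1, by simp only [sDepth] at hK; omega⟩
    obtain ⟨X, E, hX, hE, hr⟩ := he hD hDM (Nat.le_of_succ_le_succ hK)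
    rcases hE with rfl | rfl
    · refine ⟨_, 0, hX.posAtLeast hDM, Or.inl rfl, ?_⟩
      rw [add_zero] at hr ⊢
      exact (represents_atLeast hX.costMono).trans (hr.iter countMono_atLeast)
    · exact ⟨_, 1, (hX.pos hDM).lift, Or.inr rfl,
        (represents_atLeast_add_one hX.costMono).trans (hr.iter countMono_atLeast)⟩

/-! ### Regrouping the blocks of a term -/

theorem flatten_seg_seg {β : Type*} (x : ℕ → β) {k : ℕ → ℕ} (hk : Monotone k) {a c : ℕ}
    (hac : a ≤ c) : (seg (fun j => seg x (k j) (k (j + 1))) a c).flatten = seg x (k a) (k c) := by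
  induction c, hac using Nat.le_induction with
  | base => simp [seg_self]
  | succ c hac ih =>
    rw [seg_succ _ hac, List.flatten_append, ih, List.flatten_singleton,
      seg_append x (hk hac) (hk (Nat.le_succ c))]

theorem seg_mem_iter {R : CostLang α} {P : CountCond} {x : ℕ → α} {k : ℕ → ℕ} (hk : Monotone k)
    {a c b s : ℕ} (hac : a ≤ c) (h : ∀ j, a ≤ j → j < c → seg x (k j) (k (j + 1)) ∈ R b s)
    (hP : P b s (c - a)) : seg x (k a) (k c) ∈ iter P R b s := by
  refine ⟨_, flatten_seg_seg x hk hac, fun u hu => ?_, by rwa [length_seg]⟩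
  obtain ⟨j, hj, hj', rfl⟩ := mem_seg.1 hu
  exact h j hj hj'

/-- Consecutive blocks are regrouped, `i + 1` of them in group `i`. The number of blocks in a group
tends to infinity, so an additional `S`-counter can always be satisfied in an `ω`-word. -/
theorem omegaTerm_subset_posAtLeast (L : Language α) {R : CostLang α} :
    omegaTerm L R ⊆ omegaTerm L (iter posAtLeast R) := by
  rintro x ⟨k, hk, hL, N, h0, h1⟩
  set ψ : ℕ → ℕ := fun i => ∑ j ∈ Finset.range i, (j + 1) with hψ
  have hψs : ∀ i, ψ (i + 1) = ψ i + (i + 1) := fun i => Finset.sum_range_succ _ _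
  have hψm : StrictMono ψ := strictMono_nat_of_lt_succ fun i => by rw [hψs]; omega
  have hmem : ∀ i s, s ≤ i → (∀ j ≥ ψ i, seg x.get (k j) (k (j + 1)) ∈ R N s) →
      seg x.get (k (ψ i)) (k (ψ (i + 1))) ∈ iter posAtLeast R N s := fun i s hs h =>
    seg_mem_iter hk.monotone (hψm (Nat.lt_succ_self i)).le (fun j hj _ => h j hj) (by
      rw [hψs]
      simp only [posAtLeast]
      omega)
  refine ⟨fun i => k (ψ i), hk.comp hψm, hL, N, fun i => hmem i 0 (Nat.zero_le i) fun j _ => h0 j,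
    fun s => ?_⟩
  obtain ⟨i₀, hi₀⟩ := h1 s
  exact ⟨max s i₀, fun i hi => hmem i s (le_of_max_le_left hi) fun j hj =>
    hi₀ j (((le_of_max_le_right hi).trans (hψm.id_le i)).trans hj)⟩

/-- If blocks from `Y` recur forever, each of them is grouped with the blocks of `X` before it.
Otherwise all blocks eventually come from `X`, and the initial ones are absorbed by `L`. -/
theorem omegaTerm_add_subset {L : Language α} {X Y : CostLang α} (hL : Absorbs L (X + Y))
    (hX : CostMono X) (hY : CostMono Y) :
    omegaTerm L (X + Y) ⊆ omegaTerm L X ∪ omegaTerm L ((1 + iter posCount X) * Y) := by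
  classical
  rintro x ⟨k, hk, hL0, N, h0, h1⟩
  obtain ⟨f, hf, h⟩ := exists_threshold
    (p := fun i s => seg x.get (k i) (k (i + 1)) ∈ (X + Y) N s) h0 h1
  by_cases hinf : ∀ n, ∃ i, n ≤ i ∧ seg x.get (k i) (k (i + 1)) ∈ Y N (f i)
  · right
    set ψ : ℕ → ℕ := fun i => (fun n => Nat.find (hinf n) + 1)^[i] 0 with hψ
    have hψs : ∀ i, ψ (i + 1) = Nat.find (hinf (ψ i)) + 1 := fun i =>
      Function.iterate_succ_apply' _ i _
    have hle : ∀ i, ψ i ≤ Nat.find (hinf (ψ i)) := fun i => (Nat.find_spec (hinf (ψ i))).1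
    have hψm : StrictMono ψ := strictMono_nat_of_lt_succ fun i => by
      rw [hψs]
      exact Nat.lt_succ_of_le (hle i)
    have hmem : ∀ i s, (∀ j ≥ ψ i, s ≤ f j) →
        seg x.get (k (ψ i)) (k (ψ (i + 1))) ∈ ((1 + iter posCount X) * Y : CostLang α) N s := by
      intro i s hs
      refine ⟨seg x.get (k (ψ i)) (k (Nat.find (hinf (ψ i)))), ?_, _,
        hY le_rfl (hs _ (hle i)) _ (Nat.find_spec (hinf (ψ i))).2, ?_⟩
      · rcases (hle i).eq_or_lt with he | hlt
        · rw [← he, seg_self]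
          exact Or.inl rfl
        · refine Or.inr (seg_mem_iter hk.monotone (hle i) (fun j hj hj' => ?_)
            (by simp only [posCount]; omega))
          refine hX le_rfl (hs j hj) _ ((h j).resolve_right fun hj2 => ?_)
          exact Nat.find_min (hinf (ψ i)) hj' ⟨hj, hj2⟩
      · rw [hψs]
        exact seg_append x.get (hk.monotone (hle i)) (hk.monotone (Nat.le_succ _))
    refine ⟨fun i => k (ψ i), hk.comp hψm, hL0, N, fun i => hmem i 0 fun j _ => Nat.zero_le _,
      fun s => ?_⟩
    obtain ⟨i₀, hi₀⟩ := hf.exists_ge s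
    exact ⟨i₀, fun i hi => hmem i s fun j hj => hi₀ j ((hi.trans (hψm.id_le i)).trans hj)⟩
  · left
    push Not at hinf
    obtain ⟨n, hn⟩ := hinf
    have hXm : ∀ i, seg x.get (k (n + i)) (k (n + i + 1)) ∈ X N (f (n + i)) := fun i =>
      (h (n + i)).resolve_right (hn _ (Nat.le_add_right n i))
    refine ⟨fun i => k (n + i), fun a c hac => hk (by omega), hL.seg_mem hk.monotone hL0 h0 n, N,
      fun i => hX le_rfl (Nat.zero_le _) _ (hXm i), fun s => ?_⟩
    obtain ⟨i₀, hi₀⟩ := hf.exists_ge s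
    exact ⟨i₀, fun i hi => hX le_rfl (hi₀ _ (by omega)) _ (hXm i)⟩

/-- The words absorbed by the prefix are turned back into blocks. They are finitely many, so they
only enlarge the bound and do not matter for thresholds. -/
theorem omegaTerm_mul_kstar_subset {L X : Language α} {R : CostLang α} (hR : CostMono R)
    (hX : ∀ u ∈ X, ∃ b, u ∈ R b 0) : omegaTerm (L * KStar.kstar X) R ⊆ omegaTerm L R := by
  rintro x ⟨k, hk, ⟨v, hv, t, ht, hvt⟩, N, h0, h1⟩
  obtain ⟨l, rfl, hl⟩ := Language.mem_kstar.1 ht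
  clear ht
  induction l using List.reverseRecOn generalizing k N with
  | nil =>
    have hvt' : v = seg x.get 0 (k 0) := by simpa using hvt
    exact ⟨k, hk, hvt' ▸ hv, N, h0, h1⟩
  | append_singleton l u ih =>
    have hl' : ∀ u ∈ l, u ∈ X := fun u hu => hl u (by simp [hu])
    obtain ⟨b, hb⟩ := hX u (hl u (by simp))
    have hvt' : (v ++ l.flatten) ++ u = seg x.get 0 (k 0) := by simpa using hvt
    by_cases hu : u = []
    · exact ih k hk N h0 h1 hl' (by simpa [hu] using hvt')
    · obtain ⟨h2, h3⟩ := eq_seg_of_append hvt'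
      rw [Nat.zero_add] at h2 h3
      set m := (v ++ l.flatten).length with hm
      have hlt : m < k 0 := by
        by_contra! hle
        have h4 := length_seg x.get m (k 0)
        rw [← h3] at h4
        exact hu (List.length_eq_zero_iff.1 (by omega))
      -- One nonempty word is moved from the end of the prefix to a new first block, which begins at
      -- `m`.
      set k' : ℕ → ℕ := fun i => if i = 0 then m else k (i - 1) with hk'
      have hk's : ∀ i, k' (i + 1) = k i := fun i => rfl
      refine ih k' (strictMono_nat_of_lt_succ fun i => ?_) (max N b) (fun i => ?_) (fun s => ?_)
        hl' h2
      · cases i with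
        | zero => exact hlt
        | succ i => exact hk (Nat.lt_succ_self i)
      · cases i with
        | zero =>
          change seg x.get m (k 0) ∈ _
          rw [← h3]
          exact hR (le_max_right _ _) le_rfl _ hb
        | succ i => exact hR (le_max_left _ _) le_rfl _ (h0 i)
      · obtain ⟨i₀, hi₀⟩ := h1 s
        refine ⟨i₀ + 1, fun i hi => ?_⟩
        obtain ⟨j, rfl⟩ : ∃ j, i = j + 1 := ⟨i - 1, by omega⟩
        exact hR (le_max_left _ _) le_rfl _ (hi₀ j (by omega))

theorem omegaTerm_add_unit_subset {L : Language α} {X E : CostLang α} (hE : E = 0 ∨ E = 1) :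
    omegaTerm L (X + E) ⊆ omegaTerm L X := by
  rintro x ⟨k, hk, hL, N, h0, h1⟩
  have key : ∀ i s, seg x.get (k i) (k (i + 1)) ∈ (X + E) N s →
      seg x.get (k i) (k (i + 1)) ∈ X N s := by
    rintro i s (h | h)
    · exact h
    · rcases hE with rfl | rfl
      · exact h.elim
      · have h2 := length_seg x.get (k i) (k (i + 1))
        rw [show seg x.get (k i) (k (i + 1)) = [] from h, List.length_nil] at h2
        have : k i < k (i + 1) := hk (Nat.lt_succ_self i)
        omega
  refine ⟨k, hk, hL, N, fun i => key i 0 (h0 i), fun s => ?_⟩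
  obtain ⟨i₀, hi₀⟩ := h1 s
  exact ⟨i₀, fun i hi => key i s (hi₀ i hi)⟩

/-- Words of `Z` are concatenations of words of `X`, with a corrected bound. -/
def IsComposed (Z X : CostLang α) : Prop :=
  ∀ b, ∃ b', ∀ s, ∀ w ∈ Z b s, w ∈ iter posCount X b' s

theorem mem_iter_posCount {R : CostLang α} {b s : ℕ} {w : List α} (h : w ∈ R b s) :
    w ∈ iter posCount R b s := ⟨[w], by simp, by simpa using h, le_rfl⟩

theorem iter_posCount_append {R : CostLang α} {b s : ℕ} {u v : List α}
    (hu : u ∈ iter posCount R b s) (hv : v ∈ iter posCount R b s) :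
    u ++ v ∈ iter posCount R b s := by
  obtain ⟨l, rfl, hl, hn⟩ := hu
  obtain ⟨l', rfl, hl', -⟩ := hv
  refine ⟨l ++ l', by simp, fun u hu => (List.mem_append.1 hu).elim (hl u) (hl' u), ?_⟩
  have hn : 1 ≤ l.length := hn
  simp only [posCount, List.length_append]
  omega

theorem flatten_mem_iter_posCount {R : CostLang α} {b s : ℕ} {l : List (List α)} (hne : l ≠ [])
    (h : ∀ u ∈ l, u ∈ iter posCount R b s) : l.flatten ∈ iter posCount R b s := by
  induction l with
  | nil => exact absurd rfl hne
  | cons u l ih =>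
    rw [List.flatten_cons]
    cases l with
    | nil => simpa using h u (by simp)
    | cons v l =>
      exact iter_posCount_append (h u (by simp)) (ih (by simp) fun w hw => h w (by simp [hw]))

theorem IsComposed.trans {X Y Z : CostLang α} (h : IsComposed Z Y)
    (h' : IsComposed Y X) : IsComposed Z X := by
  intro b
  obtain ⟨b1, h1⟩ := h b
  obtain ⟨b2, h2⟩ := h' b1
  refine ⟨b2, fun s w hw => ?_⟩
  obtain ⟨l, rfl, hl, hn⟩ := h1 s w hw
  refine flatten_mem_iter_posCount ?_ fun u hu => h2 s u (hl u hu)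
  rintro rfl
  exact absurd hn (by simp [posCount])

theorem Represents.isComposed {X Y : CostLang α} (h : Represents X Y) : IsComposed X Y := by
  intro b
  obtain ⟨b', hb'⟩ := h.sound b
  exact ⟨b', fun s w hw => mem_iter_posCount (hb' s w hw)⟩

theorem IsComposed.omegaTerm_subset {L : Language α} {X Z : CostLang α} (hX : CostMono X)
    (h : IsComposed Z X) : omegaTerm L Z ⊆ omegaTerm L X :=
  (omegaTerm_subset_of_sound h).trans (omegaTerm_iter_subset hX _)

theorem Absorbs.of_isComposed {L : Language α} {X Z : CostLang α} (hL : Absorbs L X)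
    (h : IsComposed Z X) : Absorbs L Z := by
  intro w hw b u hu
  obtain ⟨b', hb'⟩ := h b
  obtain ⟨l, rfl, hl, -⟩ := hb' 0 u hu
  clear hb' hu
  induction l generalizing w with
  | nil => simpa using hw
  | cons v l ih =>
    rw [List.flatten_cons, ← List.append_assoc]
    exact ih _ (hL w hw b' v (hl v (by simp))) fun u hu => hl u (List.mem_cons_of_mem _ hu)

/-- In `ω`-terms a language of the next lower grade may be replaced by its iterations of length at
least `s + 1`, which use the additional `S`-counter. With truncated subtraction, `k = 0` requires no
change. -/
theorem Realizable.exists_raise {M d k : ℕ} {Z : CostLang α} (hd : d ≤ M)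
    (h : Realizable (groupType M) (level M (k - 1) d) Z) :
    ∃ Z', Realizable (groupType M) (level M k d) Z' ∧ IsComposed Z' Z ∧
      ∀ L : Language α, omegaTerm L Z ⊆ omegaTerm L Z' := by
  cases k with
  | zero => exact ⟨Z, h, (Represents.refl h.costMono).isComposed, fun L => le_rfl⟩
  | succ k =>
    refine ⟨_, h.posAtLeast_level hd, fun b => ⟨b, fun s w hw => ?_⟩,
      fun L => omegaTerm_subset_posAtLeast L⟩
    obtain ⟨l, rfl, hl, hn⟩ := hw
    exact ⟨l, rfl, hl, le_trans (Nat.succ_le_succ (Nat.zero_le s)) hn⟩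

/-- The lower grades are merged by induction and raised by regrouping blocks; the top grade absorbs
lower pieces placed in front of it. Both then use the same number of counters. The result need not
represent `X`, but it yields the same `ω`-terms for prefixes that absorb `X`. -/
theorem Graded.exists_merge {M d k : ℕ} (hd : d ≤ M) {X : CostLang α} (h : Graded M d k X) :
    ∃ Z, Realizable (groupType M) (level M (k - 1) d) Z ∧ IsComposed Z X ∧
      ∀ L : Language α, Absorbs L X → omegaTerm L X ⊆ omegaTerm L Z := by
  induction k generalizing X with
  | zero =>
    exact ⟨0, .zero, Represents.isComposed h, fun L hL =>
      omegaTerm_subset_of_complete hL (Represents.complete h)⟩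
  | succ k ih =>
    obtain ⟨X', Y, hX', hY, hr⟩ := h
    obtain ⟨Z', hZ', hc', hs'⟩ := ih hX'
    obtain ⟨Z₁, hZ₁, hc₁, hs₁⟩ := hZ'.exists_raise hd
    have hp := (hX'.pos hd).one_add_mul_realizable hd (level_mono (Nat.zero_le d)) hY
    have hXY := hX'.costMono.add hY.costMono
    have hX'c : IsComposed X' (X' + Y) := fun b => ⟨b, fun s w hw => mem_iter_posCount (Or.inl hw)⟩
    have hc : IsComposed (Z₁ + (1 + iter posCount X') * Y) (X' + Y) := by
      intro b
      obtain ⟨b', hb'⟩ := ((hc₁.trans hc').trans hX'c) b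
      refine ⟨max b b', fun s w hw => ?_⟩
      rcases hw with hw | ⟨u, hu, v, hv, rfl⟩
      · exact hXY.iter countMono_posCount (le_max_right _ _) le_rfl _ (hb' s w hw)
      · refine hXY.iter countMono_posCount (le_max_left _ _) le_rfl _ ?_
        have hv' : v ∈ iter posCount (X' + Y) b s := mem_iter_posCount (Or.inr hv)
        rcases hu with hu | ⟨l, rfl, hl, hn⟩
        · obtain rfl : u = [] := hu
          exact hv'
        · exact iter_posCount_append ⟨l, rfl, fun u hu => Or.inl (hl u hu), hn⟩ hv'
    refine ⟨_, hZ₁.add hp, hc.trans hr.isComposed, fun L hL => ?_⟩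
    have hL' := hL.of_isComposed hr.isComposed
    refine (omegaTerm_subset_of_complete hL hr.complete).trans
      ((omegaTerm_add_subset hL' hX'.costMono hY.costMono).trans (Set.union_subset ?_ ?_))
    · refine ((hs' L (hL'.of_isComposed hX'c)).trans (hs₁ L)).trans
        (omegaTerm_subset_of_sound fun b => ⟨b, fun s w hw => Or.inl hw⟩)
    · exact omegaTerm_subset_of_sound fun b => ⟨b, fun s w hw => Or.inr hw⟩

/-- Terms of `ω`-regular expressions in normal form. -/
theorem exists_isBlockLang_omegaTerm (r : RegularExpression α) (e : BSExpr α) {M D K : ℕ}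
    (hD : e.bDepth ≤ D) (hDM : D ≤ M) (hK : e.sDepth ≤ K) :
    ∃ (r' : RegularExpression α) (Z : CostLang α), IsBlockLang (groupType M) (level M K D) Z ∧
      omegaTerm r.matches' e.val = omegaTerm r'.matches' Z := by
  obtain ⟨X, E, hX, hE, hr⟩ := e.exists_graded hD hDM hK
  obtain ⟨Z, hZ, hc, hs⟩ := hX.exists_merge hDM
  obtain ⟨Z', hZ', hr'⟩ := hZ
  -- The factor `e*` makes the prefix language absorb the words of `e`, as the loss of initial
  -- blocks requires; it is removed at the end by `omegaTerm_mul_kstar_subset`.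
  set L := (r * e.toRegular.star).matches' with hL
  have habs : Absorbs L e.val := by
    rintro _ ⟨u, hu, v, hv, rfl⟩ b t ht
    obtain ⟨l, rfl, hl⟩ := Language.mem_kstar.1 hv
    refine ⟨u, hu, (l ++ [t]).flatten, Language.mem_kstar.2 ⟨l ++ [t], rfl, fun y hy => ?_⟩,
      by simp⟩
    rcases List.mem_append.1 hy with hy | hy
    · exact hl y hy
    · rw [List.mem_singleton.1 hy]
      exact e.mem_matches'_toRegular.2 ⟨b, ht⟩
  have hXc : IsComposed X (X + E) := fun b => ⟨b, fun s w hw => mem_iter_posCount (Or.inl hw)⟩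
  have habs1 := habs.of_isComposed hr.isComposed
  have habs2 := habs1.of_isComposed hXc
  have habs3 := habs2.of_isComposed hc
  refine ⟨r * e.toRegular.star, Z', hZ', Set.Subset.antisymm ?_ ?_⟩
  · refine (omegaTerm_mono (M' := L) (fun w hw => ?_) _).trans
      ((omegaTerm_subset_of_complete habs hr.complete).trans ((omegaTerm_add_unit_subset hE).trans
        ((hs L habs2).trans (omegaTerm_subset_of_complete habs3 hr'.complete))))
    exact ⟨w, hw, [], Language.mem_kstar.2 ⟨[], rfl, by simp⟩, by simp⟩
  · refine (hr'.isComposed.omegaTerm_subset hr'.mono_right).trans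
      ((hc.omegaTerm_subset hX.costMono).trans ((hXc.omegaTerm_subset hr.mono_left).trans
        ((hr.isComposed.omegaTerm_subset hr.mono_right).trans ?_)))
    exact omegaTerm_mul_kstar_subset e.costMono_val fun u hu => e.mem_matches'_toRegular.1 hu

end OmegaBS

/-! ### From expressions to hierarchical automata: infinite runs of block automata. -/

namespace OmegaBS

open Filter

variable {α : Type*}

/-! ### Infinite runs of block automata -/

theorem cnt_eq_zero_of_none {a : ℕ → Action} {m : ℕ} (h : ∀ k < m, a k = .none) : cnt a m = 0 := by
  induction m with
  | zero => rfl
  | succ m ih =>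
    rw [cnt_succ, h m (Nat.lt_succ_self m), ih fun k hk => h k (by omega)]
    rfl

theorem CounterType.limitCond_shift {a : ℕ → Action} {m : ℕ} (h : ∀ k < m, a k = .none)
    (t : CounterType) : t.LimitCond a ↔ t.LimitCond fun k => a (m + k) := by
  have hm : ∀ k, cnt a (m + k) = cnt (fun k => a (m + k)) k := by
    intro k
    rw [cnt_eq_countFrom a (Nat.le_add_right m k), cnt_eq_zero_of_none h, cnt]
    congr 1
    exact seg_shift a m 0 k
  cases t with
  | B =>
    constructor
    · rintro ⟨N, hN⟩
      exact ⟨N, fun k => hm k ▸ hN _⟩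
    · rintro ⟨N, hN⟩
      refine ⟨N, fun k => ?_⟩
      by_cases hk : k < m
      · rw [cnt_eq_zero_of_none fun i hi => h i (by omega)]
        exact Nat.zero_le N
      · obtain ⟨k, rfl⟩ := Nat.exists_eq_add_of_le (not_lt.1 hk)
        exact hm k ▸ hN k
  | S =>
    constructor
    · intro hS s
      obtain ⟨p, hp⟩ := hS s
      exact ⟨p, fun k hk hr => hm k ▸ hp (m + k) (by omega) hr⟩
    · intro hS s
      obtain ⟨p, hp⟩ := hS s
      refine ⟨m + p, fun k hk hr => ?_⟩
      obtain ⟨k, rfl⟩ := Nat.exists_eq_add_of_le ((Nat.le_add_right m p).trans hk)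
      exact hm k ▸ hp k (by omega) hr

theorem exists_forall_lt_of_mono {Q : ℕ → ℕ → Prop} (hQ : ∀ j p p', p ≤ p' → Q j p → Q j p')
    {n : ℕ} (h : ∀ j < n, ∃ p, Q j p) : ∃ p, ∀ j < n, Q j p := by
  induction n with
  | zero => exact ⟨0, fun j hj => absurd hj (Nat.not_lt_zero j)⟩
  | succ n ih =>
    obtain ⟨p, hp⟩ := ih fun j hj => h j (by omega)
    obtain ⟨p', hp'⟩ := h n (Nat.lt_succ_self n)
    refine ⟨max p p', fun j hj => ?_⟩
    rcases Nat.lt_succ_iff_lt_or_eq.1 hj with hj | rfl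
    · exact hQ _ _ _ (le_max_left _ _) (hp j hj)
    · exact hQ _ _ _ (le_max_right _ _) hp'

/-- The first `n` counters are reset infinitely often and satisfy their conditions. -/
def AcceptsOps (τ : ℕ → CounterType) (n : ℕ) (o : ℕ → CounterOp) : Prop :=
  ∀ j < n, (∀ m, ∃ k ≥ m, o k j = .reset) ∧ (τ j).LimitCond fun k => o k j

theorem acceptsOps_shift {τ : ℕ → CounterType} {n m : ℕ} {o : ℕ → CounterOp}
    (h : ∀ k < m, ∀ j, o k j = .none) :
    AcceptsOps τ n o ↔ AcceptsOps τ n fun k => o (m + k) := by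
  refine forall_congr' fun j => forall_congr' fun _ => and_congr ?_
    (CounterType.limitCond_shift (fun k hk => h k hk j) _)
  constructor
  · intro H i
    obtain ⟨k, hk, hr⟩ := H (m + i)
    obtain ⟨k, rfl⟩ := Nat.exists_eq_add_of_le ((Nat.le_add_right m i).trans hk)
    exact ⟨k, by omega, hr⟩
  · intro H i
    obtain ⟨k, hk, hr⟩ := H i
    exact ⟨m + k, by omega, hr⟩

namespace BlockAut

variable {A B W : BlockAut α} {τ : ℕ → CounterType} {n : ℕ}

/-- An infinite run. -/
def IsRun (A : BlockAut α) (x : Stream' α) (ρ : ℕ → Transition A.State ℕ) : Prop :=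
  (∀ i, A.step (ρ i).source (x.get i) (ρ i).action (ρ i).target) ∧
    ∀ i, (ρ i).target = (ρ (i + 1)).source

/-- The `ω`-words that have an infinite run from an initial state satisfying the conditions on the
first `n` counters. -/
def omegaLang (A : BlockAut α) (τ : ℕ → CounterType) (n : ℕ) : Set (Stream' α) :=
  {x | ∃ ρ, A.IsRun x ρ ∧ (ρ 0).source ∈ A.init ∧ AcceptsOps τ n fun k => (ρ k).action}

/-- The steps of a block automaton as transitions of an automaton. -/
def toAutomaton (A : BlockAut α) (q : A.State) : Automaton α ℕ where
  State := A.State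
  finite_state := A.finite_state
  init := q
  -- The types play no role: this automaton only makes the gluing of finite runs available.
  type _ := .B
  δ a := {t | A.step t.source a t.action t.target}

/-- The last letter of a block carries no operation in `A`. In `W` it is read by a connecting step
with operation `op`, which ends the list of operations. -/
theorem Run.exists_runOn {φ : A.State → W.State} {op : CounterOp} {z q₀ : W.State}
    (hstep : ∀ q a o q', A.step q a o q' → W.step (φ q) a o (φ q'))
    (hlast : ∀ q a, A.last q a → W.step (φ q) a op z) {q : A.State} {w : List α}
    {os : List CounterOp} (h : A.Run q w os) :
    ∃ π, (W.toAutomaton q₀).RunOn (φ q) w π z ∧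
      π.map Transition.action = os ++ [op] := by
  induction h with
  | @last q a h =>
    exact ⟨[⟨φ q, op, z⟩], .cons (A := W.toAutomaton q₀) (t := ⟨φ q, op, z⟩) (hlast q a h)
      (.nil (A := W.toAutomaton q₀) z), rfl⟩
  | @step q q' a w o os h _ ih =>
    obtain ⟨π, hπ, hos⟩ := ih
    exact ⟨⟨φ q, o, φ q'⟩ :: π, .cons (A := W.toAutomaton q₀) (t := ⟨φ q, o, φ q'⟩)
      (hstep q a o q' h) hπ, by rw [List.map_cons, hos]; rfl⟩

theorem run_seg {x : ℕ → α} {p : ℕ → A.State} {o : ℕ → CounterOp} {a m : ℕ} (ham : a ≤ m)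
    (hstep : ∀ i, a ≤ i → i < m → A.step (p i) (x i) (o i) (p (i + 1)))
    (hlast : A.last (p m) (x m)) : A.Run (p a) (seg x a (m + 1)) (seg o a m) := by
  obtain ⟨d, rfl⟩ := Nat.exists_eq_add_of_le ham
  clear ham
  induction d generalizing a with
  | zero =>
    rw [show seg o a (a + 0) = [] from seg_self o a, show seg x a (a + 0 + 1) = [x a] by
      rw [Nat.add_zero, seg_cons x (Nat.lt_succ_self a), seg_self]]
    exact .last hlast
  | succ d ih =>
    rw [show a + (d + 1) = a + 1 + d by omega] at hstep hlast ⊢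
    rw [seg_cons x (by omega), seg_cons o (by omega)]
    exact .step (hstep a le_rfl (by omega))
      (ih (fun i hi hi' => hstep i (by omega) hi') hlast)

theorem Run.ne_nil {q : A.State} {w : List α} {os : List CounterOp} (h : A.Run q w os) :
    w ≠ [] := by
  cases h <;> simp

theorem IsRun.map {φ : A.State → W.State}
    (hφ : ∀ q a o q', A.step q a o q' → W.step (φ q) a o (φ q')) {x : Stream' α}
    {ρ : ℕ → Transition A.State ℕ} (h : A.IsRun x ρ) :
    W.IsRun x fun i => ⟨φ (ρ i).source, (ρ i).action, φ (ρ i).target⟩ :=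
  ⟨fun i => hφ _ _ _ _ (h.1 i), fun i => congrArg φ (h.2 i)⟩

theorem IsRun.exists_of_map {φ : A.State → W.State}
    (hφ : ∀ q a o q', W.step (φ q) a o (φ q') → A.step q a o q') {x : Stream' α}
    {ρ : ℕ → Transition W.State ℕ} (h : W.IsRun x ρ) (hs : ∀ i, ∃ q, (ρ i).source = φ q) :
    ∃ ρ', A.IsRun x ρ' ∧ (∀ i, φ (ρ' i).source = (ρ i).source) ∧
      ∀ i, (ρ' i).action = (ρ i).action := by
  choose q hq using hs
  refine ⟨fun i => ⟨q i, (ρ i).action, q (i + 1)⟩, ⟨fun i => ?_, fun i => rfl⟩,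
    fun i => (hq i).symm, fun i => rfl⟩
  have := h.1 i
  rw [h.2 i, hq, hq] at this
  exact hφ _ _ _ _ this

theorem omegaLang_zero : (zero : BlockAut α).omegaLang τ n = ∅ :=
  Set.eq_empty_iff_forall_notMem.2 fun _ ⟨ρ, _⟩ => (ρ 0).source.elim

theorem omegaLang_sum : (A.sum B).omegaLang τ n = A.omegaLang τ n ∪ B.omegaLang τ n := by
  ext x
  constructor
  · rintro ⟨ρ, hρ, hinit, hacc⟩
    rcases h0 : (ρ 0).source with q | q
    · have hs : ∀ i, ∃ q, (ρ i).source = Sum.inl q := by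
        intro i
        induction i with
        | zero => exact ⟨q, h0⟩
        | succ i ih =>
          obtain ⟨p, hp⟩ := ih
          have h1 := hρ.1 i
          rw [hp, hρ.2 i] at h1
          rcases h2 : (ρ (i + 1)).source with p' | p'
          · exact ⟨p', rfl⟩
          · rw [h2] at h1
            exact h1.elim
      obtain ⟨ρ', h1, h2, h3⟩ := IsRun.exists_of_map (A := A) (W := A.sum B) (φ := Sum.inl)
        (fun _ _ _ _ h => h) hρ hs
      refine Or.inl ⟨ρ', h1, ?_, ?_⟩
      · rw [← h2] at hinit
        exact hinit
      · simpa only [h3] using hacc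
    · have hs : ∀ i, ∃ q, (ρ i).source = Sum.inr q := by
        intro i
        induction i with
        | zero => exact ⟨q, h0⟩
        | succ i ih =>
          obtain ⟨p, hp⟩ := ih
          have h1 := hρ.1 i
          rw [hp, hρ.2 i] at h1
          rcases h2 : (ρ (i + 1)).source with p' | p'
          · rw [h2] at h1
            exact h1.elim
          · exact ⟨p', rfl⟩
      obtain ⟨ρ', h1, h2, h3⟩ := IsRun.exists_of_map (A := B) (W := A.sum B) (φ := Sum.inr)
        (fun _ _ _ _ h => h) hρ hs
      refine Or.inr ⟨ρ', h1, ?_, ?_⟩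
      · rw [← h2] at hinit
        exact hinit
      · simpa only [h3] using hacc
  · rintro (⟨ρ, hρ, hinit, hacc⟩ | ⟨ρ, hρ, hinit, hacc⟩)
    · exact ⟨_, hρ.map (W := A.sum B) (φ := Sum.inl) (fun _ _ _ _ h => h), hinit, hacc⟩
    · exact ⟨_, hρ.map (W := A.sum B) (φ := Sum.inr) (fun _ _ _ _ h => h), hinit, hacc⟩

/-- The words that have a run from an initial state. -/
def wordLang (A : BlockAut α) : Language α := {w | ∃ q ∈ A.init, ∃ os, A.Run q w os}

/-- `A` touches no counter, whereas counter `0` has to be reset infinitely often; hence an accepting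
run cannot stay in `A`. The operation `opAt 0 .none` does nothing, so the prefix has no effect on
the conditions. -/
theorem omegaLang_mul (hA : A.Below 0) : (A.mul B (opAt 0 .none)).omegaLang τ (n + 1) =
    {x | ∃ m, seg x.get 0 m ∈ A.wordLang ∧ x.drop m ∈ B.omegaLang τ (n + 1)} := by
  classical
  ext x
  constructor
  · rintro ⟨ρ, hρ, hinit, hacc⟩
    have hex : ∃ i q, (ρ i).source = Sum.inr q := by
      by_contra! hne
      have hs : ∀ i, ∃ q, (ρ i).source = Sum.inl q := by
        intro i
        rcases h : (ρ i).source with q | q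
        · exact ⟨q, rfl⟩
        · exact absurd h (hne i q)
      obtain ⟨k, -, hk⟩ := (hacc 0 (Nat.succ_pos n)).1 0
      obtain ⟨q, hq⟩ := hs k
      obtain ⟨q', hq'⟩ := hs (k + 1)
      have h1 := hρ.1 k
      rw [hq, hρ.2 k, hq'] at h1
      have h2 := (hA _ _ _ _ h1).2 0 le_rfl
      simp only at hk
      rw [h2] at hk
      cases hk
    obtain ⟨m, hm⟩ : ∃ m, Nat.find hex = m + 1 := by
      refine Nat.exists_eq_succ_of_ne_zero fun h0 => ?_
      obtain ⟨q, hq⟩ := Nat.find_spec hex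
      rw [h0] at hq
      rw [hq] at hinit
      exact hinit
    have hl : ∀ i, i ≤ m → ∃ q, (ρ i).source = Sum.inl q := by
      intro i hi
      rcases h : (ρ i).source with q | q
      · exact ⟨q, rfl⟩
      · exact absurd ⟨q, h⟩ (Nat.find_min hex (by omega))
    have hr : ∀ i, ∃ q, (ρ (m + 1 + i)).source = Sum.inr q := by
      intro i
      induction i with
      | zero => exact hm ▸ Nat.find_spec hex
      | succ i ih =>
        obtain ⟨p, hp⟩ := ih
        have h1 := hρ.1 (m + 1 + i)
        rw [hp, hρ.2] at h1
        rcases h2 : (ρ (m + 1 + i + 1)).source with p' | p'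
        · rw [h2] at h1
          exact h1.elim
        · exact ⟨p', rfl⟩
    obtain ⟨q₀, hq₀⟩ := hl 0 (Nat.zero_le m)
    have hp : ∀ i, ∃ q, i ≤ m → (ρ i).source = Sum.inl q := by
      intro i
      by_cases hi : i ≤ m
      · obtain ⟨q, hq⟩ := hl i hi
        exact ⟨q, fun _ => hq⟩
      · exact ⟨q₀, fun h => absurd h hi⟩
    choose p hp using hp
    have hstep : ∀ i, 0 ≤ i → i < m →
        A.step (p i) (x.get i) (ρ i).action (p (i + 1)) := by
      intro i _ hi
      have h1 := hρ.1 i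
      rw [hρ.2 i, hp i hi.le, hp (i + 1) hi] at h1
      exact h1
    obtain ⟨b, hb⟩ := hr 0
    have hlast := hρ.1 m
    rw [hρ.2 m, hp m le_rfl, show (ρ (m + 1)).source = Sum.inr b from hb] at hlast
    obtain ⟨hop, hlast, hbi⟩ := hlast
    have hrun := run_seg (Nat.zero_le m) hstep hlast
    have htail : (A.mul B (opAt 0 .none)).IsRun (x.drop (m + 1)) fun i => ρ (m + 1 + i) := by
      refine ⟨fun i => ?_, fun i => hρ.2 (m + 1 + i)⟩
      rw [Stream'.get_drop]
      exact hρ.1 (m + 1 + i)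
    obtain ⟨ρ', h1, h2, h3⟩ := IsRun.exists_of_map (A := B)
      (W := A.mul B (opAt 0 .none)) (φ := Sum.inr) (fun _ _ _ _ h => h) htail hr
    refine ⟨m + 1, ⟨p 0, ?_, _, hrun⟩, ρ', h1, ?_, ?_⟩
    · rw [hp 0 (Nat.zero_le m)] at hinit
      exact hinit
    · have h4 := h2 0
      rw [Nat.add_zero] at h4
      have h5 : Sum.inr (ρ' 0).source = (Sum.inr b : A.State ⊕ B.State) := h4.trans hb
      rw [Sum.inr.inj h5]
      exact hbi
    · simp only [h3]
      refine (acceptsOps_shift fun k hk j => ?_).1 hacc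
      rcases Nat.lt_succ_iff_lt_or_eq.1 hk with hk | rfl
      · exact (hA _ _ _ _ (hstep k (Nat.zero_le k) hk)).2 j (Nat.zero_le j)
      · rw [hop]
        exact opAt_none_of_ge (Nat.zero_le j)
  · rintro ⟨m, ⟨q, hq, os, hrun⟩, ρ', hρ', hinit, hacc⟩
    have hm : 0 < m := by
      by_contra! h
      obtain rfl : m = 0 := by omega
      exact hrun.ne_nil (seg_self _ _)
    set W := A.mul B (opAt 0 .none) with hW
    obtain ⟨π, hπ, hπo⟩ := hrun.exists_runOn (W := W) (φ := Sum.inl) (op := opAt 0 .none)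
      (z := Sum.inr (ρ' 0).source) (q₀ := Sum.inl q) (fun _ _ _ _ h => h)
      (fun _ _ h => ⟨rfl, h, hinit⟩)
    -- The prefix is the first piece, and every later piece is a single letter.
    set k : ℕ → ℕ := fun i => if i = 0 then 0 else m + (i - 1) with hk
    have hks : ∀ i, k (i + 1) = m + i := fun i => rfl
    have hkm : StrictMono k := strictMono_nat_of_lt_succ fun i => by
      cases i with
      | zero => exact hm
      | succ i => rw [hks, hks]; omega
    obtain ⟨ρ, hρ, hρ0, hseg⟩ := exists_isRun (A := W.toAutomaton (Sum.inl q)) (x := x) hkm rfl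
      (P := fun i => if i = 0 then Sum.inl q else Sum.inr (ρ' (i - 1)).source)
      (π := fun i => if i = 0 then π else [⟨Sum.inr (ρ' (i - 1)).source, (ρ' (i - 1)).action,
        Sum.inr (ρ' i).source⟩]) (by
        intro i
        cases i with
        | zero => exact hπ
        | succ i =>
          have h1 := hρ'.1 i
          rw [hρ'.2 i, Stream'.get_drop] at h1
          have h2 : seg x.get (m + i) (m + (i + 1)) = [x.get (m + i)] := by
            rw [← Nat.add_assoc, seg_succ _ le_rfl, seg_self, List.nil_append]
          change (W.toAutomaton (Sum.inl q)).RunOn (Sum.inr (ρ' i).source)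
            (seg x.get (m + i) (m + (i + 1))) [⟨Sum.inr (ρ' i).source, (ρ' i).action,
              Sum.inr (ρ' (i + 1)).source⟩] (Sum.inr (ρ' (i + 1)).source)
          rw [h2]
          exact .cons (A := W.toAutomaton (Sum.inl q)) (t := ⟨Sum.inr (ρ' i).source,
            (ρ' i).action, Sum.inr (ρ' (i + 1)).source⟩) h1
            (.nil (A := W.toAutomaton (Sum.inl q)) _))
    have hnone : ∀ i < m, ∀ j, (ρ i).action j = .none := by
      intro i hi j
      have h1 := hseg 0
      rw [hks] at h1
      have h2 : (ρ i).action ∈ os ++ [opAt 0 .none] := by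
        rw [← hπo]
        refine List.mem_map_of_mem ?_
        have h3 : ρ i ∈ seg ρ 0 m := mem_seg.2 ⟨i, Nat.zero_le i, hi, rfl⟩
        have h4 : seg ρ 0 m = π := h1
        rw [h4] at h3
        exact h3
      rcases List.mem_append.1 h2 with h2 | h2
      · exact hA.map_eq_none hrun (Nat.zero_le j) _ (List.mem_map_of_mem (f := fun o => o j) h2)
      · rw [List.mem_singleton.1 h2]
        exact opAt_none_of_ge (Nat.zero_le j)
    refine ⟨ρ, hρ, ?_, (acceptsOps_shift hnone).2 ?_⟩
    · rw [hρ0]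
      exact hq
    · have : ∀ i, (ρ (m + i)).action = (ρ' i).action := by
        intro i
        have h1 : seg ρ (m + i) (m + (i + 1)) = [⟨Sum.inr (ρ' i).source, (ρ' i).action,
          Sum.inr (ρ' (i + 1)).source⟩] := hseg (i + 1)
        have h2 : seg ρ (m + i) (m + (i + 1)) = [ρ (m + i)] := by
          rw [← Nat.add_assoc, seg_succ _ le_rfl, seg_self, List.nil_append]
        exact congrArg Transition.action (List.cons.inj (h2.symm.trans h1)).1
      simpa only [this] using hacc

/-- Counter `n` is never reset by steps of `A`, so its resets are exactly the passages through the
loop. As it must be reset infinitely often, they cut the word into infinitely many blocks of `A`. -/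
theorem mem_omegaTerm_of_mem_omegaLang_loop
    (hres : ∀ q a o q', A.step q a o q' → o n ≠ .reset) {x : Stream' α}
    (hx : x ∈ (A.loop (opAt (n + 1) .none)).omegaLang τ (n + 1)) :
    x ∈ omegaTerm 1 (A.rel τ (n + 1)) := by
  obtain ⟨ρ, hρ, hinit, hacc⟩ := hx
  have hinf : (resetPositions ρ n).Infinite :=
    infinite_resetPositions_iff.2 (hacc n (Nat.lt_succ_self n)).1
  set a : ℕ → ℕ := segmentStart ρ n with ha
  set m : ℕ → ℕ := fun i => Nat.nth (· ∈ resetPositions ρ n) i with hm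
  have has : ∀ i, a (i + 1) = m i + 1 := fun i => rfl
  have hmm : StrictMono m := Nat.nth_strictMono (p := (· ∈ resetPositions ρ n)) hinf
  have hle : ∀ i, a i ≤ m i := by
    intro i
    cases i with
    | zero => exact Nat.zero_le _
    | succ i => exact hmm (Nat.lt_succ_self i)
  have ham : StrictMono a := strictMono_nat_of_lt_succ fun i => by
    rw [has]
    exact Nat.lt_succ_of_le (hle i)
  have hloop : ∀ i, (ρ (m i)).action = opAt (n + 1) .none ∧ A.last (ρ (m i)).source (x.get (m i)) ∧
      (ρ (m i)).target ∈ A.init := fun i =>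
    (hρ.1 (m i)).resolve_left fun h => hres _ _ _ _ h (nth_mem_resetPositions hinf i)
  have hstep : ∀ i j, a i ≤ j → j < m i →
      A.step (ρ j).source (x.get j) (ρ j).action (ρ (j + 1)).source := by
    intro i j h1 h2
    rw [← hρ.2 j]
    refine (hρ.1 j).resolve_right fun h => action_ne_reset_of_segment hinf h1 h2 ?_
    rw [h.1]
    exact opAt_of_lt (Nat.lt_succ_self n)
  have hsrc : ∀ i, (ρ (a i)).source ∈ A.init := by
    intro i
    cases i with
    | zero => exact hinit
    | succ i =>
      rw [has, ← hρ.2 (m i)]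
      exact (hloop i).2.2
  -- The loop operation resets all the `n + 1` counters, so each block starts from zero, as `rel`
  -- demands.
  have hcnt : ∀ i, ∀ j < n + 1, cnt (fun k => (ρ k).action j) (a i) = 0 := by
    intro i j hj
    cases i with
    | zero => rfl
    | succ i =>
      rw [has, cnt_succ, (hloop i).1, opAt_of_lt hj]
      rfl
  obtain ⟨N, hN⟩ : ∃ N, ∀ j < n + 1, τ j = .B → ∀ k, cnt (fun k => (ρ k).action j) k ≤ N := by
    refine exists_forall_lt_of_mono (fun j p p' hp h hj k => (h hj k).trans hp) fun j hj => ?_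
    have h1 := (hacc j hj).2
    cases hc : τ j with
    | B =>
      rw [hc] at h1
      obtain ⟨N, hN⟩ := h1
      exact ⟨N, fun _ => hN⟩
    | S => exact ⟨0, fun h => by cases h⟩
  have hS : ∀ s, ∃ p, ∀ j < n + 1, τ j = .S → ∀ k ≥ p, (ρ k).action j = .reset →
      s ≤ cnt (fun k => (ρ k).action j) k := by
    intro s
    refine exists_forall_lt_of_mono (fun j p p' hp h hj k hk => h hj k (hp.trans hk))
      fun j hj => ?_
    have h1 := (hacc j hj).2
    cases hc : τ j with
    | S =>
      rw [hc] at h1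
      obtain ⟨p, hp⟩ := h1 s
      exact ⟨p, fun _ => hp⟩
    | B => exact ⟨0, fun h => by cases h⟩
  have hmem : ∀ i s, (∀ j < n + 1, τ j = .S → ∀ k ≥ a i, (ρ k).action j = .reset →
      s ≤ cnt (fun k => (ρ k).action j) k) →
      seg x.get (a i) (a (i + 1)) ∈ A.rel τ (n + 1) N s := by
    intro i s hs
    refine ⟨(ρ (a i)).source, hsrc i, _,
      run_seg (A := A) (p := fun j => (ρ j).source) (o := fun j => (ρ j).action) (hle i) (hstep i)
        (hloop i).2.1, fun j hj => ?_⟩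
    rw [← seg_map]
    have h0 := hcnt i j hj
    cases hc : τ j with
    | B =>
      have h1 := okB_seg (fun k => (ρ k).action j) (hle i) fun k _ => hN j hj hc k
      rw [h0] at h1
      exact h1
    | S =>
      have h1 := okS_seg_iff (fun k => (ρ k).action j) (s := s) (hle i)
      have h2 := cnt_eq_countFrom (fun k => (ρ k).action j) (hle i)
      rw [h0] at h1 h2
      refine okS_true_iff.2 ⟨h1.2 fun k hk _ hr => hs j hj hc k hk hr, ?_⟩
      refine le_of_le_of_eq (hs j hj hc (m i) (hle i) ?_) h2
      rw [(hloop i).1]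
      exact opAt_of_lt hj
  refine ⟨a, ham, seg_self _ _, N, fun i => hmem i 0 fun _ _ _ _ _ _ => Nat.zero_le _, fun s => ?_⟩
  obtain ⟨p, hp⟩ := hS s
  exact ⟨p, fun i hi => hmem i s fun j hj hc k hk =>
    hp j hj hc k ((hi.trans (ham.id_le i)).trans hk)⟩

theorem mem_omegaLang_loop_of_mem_omegaTerm {x : Stream' α}
    (hx : x ∈ omegaTerm 1 (A.rel τ n)) :
    x ∈ (A.loop (opAt n .none)).omegaLang τ n := by
  obtain ⟨k, hk, hk0, N, h0, h1⟩ := hx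
  have hk0 : k 0 = 0 := by
    have h2 := length_seg x.get 0 (k 0)
    rw [show seg x.get 0 (k 0) = [] from hk0] at h2
    exact h2.symm
  obtain ⟨f, hf, h⟩ := exists_threshold
    (p := fun i s => seg x.get (k i) (k (i + 1)) ∈ A.rel τ n N s) h0 h1
  choose q hq os hrun hok using h
  have hπ := fun i => Run.exists_runOn (A := A) (W := A.loop (opAt n .none)) (φ := fun q => q)
    (op := opAt n .none) (z := q (i + 1)) (q₀ := q 0) (fun _ _ _ _ h => Or.inl h)
    (fun _ _ h => Or.inr ⟨rfl, h, hq (i + 1)⟩) (hrun i)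
  choose π hπ hπo using hπ
  obtain ⟨ρ, hρ, hρ0, hseg⟩ := exists_isRun (A := (A.loop (opAt n .none)).toAutomaton (q 0))
    (P := q) hk hk0 hπ
  have hacts : ∀ j < n, ∀ i, seg (fun l => (ρ l).action j) (k i) (k (i + 1)) =
      (os i).map (· j) ++ [.reset] := by
    intro j hj i
    have h2 := congrArg (List.map fun t => t.action j) (hseg i)
    have h3 := congrArg (List.map fun o : CounterOp => o j) (hπo i)
    rw [List.map_map, List.map_append, List.map_singleton, opAt_of_lt hj] at h3
    rw [seg_map (fun t => t.action j) ρ]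
    exact h2.trans h3
  have hres : ∀ j < n, ∀ i, Action.reset ∈ seg (fun l => (ρ l).action j) (k i) (k (i + 1)) := by
    intro j hj i
    rw [hacts j hj]
    simp
  refine ⟨ρ, hρ, hρ0 ▸ hq 0, fun j hj => ⟨fun m => ?_, ?_⟩⟩
  · obtain ⟨l, hl, -, hl'⟩ := mem_seg.1 (hres j hj m)
    exact ⟨l, (hk.id_le m).trans hl, hl'⟩
  · have hok' := fun i => hok i j hj
    cases hc : τ j with
    | B =>
      refine exists_bound_of_blocks (N := N) hk (fun i _ => hres j hj i) fun i _ => ?_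
      have h2 := hok' i
      rw [hc] at h2
      rw [hacts j hj, okB_append]
      exact ⟨h2, trivial⟩
    | S =>
      intro s
      obtain ⟨i₀, hi₀⟩ := hf.exists_ge s
      refine ⟨k i₀, fun l hl hr => ?_⟩
      obtain ⟨i, hi, hi'⟩ := exists_index_of_strictMono hk (j := l) (by omega)
      have hlt : i₀ < i + 1 := hk.lt_iff_lt.1 (lt_of_le_of_lt hl hi')
      have h2 := (hok' i).mono le_rfl (hi₀ i (by omega))
      rw [hc] at h2
      have h3 : okS s false 0 (seg (fun l => (ρ l).action j) (k i) (k (i + 1))) := by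
        rw [hacts j hj, okS_append]
        have h4 := okS_true_iff.1 (show okS s true 0 ((os i).map (· j)) from h2)
        exact ⟨h4.1, h4.2, fun h => by cases h⟩
      exact (okS_seg_iff _ (hk (Nat.lt_succ_self i)).le).1
        (h3.mono le_rfl (Nat.zero_le _)) l hi hi' hr

theorem omegaLang_loop (hres : ∀ q a o q', A.step q a o q' → o n ≠ .reset) :
    (A.loop (opAt (n + 1) .none)).omegaLang τ (n + 1) = omegaTerm 1 (A.rel τ (n + 1)) :=
  Set.Subset.antisymm (fun _ h => mem_omegaTerm_of_mem_omegaLang_loop hres h)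
    fun _ h => mem_omegaLang_loop_of_mem_omegaTerm h

/-- Recognition by a hierarchical automaton. -/
theorem isHierarchicallyRecognized {T : Variant}
    (hA : ∀ q a o q', A.step q a o q' → o.IsHierarchical)
    (hτ : ∀ j < n, (τ j = .B → T.AllowsB) ∧ (τ j = .S → T.AllowsS)) :
    IsHierarchicallyRecognized T (A.omegaLang τ n) := by
  have := A.finite_state
  -- The fresh state `none` copies the transitions of all initial states, since an automaton has
  -- only one initial state. It is never entered again.
  refine ⟨n, ⟨Option A.State, inferInstance, none, fun j => τ j, fun a =>
    {t | ∃ q o q', A.step q a o q' ∧ (t.source = some q ∨ t.source = none ∧ q ∈ A.init) ∧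
      t.target = some q' ∧ ∀ j : Fin n, t.action j = o j}⟩, ?_, fun j => hτ j j.2, ?_⟩
  · rintro a t ⟨q, o, q', hs, -, -, ho⟩ i hi j hj
    rw [ho] at hi
    rw [ho]
    refine hA _ _ _ _ hs i ?_ j hj
    rcases hi with hi | hi <;> rw [hi] <;> simp
  · ext x
    constructor
    · rintro ⟨ρ, ⟨h1, h2⟩, h3, h4⟩
      choose q o q' hs hsrc htgt ho using h1
      have hq : ∀ i, q' i = q (i + 1) := by
        intro i
        have h5 := h2 i
        rw [htgt i] at h5
        rcases hsrc (i + 1) with h6 | ⟨h6, -⟩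
        · rw [h6] at h5
          exact Option.some.inj h5
        · rw [h6] at h5
          cases h5
      refine ⟨fun i => ⟨q i, o i, q' i⟩, ⟨hs, hq⟩, ?_, fun j hj => ?_⟩
      · rcases hsrc 0 with h6 | ⟨-, h6⟩
        · rw [h3] at h6
          cases h6
        · exact h6
      · obtain ⟨h5, h6⟩ := h4 ⟨j, hj⟩
        rw [condition_counterValues_iff h5] at h6
        rw [infinite_resetPositions_iff] at h5
        simp only [ho] at h5 h6
        exact ⟨h5, h6⟩
    · rintro ⟨ρ, hρ, hinit, hacc⟩
      refine ⟨fun i => ⟨if i = 0 then none else some (ρ i).source, fun j => (ρ i).action j,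
        some (ρ i).target⟩, ⟨fun i => ⟨_, _, _, hρ.1 i, ?_, rfl, fun _ => rfl⟩, fun i => ?_⟩, rfl,
        fun j => ?_⟩
      · cases i with
        | zero => exact Or.inr ⟨rfl, hinit⟩
        | succ i => exact Or.inl rfl
      · exact congrArg some (hρ.2 i)
      · obtain ⟨h5, h6⟩ := hacc j j.2
        have h7 := infinite_resetPositions_iff.2 h5
        exact ⟨infinite_resetPositions_iff.2 h5,
          (condition_counterValues_iff (infinite_resetPositions_iff.2 h5) _).2 h6⟩

end BlockAut

/-! ### Automata for `ω`-regular expressions -/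

theorem omegaTerm_eq (L : Language α) (R : CostLang α) :
    omegaTerm L R = {x | ∃ m, seg x.get 0 m ∈ L ∧ x.drop m ∈ omegaTerm 1 R} := by
  have hseg : ∀ (x : Stream' α) m a b, seg (x.drop m).get a b = seg x.get (m + a) (m + b) := by
    intro x m a b
    rw [seg_shift]
    congr 1
    funext i
    rw [Stream'.get_drop]
  ext x
  constructor
  · rintro ⟨k, hk, hL, N, h0, h1⟩
    have hle : ∀ i, k 0 ≤ k i := fun i => hk.monotone (Nat.zero_le i)
    have e : ∀ i, seg (x.drop (k 0)).get (k i - k 0) (k (i + 1) - k 0) =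
        seg x.get (k i) (k (i + 1)) := by
      intro i
      rw [hseg, Nat.add_sub_cancel' (hle i), Nat.add_sub_cancel' (hle (i + 1))]
    refine ⟨k 0, hL, fun i => k i - k 0, fun a b hab => ?_, ?_, N, fun i => ?_, fun s => ?_⟩
    · have := hk hab
      have := hle a
      simp only
      omega
    · change seg _ 0 (k 0 - k 0) ∈ _
      rw [Nat.sub_self]
      exact seg_self _ _
    · rw [e]
      exact h0 i
    · obtain ⟨i₀, hi₀⟩ := h1 s
      exact ⟨i₀, fun i hi => by rw [e]; exact hi₀ i hi⟩
  · rintro ⟨m, hL, k, hk, hk0, N, h0, h1⟩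
    have hk0 : k 0 = 0 := by
      have h2 := length_seg (x.drop m).get 0 (k 0)
      rw [show seg (x.drop m).get 0 (k 0) = [] from hk0] at h2
      exact h2.symm
    refine ⟨fun i => m + k i, fun a b hab => Nat.add_lt_add_left (hk hab) m, ?_, N, fun i => ?_,
      fun s => ?_⟩
    · change seg x.get 0 (m + k 0) ∈ L
      rwa [hk0]
    · rw [← hseg]
      exact h0 i
    · obtain ⟨i₀, hi₀⟩ := h1 s
      exact ⟨i₀, fun i hi => by rw [← hseg]; exact hi₀ i hi⟩

/-- The graded form of an expression without exponents `B` and `S` needs no counters; the empty word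
is what it leaves out. -/
theorem exists_blockAut_matches' (r : RegularExpression α) :
    ∃ A : BlockAut α, A.Below 0 ∧ ∀ w, w ∈ A.wordLang ↔ w ∈ r.matches' ∧ w ≠ [] := by
  obtain ⟨X, E, ⟨X', Y, hX', ⟨Y', ⟨A, hA, rfl⟩, hr'⟩, hr⟩, hE, hre⟩ :=
    (ofRegular r).exists_graded (M := 0) (D := 0) (K := 0) (bDepth_ofRegular r).le le_rfl
      (sDepth_ofRegular r).le
  have h0 : level 0 0 0 = 0 := rfl
  rw [h0] at hA hr'
  have hrep := (((Represents.add hX' hr').trans hr).add (.refl (.of_unit hE))).trans hre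
  rw [zero_add] at hrep
  refine ⟨A, hA, fun w => ⟨?_, ?_⟩⟩
  · rintro ⟨q, hq, os, h⟩
    obtain ⟨b, hb⟩ := hrep.sound 0
    have := hb 0 w (Or.inl ⟨q, hq, os, h, fun j hj => absurd hj (Nat.not_lt_zero j)⟩)
    rw [val_ofRegular] at this
    exact ⟨this, h.ne_nil⟩
  · rintro ⟨hw, hne⟩
    obtain ⟨b, hb⟩ := hrep.complete 0
    obtain ⟨s, hs⟩ := hb 0
    rcases hs w (by rwa [val_ofRegular]) with ⟨q, hq, os, h, -⟩ | h
    · exact ⟨q, hq, os, h⟩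
    · rcases hE with rfl | rfl
      · exact h.elim
      · exact absurd h hne

/-- The next counter `ℓ` is reserved for marking the ends of blocks. If it is of type `B` it may
stay idle; if it is of type `S` its values must tend to infinity, so it counts the blocks of longer
and longer groups, which leaves the `ω`-terms unchanged. -/
theorem IsBlockLang.exists_not_reset {τ : ℕ → CounterType} {ℓ : ℕ} {Z : CostLang α}
    (h : IsBlockLang τ ℓ Z) : ∃ A : BlockAut α, A.Below (ℓ + 1) ∧
      (∀ q a o q', A.step q a o q' → o ℓ ≠ .reset) ∧
      ∀ L : Language α, omegaTerm L (A.rel τ (ℓ + 1)) = omegaTerm L Z := by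
  obtain ⟨A, hA, rfl⟩ := h
  have hne : ∀ q a o q', A.step q a o q' → o ℓ ≠ .reset := by
    intro q a o q' h
    rw [(hA q a o q' h).2 ℓ le_rfl]
    simp
  cases hτ : τ ℓ with
  | B => exact ⟨A, hA.mono (Nat.le_succ ℓ), hne, fun L => by rw [BlockAut.rel_succ hA hτ]⟩
  | S =>
    refine ⟨A.loop (opAt ℓ .inc), (hA.mono (Nat.le_succ _)).loop (isHierarchical_opAt _ _)
      fun j hj => opAt_of_gt hj, ?_, fun L => ?_⟩
    · rintro q a o q' (h | ⟨rfl, -⟩)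
      · exact hne q a o q' h
      · rw [opAt_self]
        simp
    · rw [BlockAut.rel_loop_inc_S hA hτ]
      exact Set.Subset.antisymm (omegaTerm_iter_subset BlockAut.costMono_rel _)
        (omegaTerm_subset_posAtLeast L)

theorem IsBlockLang.exists_omegaLang_eq {τ : ℕ → CounterType} {ℓ : ℕ} {Z : CostLang α}
    (h : IsBlockLang τ ℓ Z) (r : RegularExpression α) : ∃ W : BlockAut α, W.Below (ℓ + 1) ∧
      W.omegaLang τ (ℓ + 1) = omegaTerm r.matches' Z := by
  classical
  obtain ⟨A, hA, hres, hZ⟩ := h.exists_not_reset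
  obtain ⟨P, hP, hPr⟩ := exists_blockAut_matches' r
  have hB : (A.loop (opAt (ℓ + 1) .none)).Below (ℓ + 1) :=
    hA.loop (isHierarchical_opAt _ _) fun j hj => opAt_none_of_ge hj
  have hBl := BlockAut.omegaLang_loop (τ := τ) hres
  rw [hZ] at hBl
  have hW : (P.mul (A.loop (opAt (ℓ + 1) .none)) (opAt 0 .none)).Below (ℓ + 1) :=
    (hP.mono (Nat.zero_le _)).mul hB (isHierarchical_opAt _ _) fun j _ =>
      opAt_none_of_ge (Nat.zero_le j)
  have hWl := BlockAut.omegaLang_mul (B := A.loop (opAt (ℓ + 1) .none)) (τ := τ) (n := ℓ) hP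
  rw [hBl] at hWl
  -- Block automata do not read the empty word, so an empty prefix is handled by starting directly
  -- in the loop.
  by_cases hnil : [] ∈ r.matches'
  · refine ⟨_, hW.sum hB, ?_⟩
    rw [BlockAut.omegaLang_sum, hWl, hBl, omegaTerm_eq r.matches' Z]
    ext x
    constructor
    · rintro (⟨m, hm, hx⟩ | hx)
      · exact ⟨m, ((hPr _).1 hm).1, hx⟩
      · exact ⟨0, by rwa [seg_self], hx⟩
    · rintro ⟨m, hm, hx⟩
      rcases m.eq_zero_or_pos with rfl | hpos
      · exact Or.inr hx
      · refine Or.inl ⟨m, (hPr _).2 ⟨hm, fun he => ?_⟩, hx⟩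
        have := length_seg x.get 0 m
        rw [he, List.length_nil] at this
        omega
  · refine ⟨_, hW, ?_⟩
    rw [hWl, omegaTerm_eq r.matches' Z]
    ext x
    refine exists_congr fun m => and_congr_left fun _ => (hPr _).trans
      ⟨fun h => h.1, fun h => ⟨h, fun he => hnil (he ▸ h)⟩⟩

theorem exists_blockAut_union {τ : ℕ → CounterType} {n : ℕ} {β : Type*} {F : β → Set (Stream' α)}
    {E : List β} (h : ∀ p ∈ E, ∃ W : BlockAut α, W.Below n ∧ W.omegaLang τ n = F p) :
    ∃ W : BlockAut α, W.Below n ∧ W.omegaLang τ n = {x | ∃ p ∈ E, x ∈ F p} := by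
  induction E with
  | nil => exact ⟨.zero, fun q => q.elim, by rw [BlockAut.omegaLang_zero]; simp⟩
  | cons p E ih =>
    obtain ⟨W, hW, hW'⟩ := h p (by simp)
    obtain ⟨V, hV, hV'⟩ := ih fun q hq => h q (List.mem_cons_of_mem _ hq)
    refine ⟨W.sum V, hW.sum hV, ?_⟩
    rw [BlockAut.omegaLang_sum, hW', hV']
    ext x
    simp

theorem exists_forall_mem_le {β : Type*} (f : β → ℕ) (E : List β) : ∃ N, ∀ p ∈ E, f p ≤ N :=
  ⟨(E.map f).sum, fun _ hp => List.le_sum_of_mem (List.mem_map_of_mem hp)⟩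

/-- Regular languages are recognized by hierarchical automata. -/
theorem IsOmegaRegular.isHierarchicallyRecognized {T : Variant} {L : Set (Stream' α)}
    (h : IsOmegaRegular T L) : IsHierarchicallyRecognized T L := by
  classical
  obtain ⟨E, hE, rfl⟩ := h
  obtain ⟨D, hD, hDT⟩ : ∃ D, (∀ p ∈ E, p.2.bDepth ≤ D) ∧ (T.AllowsB ∨ D = 0) := by
    by_cases hT : T.AllowsB
    · obtain ⟨D, hD⟩ := exists_forall_mem_le (fun p : RegularExpression α × BSExpr α => p.2.bDepth) E
      exact ⟨D, hD, Or.inl hT⟩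
    · exact ⟨0, fun p hp => ((hE p hp).bDepth_eq_zero hT).le, Or.inr rfl⟩
  obtain ⟨K, hK, hKT⟩ : ∃ K, (∀ p ∈ E, p.2.sDepth ≤ K) ∧ (T.AllowsS ∨ K = 0) := by
    by_cases hT : T.AllowsS
    · obtain ⟨K, hK⟩ := exists_forall_mem_le (fun p : RegularExpression α × BSExpr α => p.2.sDepth) E
      exact ⟨K, hK, Or.inl hT⟩
    · exact ⟨0, fun p hp => ((hE p hp).sDepth_eq_zero hT).le, Or.inr rfl⟩
  -- There are `level M K D + 1` counters. Without `S`, `K = 0` and `M = D + 1`, so all `D + 1` of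
  -- them are the `B`-counters of the first group. Without `B`, `M = 0` and every counter is of type
  -- `S`.
  set M := if T.AllowsB then D + 1 else 0 with hM
  have hDM : D ≤ M := by
    rw [hM]
    split_ifs with hT
    · exact Nat.le_succ D
    · exact (hDT.resolve_left hT).le
  obtain ⟨W, hW, hWl⟩ := exists_blockAut_union (τ := groupType M) (n := level M K D + 1)
    (F := fun p : RegularExpression α × BSExpr α => omegaTerm p.1.matches' p.2.val) (E := E) (by
      intro p hp
      obtain ⟨r, Z, hZ, hr⟩ := exists_isBlockLang_omegaTerm p.1 p.2 (hD p hp) hDM (hK p hp)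
      obtain ⟨W, hW, hWl⟩ := hZ.exists_omegaLang_eq r
      exact ⟨W, hW, hWl.trans hr.symm⟩)
  rw [lang_eq_omegaTerm, ← hWl]
  refine BlockAut.isHierarchicallyRecognized (fun q a o q' h => (hW q a o q' h).1)
    fun j hj => ⟨fun hj' => ?_, fun hj' => ?_⟩
  · by_contra hT
    rw [hM, if_neg hT, groupType, if_pos (by omega)] at hj'
    cases hj'
  · by_contra hT
    have hTB : T.AllowsB := by
      cases T
      · exact Or.inl rfl
      · exact Or.inr rfl
      · exact absurd (Or.inr rfl) hT
    rw [hM, if_pos hTB, hKT.resolve_left hT] at hj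
    rw [hM, if_pos hTB] at hj'
    simp only [level, Nat.zero_mul, Nat.zero_add] at hj
    rw [groupType, Nat.mod_eq_of_lt (by omega), if_neg (by omega)] at hj'
    cases hj'

end OmegaBS

theorem theorem3p1 {α : Type*} [Finite α] (T : OmegaBS.Variant) (L : Set (Stream' α)) :
    List.TFAE [OmegaBS.IsOmegaRegular T L,
      OmegaBS.IsHierarchicallyRecognized T L,
      OmegaBS.IsRecognized T L] := by
  tfae_have 1 → 2 := fun h => h.isHierarchicallyRecognized
  tfae_have 2 → 3 := fun ⟨n, A, _, hV, hL⟩ => ⟨Fin n, inferInstance, A, hV, hL⟩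
  tfae_have 3 → 1 := fun ⟨Γ, _, A, hV, hL⟩ => hL ▸ OmegaBS.isOmegaRegular_lang hV
  tfae_finish
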